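/- Conventions. Manifolds are smooth, Hausdorff and second countable, of dimension $m\ge 1$, with possibly empty boundary. Write $\mathbb H^d=[0,\infty)\times\mathbb R^{d-1}$ and $Q=(-1,1)^m$. A chart $\kappa$ with domain $U_\kappa$ is *normalized* if $\kappa(U_\kappa)=Q$ when $U_\kappa$ lies in the interior, and $\kappa(U_\kappa)=Q\cap\mathbb H^m$ when $U_\kappa$ meets the boundary. A Riemannian manifold is *uniformly regular* if it has an atlas $\mathfrak K$ of normalized charts such that: (a) for some $r\in(0,1)$ the sets $\kappa^{-1}(r\,\kappa(U_\kappa))$, $\kappa\in\mathfrak K$, cover the manifold; (b) for some $n\in\mathbb N$ every point lies in at most $n$ of the domains $U_\kappa$; (c) for every $j\ge 0$ the derivatives of order $j$ of the coordinate changes $\tilde\kappa\circ\kappa^{-1}$ are bounded on $\kappa(U_\kappa\cap U_{\tilde\kappa})$, uniformly in $\kappa,\tilde\kappa\in\mathfrak K$; (d) there is $c\ge 1$ such that the local representation $\kappa_*g$ of the metric satisfies $|\xi|^2/c\le \kappa_*g(x)(\xi,\xi)\le c|\xi|^2$ for all $\kappa\in\mathfrak K$, $x\in\kappa(U_\kappa)$,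 $\xi\in\mathbb R^m$; (e) for every $j\ge 0$ the derivatives of order $j$ of the coefficients of $\kappa_*g$ are bounded, uniformly in $\kappa\in\mathfrak K$. **Theorem.** Let $(\mathcal M,g)$ be a uniformly regular $m$-dimensional Riemannian manifold and let $\Gamma\subset\mathcal M$ be a compact connected embedded submanifold without boundary, of codimension $\ell\ge 1$, with induced metric $g_\Gamma$, such that $\Gamma\subset\partial\mathcal M$ if $\Gamma\cap\partial\mathcal M\ne\emptyset$. Put $M=\mathcal M\setminus\Gamma$. If $\Gamma$ lies in the interior of $\mathcal M$, let $\mathbb B$ be the open unit ball of $\mathbb R^\ell$ and $\mathbb S$ the unit sphere; if $\Gamma\subset\partial\mathcal M$, let $\mathbb B$ and $\mathbb S$ be the intersections of these with $\mathbb H^\ell$. Let $g_{\mathbb B}$ and $g_{\mathbb S}$ be the metrics induced on $\mathbb B$ and $\mathbb S$ by $\mathbb R^\ell$. Let $\tau:\mathcal U\to\mathbb B\times\Gamma$ be a tubular diffeomorphism, that is, a diffeomorphism from an open neighbourhood $\mathcal U$ of $\Gamma$ in $\mathcal M$ onto $\mathbb B\times\Gamma$ with $\tau(q)=(0,q)$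 for $q\in\Gamma$, and such that $\tau_*g$ and $g_{\mathbb B}+g_\Gamma$ bound each other up to a constant factor. The canonical representation of the tubular neighbourhood $U=\mathcal U\setminus\Gamma$ of $\Gamma$ in $M$ is the diffeomorphism of $U$ onto $(0,1)\times\mathbb S\times\Gamma$ that sends $p$ with $\tau(p)=(x,q)$ to $(t,y,q)=(|x|,x/|x|,q)$. Fix $\alpha>0$, and let $\mathfrak g$ be a smooth Riemannian metric on $M$ which coincides with $g$ on $M\setminus U$ and which, on the complement of $\Gamma$ in some open neighbourhood of $\Gamma$ contained in $\mathcal U$, is given in the canonical representation by $$t^{-2}\,dt^2+t^{-2\alpha}(g_{\mathbb S}+g_\Gamma)\quad\text{if } 0<\alpha\le 1,\qquad t^{-2(\alpha+1)}\,dt^2+g_{\mathbb S}+g_\Gamma\quad\text{if }\alpha>1 .$$ Then $(M,\mathfrak g)$ is uniformly regular. -/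

import Mathlib

open Set Topology
open scoped Manifold ContDiff Pointwise

noncomputable section

/-! ### Riemannian manifolds with boundary

A smooth `m`-dimensional manifold with (possibly empty) boundary is modelled on the closed
half-space `{x | 0 ≤ x 0}` of `ℝᵐ` through `𝓡∂ m`. -/

/-- Smooth Riemannian metrics on an `m`-dimensional manifold with boundary. -/
abbrev SmoothMetric (m : ℕ) [NeZero m] (N : Type*) [TopologicalSpace N]
    [ChartedSpace (EuclideanHalfSpace m) N] [IsManifold (𝓡∂ m) ∞ N] :=
  Bundle.ContMDiffRiemannianMetric (𝓡∂ m) ∞ (EuclideanSpace ℝ (Fin m))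
    (fun p : N => TangentSpace (𝓡∂ m) p)

/-- The closed half-space `{x ∈ ℝᵈ | 0 ≤ x 0}`. -/
def halfSpaceSet (d : ℕ) [NeZero d] : Set (EuclideanSpace ℝ (Fin d)) := {x | 0 ≤ x 0}

/-- The open cube `(-1, 1)ᵐ`. -/
def openCube (m : ℕ) : Set (EuclideanSpace ℝ (Fin m)) := {x | ∀ i, x i ∈ Ioo (-1 : ℝ) 1}

section UniformRegularity

variable {m : ℕ} [NeZero m] {N : Type*} [TopologicalSpace N]
  [ChartedSpace (EuclideanHalfSpace m) N]

/-- A normalized chart `κ`: a diffeomorphism from an open set `U_κ = κ.source` onto the cube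
`Q = (-1, 1)ᵐ` if `U_κ` lies in the interior, and onto the half-cube (the cube intersected with
the closed half-space) if `U_κ` meets the boundary. -/
structure IsNormalizedChart (κ : PartialEquiv N (EuclideanSpace ℝ (Fin m))) : Prop where
  open_source : IsOpen κ.source
  smooth : ContMDiffOn (𝓡∂ m) 𝓘(ℝ, EuclideanSpace ℝ (Fin m)) ∞ κ κ.source
  smooth_symm : ContMDiffOn 𝓘(ℝ, EuclideanSpace ℝ (Fin m)) (𝓡∂ m) ∞ κ.symm κ.target
  target_of_interior : κ.source ⊆ (𝓡∂ m).interior N → κ.target = openCube m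
  target_of_boundary : (κ.source ∩ (𝓡∂ m).boundary N).Nonempty →
    κ.target = openCube m ∩ halfSpaceSet m

/-- A uniformly regular atlas: it consists of normalized charts, is shrinkable, has finite
multiplicity, and all derivatives of the coordinate changes `κ' ∘ κ⁻¹` are bounded on
`κ (U_κ ∩ U_κ')`, uniformly with respect to the charts. -/
structure IsUniformlyRegularAtlas (K : Set (PartialEquiv N (EuclideanSpace ℝ (Fin m)))) :
    Prop where
  normalized : ∀ κ ∈ K, IsNormalizedChart κ
  shrinkable : ∃ r ∈ Ioo (0 : ℝ) 1, ∀ p : N, ∃ κ ∈ K, p ∈ κ.source ∧ κ p ∈ r • κ.target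
  finite_multiplicity : ∃ n : ℕ, ∀ p : N, {κ ∈ K | p ∈ κ.source}.encard ≤ n
  transition_bounds : ∀ j : ℕ, ∃ c : ℝ, ∀ κ ∈ K, ∀ κ' ∈ K,
    ∀ x ∈ κ.target ∩ κ.symm ⁻¹' κ'.source,
      ‖iteratedFDerivWithin ℝ j (κ' ∘ κ.symm) (κ.target ∩ κ.symm ⁻¹' κ'.source) x‖ ≤ c

variable [IsManifold (𝓡∂ m) ∞ N]

/-- The local representation `κ_* g` of a metric in the chart `κ`, as a bilinear form
`(x, ξ, η) ↦ g (κ⁻¹ x) (T κ⁻¹ ξ, T κ⁻¹ η)`. -/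
def chartMetric (g : SmoothMetric m N) (κ : PartialEquiv N (EuclideanSpace ℝ (Fin m)))
    (x ξ η : EuclideanSpace ℝ (Fin m)) : ℝ :=
  g.inner (κ.symm x)
    (mfderivWithin 𝓘(ℝ, EuclideanSpace ℝ (Fin m)) (𝓡∂ m) κ.symm κ.target x ξ)
    (mfderivWithin 𝓘(ℝ, EuclideanSpace ℝ (Fin m)) (𝓡∂ m) κ.symm κ.target x η)

/-- The metric `g` is uniformly regular with respect to `K`: its local representations are
equivalent to the Euclidean metric, and all derivatives of their coefficients
`g_{ij} = κ_* g (e_i, e_j)` are bounded, uniformly with respect to `κ ∈ K`. -/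
structure IsUniformlyRegularMetric (g : SmoothMetric m N)
    (K : Set (PartialEquiv N (EuclideanSpace ℝ (Fin m)))) : Prop where
  equiv_euclidean : ∃ c : ℝ, 1 ≤ c ∧ ∀ κ ∈ K, ∀ x ∈ κ.target,
    ∀ ξ : EuclideanSpace ℝ (Fin m),
      ‖ξ‖ ^ 2 / c ≤ chartMetric g κ x ξ ξ ∧ chartMetric g κ x ξ ξ ≤ c * ‖ξ‖ ^ 2
  coeff_bounds : ∀ j : ℕ, ∃ c : ℝ, ∀ κ ∈ K, ∀ a b : Fin m, ∀ x ∈ κ.target,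
    ‖iteratedFDerivWithin ℝ j
      (fun y => chartMetric g κ y (EuclideanSpace.single a 1) (EuclideanSpace.single b 1))
      κ.target x‖ ≤ c

/-- `(N, g)` is a uniformly regular Riemannian manifold. -/
def IsUniformlyRegular (g : SmoothMetric m N) : Prop :=
  ∃ K : Set (PartialEquiv N (EuclideanSpace ℝ (Fin m))),
    IsUniformlyRegularAtlas K ∧ IsUniformlyRegularMetric g K

end UniformRegularity

section Tube

variable {m k ℓ : ℕ} [NeZero m] [NeZero ℓ]
  {N : Type*} [TopologicalSpace N] [ChartedSpace (EuclideanHalfSpace m) N]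
  {Γ : Type*} [TopologicalSpace Γ] [ChartedSpace (EuclideanSpace ℝ (Fin k)) Γ]

/-- `ι` is a smooth embedding of the boundaryless `k`-dimensional manifold `Γ` into `N`, that is,
a smooth topological embedding with injective differentials. It exhibits `range ι` as an embedded
submanifold of `N`; the image is allowed to lie in the boundary of `N`. -/
structure EmbedsSmoothly (ι : Γ → N) : Prop where
  smooth : ContMDiff (𝓡 k) (𝓡∂ m) ∞ ι
  isEmbedding : IsEmbedding ι
  injective_mfderiv : ∀ q : Γ, Function.Injective (mfderiv (𝓡 k) (𝓡∂ m) ι q)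

/-- The metric `g_Γ = ι^* g` induced on `Γ`. -/
def inducedForm [IsManifold (𝓡∂ m) ∞ N] (g : SmoothMetric m N) (ι : Γ → N) (q : Γ)
    (u v : TangentSpace (𝓡 k) q) : ℝ :=
  g.inner (ι q) (mfderiv (𝓡 k) (𝓡∂ m) ι q u) (mfderiv (𝓡 k) (𝓡∂ m) ι q v)

/-- `τ` is a tubular diffeomorphism of `Γ` in `(N, g)`: a diffeomorphism from an open neighbourhood
`τ.source` of `Γ` onto `𝔹 × Γ` with `τ q = (0, q)` on `Γ` and `τ_* g ∼ g_𝔹 + g_Γ`. Here `𝔹` is the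
open unit ball of `ℝ^ℓ` if `Γ` lies in the interior of `N`, and the half-ball if `Γ` lies in the
boundary. -/
structure IsTubularDiffeo [IsManifold (𝓡∂ m) ∞ N] (g : SmoothMetric m N) (ι : Γ → N)
    (τ : PartialEquiv N (EuclideanSpace ℝ (Fin ℓ) × Γ)) : Prop where
  open_source : IsOpen τ.source
  mem_source : ∀ q : Γ, ι q ∈ τ.source
  target_of_interior : range ι ⊆ (𝓡∂ m).interior N → τ.target = Metric.ball 0 1 ×ˢ univ
  target_of_boundary : range ι ⊆ (𝓡∂ m).boundary N →
    τ.target = (Metric.ball 0 1 ∩ halfSpaceSet ℓ) ×ˢ univ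
  smooth : ContMDiffOn (𝓡∂ m) (𝓘(ℝ, EuclideanSpace ℝ (Fin ℓ)).prod (𝓡 k)) ∞ τ τ.source
  smooth_symm : ContMDiffOn (𝓘(ℝ, EuclideanSpace ℝ (Fin ℓ)).prod (𝓡 k)) (𝓡∂ m) ∞
    τ.symm τ.target
  map_submanifold : ∀ q : Γ, τ (ι q) = (0, q)
  equiv_product : ∃ c : ℝ, 1 ≤ c ∧ ∀ p ∈ τ.source, ∀ v : TangentSpace (𝓡∂ m) p,
    let w : EuclideanSpace ℝ (Fin ℓ) × EuclideanSpace ℝ (Fin k) :=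
      mfderiv (𝓡∂ m) (𝓘(ℝ, EuclideanSpace ℝ (Fin ℓ)).prod (𝓡 k)) τ p v
    (‖w.1‖ ^ 2 + inducedForm g ι (τ p).2 w.2 w.2) / c ≤ g.inner p v v ∧
      g.inner p v v ≤ c * (‖w.1‖ ^ 2 + inducedForm g ι (τ p).2 w.2 w.2)

/-- The canonical representation `p ↦ (t, y, q) ∈ (0, 1) × S × Γ` of the punctured tube, where
`S ⊆ ℝ^ℓ` is the unit sphere or half-sphere: `τ` followed by polar coordinates
`x ↦ (|x|, x / |x|)` in the first factor. -/
def canonicalRep (τ : PartialEquiv N (EuclideanSpace ℝ (Fin ℓ) × Γ)) (p : N) :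
    ℝ × EuclideanSpace ℝ (Fin ℓ) × Γ :=
  (‖(τ p).1‖, ‖(τ p).1‖⁻¹ • (τ p).1, (τ p).2)

/-- The model metric at a point `(t, y, q)` of `(0, 1) × S × Γ`, evaluated on two tangent vectors:
`t⁻² dt² + t^(-2α) (g_S + g_Γ)` if `α ≤ 1`, and `t^(-2(α+1)) dt² + g_S + g_Γ` if `α > 1`.
As `g_S` is induced by the inclusion `S ⊆ ℝ^ℓ`, it is the Euclidean inner product on vectors
tangent to `S`. -/
def modelForm [IsManifold (𝓡∂ m) ∞ N] (g : SmoothMetric m N) (ι : Γ → N) (α : ℝ)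
    (z : ℝ × EuclideanSpace ℝ (Fin ℓ) × Γ)
    (v w : ℝ × EuclideanSpace ℝ (Fin ℓ) × EuclideanSpace ℝ (Fin k)) : ℝ :=
  if α ≤ 1 then
    z.1 ^ (-2 : ℝ) * (v.1 * w.1)
      + z.1 ^ (-2 * α) * (inner ℝ v.2.1 w.2.1 + inducedForm g ι z.2.2 v.2.2 w.2.2)
  else
    z.1 ^ (-2 * (α + 1)) * (v.1 * w.1)
      + (inner ℝ v.2.1 w.2.1 + inducedForm g ι z.2.2 v.2.2 w.2.2)

/-- Two tangent vectors to an open submanifold `M` at `p` are transported to `ℝ × ℝ^ℓ × Γ` by the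
differential of the canonical representation, and the model metric is evaluated there: this is
the pull-back of the model metric to `M`. -/
def pulledBackModelForm [IsManifold (𝓡∂ m) ∞ N] (g : SmoothMetric m N) (ι : Γ → N)
    (τ : PartialEquiv N (EuclideanSpace ℝ (Fin ℓ) × Γ)) (α : ℝ) (M : TopologicalSpace.Opens N)
    (p : M) (v w : TangentSpace (𝓡∂ m) p) : ℝ :=
  modelForm g ι α (canonicalRep τ p)
    (mfderiv (𝓡∂ m) (𝓘(ℝ, ℝ).prod (𝓘(ℝ, EuclideanSpace ℝ (Fin ℓ)).prod (𝓡 k)))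
      (fun p' : M => canonicalRep τ p') p v)
    (mfderiv (𝓡∂ m) (𝓘(ℝ, ℝ).prod (𝓘(ℝ, EuclideanSpace ℝ (Fin ℓ)).prod (𝓡 k)))
      (fun p' : M => canonicalRep τ p') p w)

/-- The restriction of a metric to an open submanifold `M`, i.e. its pull-back by the inclusion. -/
def restrictedForm [IsManifold (𝓡∂ m) ∞ N] (g : SmoothMetric m N)
    (M : TopologicalSpace.Opens N) (p : M) (v w : TangentSpace (𝓡∂ m) p) : ℝ :=
  g.inner (p : N) (mfderiv (𝓡∂ m) (𝓡∂ m) (Subtype.val : M → N) p v)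
    (mfderiv (𝓡∂ m) (𝓡∂ m) (Subtype.val : M → N) p w)

end Tube

end

/-!
The change of the radial variable to the height `s = -log t` if `α ≤ 1`, and `s = t^(-α) / α` if
`α > 1`, turns the model metric into `ds² + e^(2 β s) (g_S + g_Γ)` with `β = α` and `β = 0`
respectively (`exists_isEndProfile`, `IsEndProfile.modelForm_eq`). The charts which consist of the
height, a central projection of the sphere and a chart of `Γ` therefore describe the punctured tube
as a cylindrical end: their coordinate changes commute with translations of the height, and a
translation multiplies the cross-sectional part of the metric by a constant (`IsCylindricalEnd`,
`IsTubeEnd.isCylindricalEnd`). Finitely many of them suffice, as `Γ` is compact.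

Such an end is cut into cells of height about `1` and of width proportional to `e^(-β n)` at the
height `n`. After rescaling a cell to the unit cube, the factor `e^(2 β s)` is compensated, and
translation to a fixed height expresses the metric and the coordinate changes in terms of those on a
compact slice. This gives all the uniform bounds for the cells:
`IsCylindricalEnd.transition_bounds`, `IsCylindricalEnd.metric_elliptic` and
`IsCylindricalEnd.coeff_bounds`.

It remains to pass from the tube to the given atlas of `N`. Nothing is assumed about the new metric
between the region where it is the model and the complement of the tube, so a compactness argument
is needed there. The given metric is complete in the sense that paths of bounded speed which start
in a compact set end in a compact set (`IsUniformlyRegularAtlas.exists_compact_of_path`). As the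
tubular diffeomorphism distorts lengths by a bounded factor, the tube is relatively compact, and so
is the union of the charts which meet it (`IsTubularDiffeo.exists_compact_source_subset`,
`IsUniformlyRegularAtlas.exists_compact_source_subset`). Hence `N \ Γ` is covered by the charts of
`N` which do not meet the tube, where the metric is unchanged, by finitely many small charts
(`IsSmoothChart.exists_compactCell`), and by the cells of the end. A small chart meets only finitely
many cells, and the charts away from the tube meet none of them, so that the union is a uniformly
regular atlas (`isUniformlyRegular_of_cylindricalEnd`).
-/

noncomputable section

set_option linter.unusedSectionVars false

/-! ### Derivatives of compositions with affine maps -/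

section Calculus

variable {E F G : Type*} [NormedAddCommGroup E] [NormedSpace ℝ E] [NormedAddCommGroup F]
  [NormedSpace ℝ F] [NormedAddCommGroup G] [NormedSpace ℝ G]

/-- A bound by a power of `ε`, also for the vanishing derivatives of order at least two, so that it
has the form required by the estimate for the derivatives of a composition. -/
theorem norm_iteratedFDerivWithin_affine_le {f : E → F} {s : Set E} (hs : UniqueDiffOn ℝ s)
    {c : F} {L : E →L[ℝ] F} (hf : EqOn f (fun x => c + L x) s) {ε : ℝ} (hL : ‖L‖ ≤ ε)
    {x : E} (hx : x ∈ s) {i : ℕ} (hi : 1 ≤ i) :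
    ‖iteratedFDerivWithin ℝ i f s x‖ ≤ ε ^ i := by
  have hε : 0 ≤ ε := (norm_nonneg _).trans hL
  rw [iteratedFDerivWithin_congr hf hx]
  have hd : EqOn (fderivWithin ℝ (fun x => c + L x) s) (fun _ => L) s := fun y hy =>
    ((L.hasFDerivWithinAt (s := s) (x := y)).const_add c).fderivWithin (hs y hy)
  obtain ⟨j, rfl⟩ : ∃ j, i = j + 1 := ⟨i - 1, by omega⟩
  rw [← norm_iteratedFDerivWithin_fderivWithin hs hx, iteratedFDerivWithin_congr hd hx]
  rcases Nat.eq_zero_or_pos j with rfl | hj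
  · simpa using hL
  · rw [iteratedFDerivWithin_const_of_ne hj.ne']
    simpa using by positivity

theorem norm_iteratedFDerivWithin_comp_affine_le {g : F → G} {a : E → F} {s : Set E} {t : Set F}
    (hg : ContDiffOn ℝ ∞ g t) (ht : UniqueDiffOn ℝ t) (hs : UniqueDiffOn ℝ s)
    (hst : MapsTo a s t) {c : F} {L : E →L[ℝ] F} (ha : EqOn a (fun x => c + L x) s) {ε : ℝ}
    (hL : ‖L‖ ≤ ε) {x : E} (hx : x ∈ s) {n : ℕ} {C : ℝ}
    (hC : ∀ i ≤ n, ‖iteratedFDerivWithin ℝ i g t (a x)‖ ≤ C) :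
    ‖iteratedFDerivWithin ℝ n (g ∘ a) s x‖ ≤ n.factorial * C * ε ^ n := by
  have hsm : ContDiffOn ℝ ∞ a s :=
    (contDiff_const.add L.contDiff).contDiffOn.congr ha
  exact norm_iteratedFDerivWithin_comp_le hg hsm (by exact_mod_cast le_top) ht hs hst hx hC
    fun i hi _ => norm_iteratedFDerivWithin_affine_le hs ha hL hx hi

theorem norm_iteratedFDerivWithin_const_add_clm_le {f : E → F} {s : Set E}
    (hs : UniqueDiffOn ℝ s) (hf : ContDiffOn ℝ ∞ f s) (c : G) (L : F →L[ℝ] G) {x : E}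
    (hx : x ∈ s) {n : ℕ} (hn : 1 ≤ n) :
    ‖iteratedFDerivWithin ℝ n (fun y => c + L (f y)) s x‖
      ≤ ‖L‖ * ‖iteratedFDerivWithin ℝ n f s x‖ := by
  have hn' : (n : ℕ∞ω) ≤ (∞ : ℕ∞ω) := by exact_mod_cast le_top
  have h1 : ContDiffWithinAt ℝ n (fun _ : E => c) s x := contDiffWithinAt_const
  have h2 : ContDiffWithinAt ℝ n (L ∘ f) s x :=
    ((L.contDiff.comp_contDiffOn hf).of_le hn') x hx
  have h3 := fun_iteratedFDerivWithin_add_apply h1 h2 hs hx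
  simp only [Function.comp_apply] at h3
  rw [h3, iteratedFDerivWithin_const_of_ne (by omega)]
  have h4 := L.iteratedFDerivWithin_comp_left (hf.contDiffWithinAt hx) hs hx hn'
  rw [h4, Pi.zero_apply, zero_add]
  exact L.norm_compContinuousMultilinearMap_le _

theorem norm_iteratedFDerivWithin_add_le {f g : E → F} {s : Set E}
    (hs : UniqueDiffOn ℝ s) (hf : ContDiffOn ℝ ∞ f s) (hg : ContDiffOn ℝ ∞ g s) {x : E}
    (hx : x ∈ s) (n : ℕ) :
    ‖iteratedFDerivWithin ℝ n (fun y => f y + g y) s x‖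
      ≤ ‖iteratedFDerivWithin ℝ n f s x‖ + ‖iteratedFDerivWithin ℝ n g s x‖ := by
  have hn' : (n : ℕ∞ω) ≤ (∞ : ℕ∞ω) := by exact_mod_cast le_top
  rw [fun_iteratedFDerivWithin_add_apply ((hf.of_le hn') x hx) ((hg.of_le hn') x hx) hs hx]
  exact norm_add_le _ _

/-- A sequence of bounds can be replaced by an increasing one. -/
theorem exists_monotone_bound {P : ℕ → ℝ → Prop} (h : ∀ n, ∃ C, P n C)
    (hP : ∀ n C C', C ≤ C' → P n C → P n C') :
    ∃ C : ℕ → ℝ, Monotone C ∧ (∀ n, 0 ≤ C n) ∧ ∀ n, P n (C n) := by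
  choose C hC using h
  refine ⟨fun n => ∑ i ∈ Finset.range (n + 1), |C i|, ?_, fun n => ?_, fun n => ?_⟩
  · intro a b hab
    exact Finset.sum_le_sum_of_subset_of_nonneg (Finset.range_mono (by omega))
      fun _ _ _ => abs_nonneg _
  · positivity
  · refine hP n _ _ ((le_abs_self _).trans ?_) (hC n)
    exact Finset.single_le_sum (f := fun i => |C i|) (fun _ _ => abs_nonneg _)
      (Finset.self_mem_range_succ n)

/-- Bounds over a finite set can be made uniform. -/
theorem Set.Finite.exists_uniform_bound {ι : Type*} {S : Set ι} (hS : S.Finite)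
    {P : ι → ℝ → Prop} (h : ∀ i ∈ S, ∃ C, P i C) (hP : ∀ i C C', C ≤ C' → P i C → P i C') :
    ∃ C, ∀ i ∈ S, P i C := by
  choose! C hC using h
  obtain ⟨B, hB⟩ := (hS.image C).bddAbove
  exact ⟨B, fun i hi => hP i _ _ (hB (mem_image_of_mem C hi)) (hC i hi)⟩

end Calculus

/-! ### Charts with values in the half-space -/

section SmoothCharts

variable {m : ℕ} [NeZero m]

theorem isClosed_halfSpaceSet : IsClosed (halfSpaceSet m) := by
  have : Continuous fun x : EuclideanSpace ℝ (Fin m) => x 0 := by fun_prop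
  exact isClosed_Ici.preimage this

theorem convex_halfSpaceSet : Convex ℝ (halfSpaceSet m) := by
  intro x hx y hy a b ha hb _
  simp only [halfSpaceSet, mem_ofPred_eq, PiLp.add_apply, PiLp.smul_apply, smul_eq_mul] at *
  positivity

theorem single_mem_interior_halfSpaceSet :
    EuclideanSpace.single 0 1 ∈ interior (halfSpaceSet m) := by
  have : Continuous fun x : EuclideanSpace ℝ (Fin m) => x 0 := by fun_prop
  refine mem_interior.2 ⟨{x | 0 < x 0}, fun x hx => ?_, isOpen_Ioi.preimage this, ?_⟩
  · exact le_of_lt (show 0 < x 0 from hx)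
  · simp

theorem pos_of_mem_interior_halfSpaceSet {x : EuclideanSpace ℝ (Fin m)}
    (hx : x ∈ interior (halfSpaceSet m)) : 0 < x 0 := by
  have h1 : ∀ᶠ t : ℝ in 𝓝 0, x - t • EuclideanSpace.single 0 1 ∈ halfSpaceSet m := by
    have : Filter.Tendsto (fun t : ℝ => x - t • EuclideanSpace.single (0 : Fin m) (1 : ℝ)) (𝓝 0)
        (𝓝 (x - (0 : ℝ) • EuclideanSpace.single (0 : Fin m) (1 : ℝ))) :=
      Continuous.tendsto (by fun_prop) 0
    rw [zero_smul, sub_zero] at this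
    exact this (mem_interior_iff_mem_nhds.1 hx)
  obtain ⟨t, ht, ht0⟩ := ((h1.filter_mono nhdsWithin_le_nhds).and
    (self_mem_nhdsWithin (s := Ioi (0 : ℝ)))).exists
  have h2 : 0 ≤ x 0 - t := by simpa [halfSpaceSet] using ht
  have h3 : 0 < t := ht0
  linarith

theorem uniqueDiffOn_halfSpaceSet : UniqueDiffOn ℝ (halfSpaceSet m) :=
  uniqueDiffOn_convex convex_halfSpaceSet ⟨_, single_mem_interior_halfSpaceSet⟩

theorem isOpen_openCube : IsOpen (openCube m) := by
  have : openCube m = ⋂ i, (fun x : EuclideanSpace ℝ (Fin m) => x i) ⁻¹' Ioo (-1) 1 := by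
    ext x; simp [openCube]
  rw [this]
  exact isOpen_iInter_of_finite fun i => isOpen_Ioo.preimage (by fun_prop)

theorem norm_le_of_forall_abs_le {n : ℕ} {x : EuclideanSpace ℝ (Fin n)} {c : ℝ} (hc : 0 ≤ c)
    (hx : ∀ i, |x i| ≤ c) : ‖x‖ ≤ √n * c := by
  rw [EuclideanSpace.norm_eq]
  calc √(∑ i, ‖x i‖ ^ 2) ≤ √(∑ _i : Fin n, c ^ 2) := by
        gcongr with i
        exact hx i
    _ = √n * c := by simp [Real.sqrt_mul, Real.sqrt_sq hc]

theorem norm_le_of_mem_openCube {x : EuclideanSpace ℝ (Fin m)} (hx : x ∈ openCube m) :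
    ‖x‖ ≤ √m := by
  simpa using norm_le_of_forall_abs_le zero_le_one fun i => (abs_lt.2 (hx i)).le

theorem zero_mem_openCube : (0 : EuclideanSpace ℝ (Fin m)) ∈ openCube m := by
  intro i; simp

theorem zero_mem_halfSpaceSet : (0 : EuclideanSpace ℝ (Fin m)) ∈ halfSpaceSet m := by
  simp [halfSpaceSet]

/-- The diagonal linear map with entries `d i`. -/
def diagCLM (d : Fin m → ℝ) : EuclideanSpace ℝ (Fin m) →L[ℝ] EuclideanSpace ℝ (Fin m) :=
  LinearMap.toContinuousLinearMap
    { toFun := fun x => WithLp.toLp 2 fun i => d i * x i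
      map_add' := fun x y => by ext i; simp [mul_add]
      map_smul' := fun c x => by ext i; simp; ring }

@[simp] theorem diagCLM_apply (d : Fin m → ℝ) (x : EuclideanSpace ℝ (Fin m)) (i : Fin m) :
    diagCLM d x i = d i * x i := rfl

theorem norm_diagCLM_le {d : Fin m → ℝ} {ε : ℝ} (hε : 0 ≤ ε) (hd : ∀ i, |d i| ≤ ε) :
    ‖diagCLM d‖ ≤ ε := by
  refine ContinuousLinearMap.opNorm_le_bound _ hε fun x => ?_
  rw [EuclideanSpace.norm_eq, EuclideanSpace.norm_eq, ← Real.sqrt_sq hε,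
    ← Real.sqrt_mul (sq_nonneg ε), Finset.mul_sum]
  gcongr with i
  rw [diagCLM_apply, norm_mul, mul_pow]
  gcongr
  exact hd i

theorem diagCLM_single (d : Fin m → ℝ) (i : Fin m) (c : ℝ) :
    diagCLM d (EuclideanSpace.single i c) = d i • EuclideanSpace.single i c := by
  ext j
  by_cases h : j = i
  · subst h; simp
  · simp [h]

variable {N : Type*} [TopologicalSpace N] [ChartedSpace (EuclideanHalfSpace m) N]

/-- A chart of a manifold with boundary, with values in `ℝᵐ`: a diffeomorphism from an open set
onto a set which is open in `ℝᵐ` or in the closed half-space. -/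
structure IsSmoothChart (κ : PartialEquiv N (EuclideanSpace ℝ (Fin m))) : Prop where
  open_source : IsOpen κ.source
  smooth : ContMDiffOn (𝓡∂ m) 𝓘(ℝ, EuclideanSpace ℝ (Fin m)) ∞ κ κ.source
  smooth_symm : ContMDiffOn 𝓘(ℝ, EuclideanSpace ℝ (Fin m)) (𝓡∂ m) ∞ κ.symm κ.target
  target_eq : ∃ D, IsOpen D ∧ (κ.target = D ∨ κ.target = D ∩ halfSpaceSet m)

theorem mem_boundary_iff_notMem_interior {p : N} :
    p ∈ (𝓡∂ m).boundary N ↔ p ∉ (𝓡∂ m).interior N := by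
  rw [← ModelWithCorners.compl_interior]; rfl

theorem IsNormalizedChart.target_cases {κ : PartialEquiv N (EuclideanSpace ℝ (Fin m))}
    (h : IsNormalizedChart κ) :
    κ.target = openCube m ∨ κ.target = openCube m ∩ halfSpaceSet m := by
  by_cases hi : κ.source ⊆ (𝓡∂ m).interior N
  · exact .inl (h.target_of_interior hi)
  · obtain ⟨p, hp, hp'⟩ := not_subset.1 hi
    exact .inr (h.target_of_boundary ⟨p, hp, mem_boundary_iff_notMem_interior.2 hp'⟩)

theorem IsNormalizedChart.isSmoothChart {κ : PartialEquiv N (EuclideanSpace ℝ (Fin m))}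
    (h : IsNormalizedChart κ) : IsSmoothChart κ :=
  ⟨h.open_source, h.smooth, h.smooth_symm, openCube m, isOpen_openCube, h.target_cases⟩

theorem IsNormalizedChart.target_subset_openCube
    {κ : PartialEquiv N (EuclideanSpace ℝ (Fin m))} (h : IsNormalizedChart κ) :
    κ.target ⊆ openCube m := by
  rcases h.target_cases with h | h <;> rw [h]
  exact inter_subset_left

/-- The domain of the coordinate change `κ' ∘ κ⁻¹`. -/
def overlap (κ κ' : PartialEquiv N (EuclideanSpace ℝ (Fin m))) :
    Set (EuclideanSpace ℝ (Fin m)) := κ.target ∩ κ.symm ⁻¹' κ'.source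

namespace IsSmoothChart

variable {κ κ' : PartialEquiv N (EuclideanSpace ℝ (Fin m))}

theorem uniqueDiffOn_target (h : IsSmoothChart κ) : UniqueDiffOn ℝ κ.target := by
  obtain ⟨D, hD, h | h⟩ := h.target_eq <;> rw [h]
  · exact hD.uniqueDiffOn
  · rw [inter_comm]; exact uniqueDiffOn_halfSpaceSet.inter hD

theorem uniqueMDiffOn_target (h : IsSmoothChart κ) :
    UniqueMDiffOn 𝓘(ℝ, EuclideanSpace ℝ (Fin m)) κ.target :=
  h.uniqueDiffOn_target.uniqueMDiffOn

theorem continuousOn (h : IsSmoothChart κ) : ContinuousOn κ κ.source := h.smooth.continuousOn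

theorem continuousOn_symm (h : IsSmoothChart κ) : ContinuousOn κ.symm κ.target :=
  h.smooth_symm.continuousOn

theorem isOpen_inter_preimage (h : IsSmoothChart κ) {D : Set (EuclideanSpace ℝ (Fin m))}
    (hD : IsOpen D) : IsOpen (κ.source ∩ κ ⁻¹' D) :=
  h.continuousOn.isOpen_inter_preimage h.open_source hD

theorem exists_open_overlap (h : IsSmoothChart κ) (h' : IsSmoothChart κ') :
    ∃ D, IsOpen D ∧ overlap κ κ' = κ.target ∩ D := by
  obtain ⟨u, hu, hu'⟩ := (continuousOn_iff'.1 h.continuousOn_symm) _ h'.open_source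
  refine ⟨u, hu, ?_⟩
  rw [overlap, inter_comm, hu', inter_comm]

theorem uniqueDiffOn_overlap (h : IsSmoothChart κ) (h' : IsSmoothChart κ') :
    UniqueDiffOn ℝ (overlap κ κ') := by
  obtain ⟨D, hD, hD'⟩ := h.exists_open_overlap h'
  rw [hD']
  exact h.uniqueDiffOn_target.inter hD

theorem contDiffOn_transition (h : IsSmoothChart κ) (h' : IsSmoothChart κ') :
    ContDiffOn ℝ ∞ (κ' ∘ κ.symm) (overlap κ κ') := by
  rw [← contMDiffOn_iff_contDiffOn]
  exact h'.smooth.comp (h.smooth_symm.mono inter_subset_left) inter_subset_right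

variable [IsManifold (𝓡∂ m) ∞ N]

theorem hasMFDerivWithinAt_symm (h : IsSmoothChart κ) {x : EuclideanSpace ℝ (Fin m)}
    (hx : x ∈ κ.target) :
    HasMFDerivWithinAt 𝓘(ℝ, EuclideanSpace ℝ (Fin m)) (𝓡∂ m) κ.symm κ.target x
      (mfderivWithin 𝓘(ℝ, EuclideanSpace ℝ (Fin m)) (𝓡∂ m) κ.symm κ.target x) :=
  ((h.smooth_symm x hx).mdifferentiableWithinAt (by simp)).hasMFDerivWithinAt

theorem mdifferentiableAt (h : IsSmoothChart κ) {p : N} (hp : p ∈ κ.source) :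
    MDifferentiableAt (𝓡∂ m) 𝓘(ℝ, EuclideanSpace ℝ (Fin m)) κ p :=
  ((h.smooth p hp).contMDiffAt (h.open_source.mem_nhds hp)).mdifferentiableAt (by simp)

theorem mfderiv_symm_mfderiv (h : IsSmoothChart κ) {p : N} (hp : p ∈ κ.source)
    (v : TangentSpace (𝓡∂ m) p) :
    mfderivWithin 𝓘(ℝ, EuclideanSpace ℝ (Fin m)) (𝓡∂ m) κ.symm κ.target (κ p)
      (mfderiv (𝓡∂ m) 𝓘(ℝ, EuclideanSpace ℝ (Fin m)) κ p v) = v := by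
  have h1 := (h.hasMFDerivWithinAt_symm (κ.map_source hp)).comp p
    (h.mdifferentiableAt hp).hasMFDerivAt.hasMFDerivWithinAt
    (fun q hq => κ.map_source hq)
  have h2 := h1.hasMFDerivAt (h.open_source.mem_nhds hp)
  have h3 := (hasMFDerivAt_id (I := 𝓡∂ m) p).congr_of_eventuallyEq (f₁ := κ.symm ∘ κ)
    (Filter.eventuallyEq_of_mem (h.open_source.mem_nhds hp) fun q hq => κ.left_inv hq)
  have h4 := hasMFDerivAt_unique h2 h3
  exact congrArg (fun L => L v) h4

theorem mfderiv_mfderiv_symm (h : IsSmoothChart κ) {x : EuclideanSpace ℝ (Fin m)}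
    (hx : x ∈ κ.target) (v : EuclideanSpace ℝ (Fin m)) :
    mfderiv (𝓡∂ m) 𝓘(ℝ, EuclideanSpace ℝ (Fin m)) κ (κ.symm x)
      (mfderivWithin 𝓘(ℝ, EuclideanSpace ℝ (Fin m)) (𝓡∂ m) κ.symm κ.target x v) = v := by
  have h1 := (h.mdifferentiableAt (κ.map_target hx)).hasMFDerivAt.comp_hasMFDerivWithinAt x
    (h.hasMFDerivWithinAt_symm hx)
  have h3 := (hasMFDerivWithinAt_id (I := 𝓘(ℝ, EuclideanSpace ℝ (Fin m))) κ.target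
    x).congr_of_eventuallyEq (f₁ := κ ∘ κ.symm)
    (Filter.eventuallyEq_of_mem self_mem_nhdsWithin fun q hq => κ.right_inv hq) (κ.right_inv hx)
  have h4 := (h.uniqueMDiffOn_target x hx).eq h1 h3
  exact congrArg (fun L => L v) h4

/-- A chart with values in `ℝᵐ` is not a chart for the model `𝓡∂ m`, hence it takes an argument to
see that it distinguishes interior points: `κ⁻¹` has a surjective differential. -/
theorem mem_interior_of_target_mem_nhds (h : IsSmoothChart κ) {x : EuclideanSpace ℝ (Fin m)}
    (hx : κ.target ∈ 𝓝 x) : κ.symm x ∈ (𝓡∂ m).interior N := by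
  have hxt := mem_of_mem_nhds hx
  have h1 : MDifferentiableAt 𝓘(ℝ, EuclideanSpace ℝ (Fin m)) (𝓡∂ m) κ.symm x :=
    ((h.smooth_symm x hxt).contMDiffAt hx).mdifferentiableAt (by simp)
  refine h1.isInteriorPoint_of_surjective_mfderiv (fun v => ?_)
    (BoundarylessManifold.isInteriorPoint (I := 𝓘(ℝ, EuclideanSpace ℝ (Fin m))))
  refine ⟨mfderiv (𝓡∂ m) 𝓘(ℝ, EuclideanSpace ℝ (Fin m)) κ (κ.symm x) v, ?_⟩
  have h2 := h.mfderiv_symm_mfderiv (κ.map_target hxt) v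
  rw [κ.right_inv hxt] at h2
  rwa [mfderivWithin_of_mem_nhds hx] at h2

/-- A chart with values in the half-space maps no interior point to the bounding hyperplane, since a
map with surjective differential is open. -/
theorem notMem_interior_of_apply_zero (h : IsSmoothChart κ) (hsub : κ.target ⊆ halfSpaceSet m)
    {p : N} (hp : p ∈ κ.source) (h0 : κ p 0 = 0) : p ∉ (𝓡∂ m).interior N := by
  intro hint
  have hκ := h.mdifferentiableAt hp
  have hsurj : Function.Surjective (mfderiv (𝓡∂ m) 𝓘(ℝ, EuclideanSpace ℝ (Fin m)) κ p) := by
    intro v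
    refine ⟨mfderivWithin 𝓘(ℝ, EuclideanSpace ℝ (Fin m)) (𝓡∂ m) κ.symm κ.target (κ p) v, ?_⟩
    have := h.mfderiv_mfderiv_symm (κ.map_source hp) v
    rwa [κ.left_inv hp] at this
  -- In a chart of the manifold around the interior point `p`, the map `κ` is differentiable in the
  -- ordinary sense, with surjective differential, and takes values in the half-space.
  have hd := hκ.differentiableWithinAt_writtenInExtChartAt.differentiableAt
    (range_mem_nhds_isInteriorPoint hint)
  simp only [mfderiv, hκ] at hsurj
  rw [fderivWithin_eq_fderiv ((𝓡∂ m).uniqueDiffOn _ (by simp)) hd] at hsurj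
  have hu : (extChartAt (𝓡∂ m) p).symm ⁻¹' κ.source ∈ 𝓝 (extChartAt (𝓡∂ m) p p) :=
    extChartAt_preimage_mem_nhds (h.open_source.mem_nhds hp)
  have hmaps : MapsTo (writtenInExtChartAt (𝓡∂ m) 𝓘(ℝ, EuclideanSpace ℝ (Fin m)) p κ)
      ((extChartAt (𝓡∂ m) p).symm ⁻¹' κ.source) (halfSpaceSet m) := by
    intro y hy
    exact hsub (κ.map_source hy)
  have := hd.mem_interior_convex_of_surjective_fderiv hu convex_halfSpaceSet
    isClosed_halfSpaceSet ⟨EuclideanSpace.single 0 1, single_mem_interior_halfSpaceSet⟩ hmaps hsurj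
  have h1 : κ p ∈ interior (halfSpaceSet m) := by
    have he : writtenInExtChartAt (𝓡∂ m) 𝓘(ℝ, EuclideanSpace ℝ (Fin m)) p κ
        (extChartAt (𝓡∂ m) p p) = κ p := by
      change κ ((extChartAt (𝓡∂ m) p).symm (extChartAt (𝓡∂ m) p p)) = κ p
      rw [extChartAt_to_inv]
    rwa [he] at this
  exact (pos_of_mem_interior_halfSpaceSet h1).ne' h0

end IsSmoothChart
end SmoothCharts

/-! ### Affine cells of charts -/

section Cells

variable {m : ℕ} [NeZero m] {N : Type*} [TopologicalSpace N]
  [ChartedSpace (EuclideanHalfSpace m) N]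

/-- The inverse of the affine map `x ↦ c + d x`, where `d` is diagonal. -/
def cellCoord (c : EuclideanSpace ℝ (Fin m)) (d : Fin m → ℝ) (y : EuclideanSpace ℝ (Fin m)) :
    EuclideanSpace ℝ (Fin m) := diagCLM (fun i => (d i)⁻¹) (y - c)

@[simp] theorem cellCoord_apply (c : EuclideanSpace ℝ (Fin m)) (d : Fin m → ℝ)
    (y : EuclideanSpace ℝ (Fin m)) (i : Fin m) :
    cellCoord c d y i = (d i)⁻¹ * (y i - c i) := rfl

theorem cellCoord_add_diagCLM {c : EuclideanSpace ℝ (Fin m)} {d : Fin m → ℝ} (hd : ∀ i, 0 < d i)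
    (x : EuclideanSpace ℝ (Fin m)) : cellCoord c d (c + diagCLM d x) = x := by
  ext i
  simp [(hd i).ne']

theorem add_diagCLM_cellCoord {c : EuclideanSpace ℝ (Fin m)} {d : Fin m → ℝ} (hd : ∀ i, 0 < d i)
    (y : EuclideanSpace ℝ (Fin m)) : c + diagCLM d (cellCoord c d y) = y := by
  ext i
  simp [(hd i).ne']

theorem contDiff_cellCoord (c : EuclideanSpace ℝ (Fin m)) (d : Fin m → ℝ) :
    ContDiff ℝ ∞ (cellCoord c d) :=
  (diagCLM fun i => (d i)⁻¹).contDiff.comp (contDiff_id.sub contDiff_const)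

/-- The chart `κ'` is obtained from `κ` by restriction and by the affine change of coordinates
`x ↦ c + d x`, where `d` is a positive diagonal matrix. -/
structure IsCell (κ' κ : PartialEquiv N (EuclideanSpace ℝ (Fin m)))
    (c : EuclideanSpace ℝ (Fin m)) (d : Fin m → ℝ) : Prop where
  pos : ∀ i, 0 < d i
  source_subset : κ'.source ⊆ κ.source
  apply_eq : ∀ p ∈ κ'.source, κ p = c + diagCLM d (κ' p)

theorem IsCell.refl (κ : PartialEquiv N (EuclideanSpace ℝ (Fin m))) :
    IsCell κ κ 0 fun _ => 1 :=
  ⟨fun _ => one_pos, subset_rfl, fun p _ => by ext; simp⟩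

section

variable {κ' κ : PartialEquiv N (EuclideanSpace ℝ (Fin m))} {c : EuclideanSpace ℝ (Fin m)}
  {d : Fin m → ℝ}

theorem IsCell.mem_target (h : IsCell κ' κ c d) {x : EuclideanSpace ℝ (Fin m)}
    (hx : x ∈ κ'.target) : c + diagCLM d x ∈ κ.target := by
  have := κ.map_source (h.source_subset (κ'.map_target hx))
  rwa [h.apply_eq _ (κ'.map_target hx), κ'.right_inv hx] at this

theorem IsCell.symm_apply (h : IsCell κ' κ c d) {x : EuclideanSpace ℝ (Fin m)}
    (hx : x ∈ κ'.target) : κ.symm (c + diagCLM d x) = κ'.symm x := by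
  have := κ.left_inv (h.source_subset (κ'.map_target hx))
  rwa [h.apply_eq _ (κ'.map_target hx), κ'.right_inv hx] at this

theorem IsCell.eq_cellCoord (h : IsCell κ' κ c d) {p : N} (hp : p ∈ κ'.source) :
    κ' p = cellCoord c d (κ p) := by
  rw [h.apply_eq p hp, cellCoord_add_diagCLM h.pos]

end

/-- The part of the chart `κ` over the image of `T` under `x ↦ c + d x`, reparametrized by `T`. -/
def cellChart (κ : PartialEquiv N (EuclideanSpace ℝ (Fin m))) (c : EuclideanSpace ℝ (Fin m))
    {d : Fin m → ℝ} (hd : ∀ i, 0 < d i) {T : Set (EuclideanSpace ℝ (Fin m))}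
    (hT : ∀ x ∈ T, c + diagCLM d x ∈ κ.target) : PartialEquiv N (EuclideanSpace ℝ (Fin m)) where
  toFun p := cellCoord c d (κ p)
  invFun x := κ.symm (c + diagCLM d x)
  source := {p ∈ κ.source | cellCoord c d (κ p) ∈ T}
  target := T
  map_source' _ hp := hp.2
  map_target' x hx := ⟨κ.map_target (hT x hx), by
    rwa [κ.right_inv (hT x hx), cellCoord_add_diagCLM hd]⟩
  left_inv' p hp := by rw [add_diagCLM_cellCoord hd, κ.left_inv hp.1]
  right_inv' x hx := by rw [κ.right_inv (hT x hx), cellCoord_add_diagCLM hd]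

section

variable {κ : PartialEquiv N (EuclideanSpace ℝ (Fin m))} {c : EuclideanSpace ℝ (Fin m)}
  {d : Fin m → ℝ} {hd : ∀ i, 0 < d i} {T : Set (EuclideanSpace ℝ (Fin m))}
  {hT : ∀ x ∈ T, c + diagCLM d x ∈ κ.target}

theorem isCell_cellChart : IsCell (cellChart κ c hd hT) κ c d :=
  ⟨hd, fun _ hp => hp.1, fun _ _ => (add_diagCLM_cellCoord hd _).symm⟩

theorem isSmoothChart_cellChart (h : IsSmoothChart κ) {D : Set (EuclideanSpace ℝ (Fin m))}
    (hD : IsOpen D) (hT' : T = D ∨ T = D ∩ halfSpaceSet m)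
    (hDT : ∀ y ∈ κ.target, cellCoord c d y ∈ D → cellCoord c d y ∈ T) :
    IsSmoothChart (cellChart κ c hd hT) where
  open_source := by
    have hD' : IsOpen (cellCoord c d ⁻¹' D) := hD.preimage (contDiff_cellCoord c d).continuous
    convert h.isOpen_inter_preimage hD' using 1
    ext p
    refine ⟨fun hp => ⟨hp.1, ?_⟩, fun hp => ⟨hp.1, hDT _ (κ.map_source hp.1) hp.2⟩⟩
    rcases hT' with hT' | hT'
    · exact hT' ▸ hp.2
    · have h2 := hp.2
      rw [hT'] at h2
      exact h2.1
  smooth := (contDiff_cellCoord c d).contMDiff.comp_contMDiffOn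
    (h.smooth.mono fun _ hp => hp.1)
  smooth_symm := h.smooth_symm.comp
    ((contDiff_const.add (diagCLM d).contDiff).contMDiff.contMDiffOn) hT
  target_eq := ⟨D, hD, hT'⟩

variable [IsManifold (𝓡∂ m) ∞ N]

theorem IsSmoothChart.isNormalizedChart_of_openCube (h : IsSmoothChart κ)
    (ht : κ.target = openCube m) : IsNormalizedChart κ where
  open_source := h.open_source
  smooth := h.smooth
  smooth_symm := h.smooth_symm
  target_of_interior _ := ht
  target_of_boundary := by
    rintro ⟨p, hp, hp'⟩
    have := h.mem_interior_of_target_mem_nhds (x := κ p)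
      ((ht ▸ isOpen_openCube).mem_nhds (κ.map_source hp))
    rw [κ.left_inv hp] at this
    exact absurd this (mem_boundary_iff_notMem_interior.1 hp')

/-- If the target is the half-cube, the domain cannot lie in the interior, as it contains the point
with the coordinates `0`. -/
theorem IsSmoothChart.isNormalizedChart_of_halfCube (h : IsSmoothChart κ)
    (ht : κ.target = openCube m ∩ halfSpaceSet m) : IsNormalizedChart κ where
  open_source := h.open_source
  smooth := h.smooth
  smooth_symm := h.smooth_symm
  target_of_interior hi := by
    have h0 : (0 : EuclideanSpace ℝ (Fin m)) ∈ κ.target := by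
      rw [ht]; exact ⟨zero_mem_openCube, zero_mem_halfSpaceSet⟩
    refine absurd (hi (κ.map_target h0)) (h.notMem_interior_of_apply_zero ?_ (κ.map_target h0) ?_)
    · rw [ht]; exact inter_subset_right
    · rw [κ.right_inv h0]; rfl
  target_of_boundary _ := ht

end

end Cells

/-! ### Charts of open submanifolds -/

section Opens

variable {m : ℕ} [NeZero m] {N : Type*} [TopologicalSpace N]
  [ChartedSpace (EuclideanHalfSpace m) N]
  (M : TopologicalSpace.Opens N) [Nonempty M]

open Classical in
/-- The restriction of a chart to an open submanifold. -/
def restrictOpens (κ : PartialEquiv N (EuclideanSpace ℝ (Fin m))) :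
    PartialEquiv M (EuclideanSpace ℝ (Fin m)) where
  toFun p := κ p
  invFun x := if h : κ.symm x ∈ M then ⟨κ.symm x, h⟩ else Classical.arbitrary M
  source := {p | (p : N) ∈ κ.source}
  target := {x ∈ κ.target | κ.symm x ∈ M}
  map_source' p hp := ⟨κ.map_source hp, by
    rw [κ.left_inv hp]; exact p.2⟩
  map_target' x hx := by
    have : κ.symm x ∈ M := hx.2
    simp only [this, dite_true]
    exact κ.map_target hx.1
  left_inv' p hp := by
    have : κ.symm (κ p) = p := κ.left_inv hp
    simp [this]
  right_inv' x hx := by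
    have : κ.symm x ∈ M := hx.2
    simp only [this, dite_true]
    exact κ.right_inv hx.1

variable {M} {κ κ' : PartialEquiv N (EuclideanSpace ℝ (Fin m))}

theorem restrictOpens_symm_apply {x : EuclideanSpace ℝ (Fin m)}
    (hx : x ∈ (restrictOpens M κ).target) : ((restrictOpens M κ).symm x : N) = κ.symm x := by
  have h : (restrictOpens M κ).symm x = ⟨κ.symm x, hx.2⟩ := dif_pos hx.2
  rw [h]

theorem IsSmoothChart.restrictOpens (h : IsSmoothChart κ) :
    IsSmoothChart (restrictOpens M κ) where
  open_source := h.open_source.preimage continuous_subtype_val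
  smooth := h.smooth.comp contMDiff_subtype_val.contMDiffOn fun _ hp => hp
  smooth_symm := by
    intro x hx
    rw [← ContMDiffWithinAt.subtypeVal_comp_iff]
    exact ((h.smooth_symm.mono fun y hy => hy.1) x hx).congr
      (fun y hy => restrictOpens_symm_apply hy) (restrictOpens_symm_apply hx)
  target_eq := by
    obtain ⟨u, hu, hu'⟩ := (continuousOn_iff'.1 h.continuousOn_symm) _ M.isOpen
    obtain ⟨D, hD, hD'⟩ := h.target_eq
    have : (_root_.restrictOpens M κ).target = κ.target ∩ u := by
      rw [inter_comm, ← hu', inter_comm]; rfl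
    refine ⟨D ∩ u, hD.inter hu, ?_⟩
    rcases hD' with hD' | hD'
    · left; rw [this, hD']
    · right; rw [this, hD', inter_right_comm]

theorem overlap_restrictOpens :
    overlap (restrictOpens M κ) (restrictOpens M κ') = overlap κ κ' ∩ {x | κ.symm x ∈ M} := by
  ext x
  simp only [overlap, mem_inter_iff, mem_preimage]
  constructor
  · rintro ⟨h1, h2⟩
    have h3 : ((restrictOpens M κ).symm x : N) ∈ κ'.source := h2
    rw [restrictOpens_symm_apply h1] at h3
    exact ⟨⟨h1.1, h3⟩, h1.2⟩
  · rintro ⟨⟨h1, h2⟩, h3⟩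
    have h4 : x ∈ (restrictOpens M κ).target := ⟨h1, h3⟩
    refine ⟨h4, ?_⟩
    change ((restrictOpens M κ).symm x : N) ∈ κ'.source
    rwa [restrictOpens_symm_apply h4]

/-- The coordinate changes of the restricted charts are restrictions to relatively open sets, so the
bounds for their derivatives are inherited. -/
theorem iteratedFDerivWithin_restrictOpens (h : IsSmoothChart κ)
    {x : EuclideanSpace ℝ (Fin m)}
    (hx : x ∈ overlap (restrictOpens M κ) (restrictOpens M κ')) (j : ℕ) :
    iteratedFDerivWithin ℝ j (restrictOpens M κ' ∘ (restrictOpens M κ).symm)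
      (overlap (restrictOpens M κ) (restrictOpens M κ')) x
      = iteratedFDerivWithin ℝ j (κ' ∘ κ.symm) (overlap κ κ') x := by
  obtain ⟨u, hu, hu'⟩ := (continuousOn_iff'.1 h.continuousOn_symm) _ M.isOpen
  have he : overlap (restrictOpens M κ) (restrictOpens M κ') = overlap κ κ' ∩ u := by
    rw [overlap_restrictOpens]
    ext y
    refine and_congr_right fun hy => ?_
    have : (y ∈ κ.symm ⁻¹' M ∩ κ.target) ↔ y ∈ u ∩ κ.target := by rw [hu']
    simpa [hy.1] using this
  have hc : EqOn (restrictOpens M κ' ∘ (restrictOpens M κ).symm) (κ' ∘ κ.symm)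
      (overlap (restrictOpens M κ) (restrictOpens M κ')) := fun y hy => by
    change κ' ((restrictOpens M κ).symm y : N) = κ' (κ.symm y)
    rw [restrictOpens_symm_apply hy.1]
  rw [iteratedFDerivWithin_congr hc hx, he]
  rw [he] at hx
  exact iteratedFDerivWithin_inter_open hu hx.2

end Opens

/-! ### Bounds for coordinate changes -/

section Transitions

variable {m : ℕ} [NeZero m] {N : Type*} [TopologicalSpace N]
  [ChartedSpace (EuclideanHalfSpace m) N]

theorem IsCell.mapsTo_overlap {κ₁ κ₁' κ₂ κ₂' : PartialEquiv N (EuclideanSpace ℝ (Fin m))}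
    {c₁ c₂ : EuclideanSpace ℝ (Fin m)} {d₁ d₂ : Fin m → ℝ} (hc₁ : IsCell κ₁' κ₁ c₁ d₁)
    (hc₂ : IsCell κ₂' κ₂ c₂ d₂) :
    MapsTo (fun x => c₁ + diagCLM d₁ x) (overlap κ₁' κ₂') (overlap κ₁ κ₂) := by
  intro x hx
  refine ⟨hc₁.mem_target hx.1, ?_⟩
  rw [mem_preimage, hc₁.symm_apply hx.1]
  exact hc₂.source_subset hx.2

/-- The derivatives of a coordinate change between cells: those of the coordinate change between the
original charts, scaled by the sizes of the cells. -/
theorem IsCell.norm_transition_le {κ₁ κ₁' κ₂ κ₂' : PartialEquiv N (EuclideanSpace ℝ (Fin m))}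
    {c₁ c₂ : EuclideanSpace ℝ (Fin m)} {d₁ d₂ : Fin m → ℝ}
    (h₁ : IsSmoothChart κ₁) (h₁' : IsSmoothChart κ₁') (h₂ : IsSmoothChart κ₂)
    (h₂' : IsSmoothChart κ₂') (hc₁ : IsCell κ₁' κ₁ c₁ d₁) (hc₂ : IsCell κ₂' κ₂ c₂ d₂)
    {Λ₁ Λ₂ C : ℝ} (hΛ₁ : ∀ i, d₁ i ≤ Λ₁) (hΛ₂ : ∀ i, (d₂ i)⁻¹ ≤ Λ₂)
    {x : EuclideanSpace ℝ (Fin m)} (hx : x ∈ overlap κ₁' κ₂') {j : ℕ} (hj : 1 ≤ j)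
    (hC : ∀ i ≤ j, ‖iteratedFDerivWithin ℝ i (κ₂ ∘ κ₁.symm) (overlap κ₁ κ₂)
      (c₁ + diagCLM d₁ x)‖ ≤ C) :
    ‖iteratedFDerivWithin ℝ j (κ₂' ∘ κ₁'.symm) (overlap κ₁' κ₂') x‖
      ≤ Λ₂ * (j.factorial * C * Λ₁ ^ j) := by
  have hΛ₁0 : 0 ≤ Λ₁ := (hc₁.pos 0).le.trans (hΛ₁ 0)
  have hΛ₂0 : 0 ≤ Λ₂ := (inv_pos.2 (hc₂.pos 0)).le.trans (hΛ₂ 0)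
  have hs := h₁'.uniqueDiffOn_overlap h₂'
  have hmaps := hc₁.mapsTo_overlap hc₂
  have hsm : ContDiffOn ℝ ∞ ((κ₂ ∘ κ₁.symm) ∘ fun x => c₁ + diagCLM d₁ x) (overlap κ₁' κ₂') :=
    (h₁.contDiffOn_transition h₂).comp
      (contDiff_const.add (diagCLM d₁).contDiff).contDiffOn hmaps
  have heq : EqOn (κ₂' ∘ κ₁'.symm)
      (fun y => -(diagCLM (fun i => (d₂ i)⁻¹) c₂) + diagCLM (fun i => (d₂ i)⁻¹)
        (((κ₂ ∘ κ₁.symm) ∘ fun x => c₁ + diagCLM d₁ x) y)) (overlap κ₁' κ₂') := by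
    intro y hy
    simp only [Function.comp_apply]
    rw [hc₁.symm_apply hy.1, hc₂.eq_cellCoord hy.2, cellCoord, map_sub]
    abel
  rw [iteratedFDerivWithin_congr heq hx]
  refine (norm_iteratedFDerivWithin_const_add_clm_le hs hsm _ _ hx hj).trans ?_
  refine mul_le_mul (norm_diagCLM_le hΛ₂0 fun i => ?_) ?_ (norm_nonneg _) hΛ₂0
  · rw [abs_of_pos (inv_pos.2 (hc₂.pos i))]; exact hΛ₂ i
  · refine norm_iteratedFDerivWithin_comp_affine_le (h₁.contDiffOn_transition h₂)
      (h₁.uniqueDiffOn_overlap h₂) hs hmaps (fun _ _ => rfl) (norm_diagCLM_le hΛ₁0 fun i => ?_)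
      hx hC
    rw [abs_of_pos (hc₁.pos i)]; exact hΛ₁ i

/-- The coordinate changes themselves, that is, their derivatives of order zero, are bounded because
the targets of normalized charts are. -/
theorem norm_transition_zero_le {κ κ' : PartialEquiv N (EuclideanSpace ℝ (Fin m))}
    (h : κ'.target ⊆ openCube m) {x : EuclideanSpace ℝ (Fin m)} (hx : x ∈ overlap κ κ') :
    ‖iteratedFDerivWithin ℝ 0 (κ' ∘ κ.symm) (overlap κ κ') x‖ ≤ √m := by
  rw [norm_iteratedFDerivWithin_zero]
  exact norm_le_of_mem_openCube (h (κ'.map_source hx.2))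

/-- Coordinate changes have bounded derivatives where they map a compact set to a compact set. As
the manifold is a Hausdorff space, the images of the two compact sets intersect in a compact set. -/
theorem exists_bound_transition_of_isCompact [T2Space N]
    {κ₁ κ₂ : PartialEquiv N (EuclideanSpace ℝ (Fin m))} (h₁ : IsSmoothChart κ₁)
    (h₂ : IsSmoothChart κ₂) {Q₁ Q₂ : Set (EuclideanSpace ℝ (Fin m))} (hQ₁ : IsCompact Q₁)
    (hQ₁' : Q₁ ⊆ κ₁.target) (hQ₂ : IsCompact Q₂) (hQ₂' : Q₂ ⊆ κ₂.target) :
    ∃ C : ℕ → ℝ, Monotone C ∧ (∀ j, 0 ≤ C j) ∧ ∀ j, ∀ x ∈ Q₁, κ₁.symm x ∈ κ₂.source →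
      κ₂ (κ₁.symm x) ∈ Q₂ →
      ‖iteratedFDerivWithin ℝ j (κ₂ ∘ κ₁.symm) (overlap κ₁ κ₂) x‖ ≤ C j := by
  refine exists_monotone_bound (P := fun j C => ∀ x ∈ Q₁, κ₁.symm x ∈ κ₂.source →
      κ₂ (κ₁.symm x) ∈ Q₂ → ‖iteratedFDerivWithin ℝ j (κ₂ ∘ κ₁.symm) (overlap κ₁ κ₂) x‖ ≤ C)
    (fun j => ?_) fun n C C' hCC h x hx hx1 hx2 => (h x hx hx1 hx2).trans hCC
  have hK₁ : IsCompact (κ₁.symm '' Q₁) := hQ₁.image_of_continuousOn (h₁.continuousOn_symm.mono hQ₁')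
  have hK₂ : IsCompact (κ₂.symm '' Q₂) := hQ₂.image_of_continuousOn (h₂.continuousOn_symm.mono hQ₂')
  have hK := hK₁.inter hK₂
  have hsub₁ : κ₁.symm '' Q₁ ⊆ κ₁.source := by
    rintro _ ⟨y, hy, rfl⟩; exact κ₁.map_target (hQ₁' hy)
  have hsub₂ : κ₂.symm '' Q₂ ⊆ κ₂.source := by
    rintro _ ⟨y, hy, rfl⟩; exact κ₂.map_target (hQ₂' hy)
  have hZ : IsCompact (κ₁ '' (κ₁.symm '' Q₁ ∩ κ₂.symm '' Q₂)) :=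
    hK.image_of_continuousOn (h₁.continuousOn.mono (inter_subset_left.trans hsub₁))
  have hZ' : κ₁ '' (κ₁.symm '' Q₁ ∩ κ₂.symm '' Q₂) ⊆ overlap κ₁ κ₂ := by
    rintro _ ⟨p, hp, rfl⟩
    refine ⟨κ₁.map_source (hsub₁ hp.1), ?_⟩
    rw [mem_preimage, κ₁.left_inv (hsub₁ hp.1)]
    exact hsub₂ hp.2
  have hcont : ContinuousOn (iteratedFDerivWithin ℝ j (κ₂ ∘ κ₁.symm) (overlap κ₁ κ₂))
      (overlap κ₁ κ₂) := (h₁.contDiffOn_transition h₂).continuousOn_iteratedFDerivWithin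
        (by exact_mod_cast le_top) (h₁.uniqueDiffOn_overlap h₂)
  obtain ⟨C, hC⟩ := hZ.exists_bound_of_continuousOn (hcont.mono hZ')
  refine ⟨C, fun x hx hx1 hx2 => hC x ⟨κ₁.symm x, ⟨mem_image_of_mem _ hx, ?_⟩,
    κ₁.right_inv (hQ₁' hx)⟩⟩
  exact ⟨_, hx2, κ₂.left_inv hx1⟩

end Transitions

/-! ### Local representations of a metric -/

section Metric

variable {m : ℕ} [NeZero m] {N : Type*} [TopologicalSpace N]
  [ChartedSpace (EuclideanHalfSpace m) N] [IsManifold (𝓡∂ m) ∞ N]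

/-- The coefficients of the pull-back of a metric by a smooth map are smooth. -/
theorem contDiffOn_pullback_metric {E' : Type*} [NormedAddCommGroup E'] [NormedSpace ℝ E']
    (g : SmoothMetric m N) {F : E' → N} {s : Set E'} (hs : UniqueDiffOn ℝ s)
    (hF : ContMDiffOn 𝓘(ℝ, E') (𝓡∂ m) ∞ F s) (ξ η : E') :
    ContDiffOn ℝ ∞ (fun x => g.inner (F x) (mfderivWithin 𝓘(ℝ, E') (𝓡∂ m) F s x ξ)
      (mfderivWithin 𝓘(ℝ, E') (𝓡∂ m) F s x η)) s := by
  have hv : ∀ ξ : E', ContMDiffOn 𝓘(ℝ, E') ((𝓡∂ m).prod 𝓘(ℝ, EuclideanSpace ℝ (Fin m))) ∞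
      (fun x => Bundle.TotalSpace.mk' (EuclideanSpace ℝ (Fin m)) (F x)
        (mfderivWithin 𝓘(ℝ, E') (𝓡∂ m) F s x ξ : TangentSpace (𝓡∂ m) (F x))) s := by
    intro ξ
    have h1 := hF.contMDiffOn_tangentMapWithin (m := ∞) (by simp) hs.uniqueMDiffOn
    have h2 : ContMDiff 𝓘(ℝ, E') (𝓘(ℝ, E').prod 𝓘(ℝ, E')) ∞
        (fun x : E' => (Bundle.TotalSpace.mk' E' x ξ : TangentBundle 𝓘(ℝ, E') E')) := by
      have : ContDiff ℝ ∞ (fun _ : E' => ξ) := contDiff_const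
      exact contMDiff_vectorSpace_iff_contDiff.2 this
    exact h1.comp h2.contMDiffOn fun x hx => hx
  have hg : ContMDiffOn 𝓘(ℝ, E') ((𝓡∂ m).prod 𝓘(ℝ, EuclideanSpace ℝ (Fin m) →L[ℝ]
      EuclideanSpace ℝ (Fin m) →L[ℝ] ℝ)) ∞
      (fun x => Bundle.TotalSpace.mk' (EuclideanSpace ℝ (Fin m) →L[ℝ]
        EuclideanSpace ℝ (Fin m) →L[ℝ] ℝ)
        (E := fun p : N => TangentSpace (𝓡∂ m) p →L[ℝ] TangentSpace (𝓡∂ m) p →L[ℝ] ℝ)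
        (F x) (g.inner (F x))) s := g.contMDiff.comp_contMDiffOn hF
  have := hg.clm_bundle_apply₂ (F₃ := ℝ) (E₃ := Bundle.Trivial N ℝ) (hv ξ) (hv η)
  rw [← contMDiffOn_iff_contDiffOn]
  intro x hx
  have := this x hx
  simp only [Bundle.contMDiffWithinAt_totalSpace] at this
  exact this.2

theorem IsSmoothChart.contDiffOn_chartMetric {κ : PartialEquiv N (EuclideanSpace ℝ (Fin m))}
    (h : IsSmoothChart κ) (g : SmoothMetric m N) (ξ η : EuclideanSpace ℝ (Fin m)) :
    ContDiffOn ℝ ∞ (fun x => chartMetric g κ x ξ η) κ.target :=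
  contDiffOn_pullback_metric g h.uniqueDiffOn_target h.smooth_symm ξ η

/-- The inner product at `p` only depends on `p`, although the tangent spaces at different points
are formally different types. -/
theorem metric_inner_congr (g : SmoothMetric m N) {p q : N} (h : p = q)
    {u v u' v' : EuclideanSpace ℝ (Fin m)} (hu : u = u') (hv : v = v') :
    g.inner p u v = g.inner q u' v' := by
  subst h hu hv; rfl

/-- The local representation of a metric in a chart, as a continuous bilinear form on `ℝᵐ`. -/
def chartForm (g : SmoothMetric m N) (κ : PartialEquiv N (EuclideanSpace ℝ (Fin m)))
    (x : EuclideanSpace ℝ (Fin m)) :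
    EuclideanSpace ℝ (Fin m) →L[ℝ] EuclideanSpace ℝ (Fin m) →L[ℝ] ℝ :=
  ContinuousLinearMap.bilinearComp (E := EuclideanSpace ℝ (Fin m))
    (F := EuclideanSpace ℝ (Fin m)) (g.inner (κ.symm x))
    (mfderivWithin 𝓘(ℝ, EuclideanSpace ℝ (Fin m)) (𝓡∂ m) κ.symm κ.target x)
    (mfderivWithin 𝓘(ℝ, EuclideanSpace ℝ (Fin m)) (𝓡∂ m) κ.symm κ.target x)

theorem chartMetric_eq_chartForm (g : SmoothMetric m N)
    (κ : PartialEquiv N (EuclideanSpace ℝ (Fin m))) (x ξ η : EuclideanSpace ℝ (Fin m)) :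
    chartMetric g κ x ξ η = chartForm g κ x ξ η := rfl

theorem chartMetric_smul_smul (g : SmoothMetric m N)
    (κ : PartialEquiv N (EuclideanSpace ℝ (Fin m))) (x ξ η : EuclideanSpace ℝ (Fin m)) (a b : ℝ) :
    chartMetric g κ x (a • ξ) (b • η) = a * b * chartMetric g κ x ξ η := by
  simp only [chartMetric_eq_chartForm, map_smul, smul_apply, smul_eq_mul]
  ring

theorem eq_sum_single (ξ : EuclideanSpace ℝ (Fin m)) :
    ξ = ∑ a, ξ a • EuclideanSpace.single a (1 : ℝ) := by
  ext i
  simp [Finset.sum_apply, Pi.single_apply]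

theorem chartMetric_sum (g : SmoothMetric m N)
    (κ : PartialEquiv N (EuclideanSpace ℝ (Fin m))) (x ξ η : EuclideanSpace ℝ (Fin m)) :
    chartMetric g κ x ξ η = ∑ a, ∑ b, ξ a * η b *
      chartMetric g κ x (EuclideanSpace.single a 1) (EuclideanSpace.single b 1) := by
  simp only [chartMetric_eq_chartForm]
  conv_lhs => rw [eq_sum_single ξ, eq_sum_single η]
  simp only [map_sum, map_smul, sum_apply, smul_apply, smul_eq_mul, Finset.mul_sum]
  rw [Finset.sum_comm]
  refine Finset.sum_congr rfl fun a _ => Finset.sum_congr rfl fun b _ => ?_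
  ring

theorem IsSmoothChart.chartMetric_pos {κ : PartialEquiv N (EuclideanSpace ℝ (Fin m))}
    (h : IsSmoothChart κ) (g : SmoothMetric m N) {x ξ : EuclideanSpace ℝ (Fin m)}
    (hx : x ∈ κ.target) (hξ : ξ ≠ 0) : 0 < chartMetric g κ x ξ ξ := by
  refine g.pos _ _ fun h0 => hξ ?_
  have h1 := h.mfderiv_mfderiv_symm hx ξ
  rw [← h1, h0]
  exact map_zero _

theorem IsSmoothChart.exists_bound_coeff {κ : PartialEquiv N (EuclideanSpace ℝ (Fin m))}
    (h : IsSmoothChart κ) (g : SmoothMetric m N) {Q : Set (EuclideanSpace ℝ (Fin m))}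
    (hQ : IsCompact Q) (hQ' : Q ⊆ κ.target) :
    ∃ C : ℕ → ℝ, Monotone C ∧ (∀ j, 0 ≤ C j) ∧ ∀ j, ∀ a b : Fin m, ∀ x ∈ Q,
      ‖iteratedFDerivWithin ℝ j (fun y => chartMetric g κ y (EuclideanSpace.single a 1)
        (EuclideanSpace.single b 1)) κ.target x‖ ≤ C j := by
  refine exists_monotone_bound (P := fun j C => ∀ a b : Fin m, ∀ x ∈ Q,
      ‖iteratedFDerivWithin ℝ j (fun y => chartMetric g κ y (EuclideanSpace.single a 1)
        (EuclideanSpace.single b 1)) κ.target x‖ ≤ C)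
    (fun j => ?_) fun n C C' hCC h a b x hx => (h a b x hx).trans hCC
  have key : ∀ ab : Fin m × Fin m, ab ∈ (univ : Set (Fin m × Fin m)) → ∃ C, ∀ x ∈ Q,
      ‖iteratedFDerivWithin ℝ j (fun y => chartMetric g κ y (EuclideanSpace.single ab.1 1)
        (EuclideanSpace.single ab.2 1)) κ.target x‖ ≤ C := fun ab _ =>
    hQ.exists_bound_of_continuousOn (((h.contDiffOn_chartMetric g _
      _).continuousOn_iteratedFDerivWithin (by exact_mod_cast le_top) h.uniqueDiffOn_target).mono
      hQ')
  obtain ⟨C, hC⟩ := finite_univ.exists_uniform_bound key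
    fun ab C C' hCC h x hx => (h x hx).trans hCC
  exact ⟨C, fun a b x hx => hC (a, b) (mem_univ _) x hx⟩

theorem IsSmoothChart.exists_elliptic_bound {κ : PartialEquiv N (EuclideanSpace ℝ (Fin m))}
    (h : IsSmoothChart κ) (g : SmoothMetric m N) {Q : Set (EuclideanSpace ℝ (Fin m))}
    (hQ : IsCompact Q) (hQ' : Q ⊆ κ.target) :
    ∃ c : ℝ, 1 ≤ c ∧ ∀ x ∈ Q, ∀ ξ : EuclideanSpace ℝ (Fin m),
      ‖ξ‖ ^ 2 / c ≤ chartMetric g κ x ξ ξ ∧ chartMetric g κ x ξ ξ ≤ c * ‖ξ‖ ^ 2 := by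
  set φ : EuclideanSpace ℝ (Fin m) × EuclideanSpace ℝ (Fin m) → ℝ :=
    fun z => chartMetric g κ z.1 z.2 z.2 with hφ
  have hcont : ContinuousOn φ (κ.target ×ˢ univ) := by
    have : φ = fun z => ∑ a, ∑ b, z.2 a * z.2 b *
        chartMetric g κ z.1 (EuclideanSpace.single a 1) (EuclideanSpace.single b 1) := by
      ext z; exact chartMetric_sum g κ _ _ _
    rw [this]
    refine continuousOn_finsetSum _ fun a _ => continuousOn_finsetSum _ fun b _ => ?_
    refine ContinuousOn.mul (by fun_prop) ?_
    exact (h.contDiffOn_chartMetric g _ _).continuousOn.comp continuousOn_fst fun z hz => hz.1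
  have hS : IsCompact (Q ×ˢ Metric.sphere (0 : EuclideanSpace ℝ (Fin m)) 1) :=
    hQ.prod (isCompact_sphere _ _)
  have hsub : Q ×ˢ Metric.sphere (0 : EuclideanSpace ℝ (Fin m)) 1 ⊆ κ.target ×ˢ univ :=
    prod_mono hQ' (subset_univ _)
  have hpos : ∀ z ∈ Q ×ˢ Metric.sphere (0 : EuclideanSpace ℝ (Fin m)) 1, 0 < φ z := by
    intro z hz
    refine h.chartMetric_pos g (hQ' hz.1) fun h0 => ?_
    have := hz.2
    rw [h0] at this
    simp at this
  obtain ⟨C₁, hC₁⟩ := hS.exists_bound_of_continuousOn (hcont.mono hsub)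
  obtain ⟨C₂, hC₂⟩ := hS.exists_bound_of_continuousOn
    ((hcont.mono hsub).inv₀ fun z hz => (hpos z hz).ne')
  set c := max 1 (max C₁ C₂)
  have hc1 : 1 ≤ c := le_max_left _ _
  refine ⟨c, hc1, fun x hx ξ => ?_⟩
  rcases eq_or_ne ξ 0 with rfl | hξ
  · have : chartMetric g κ x 0 0 = 0 := by
      simp [chartMetric_eq_chartForm]
    simp [this]
  · have hn : 0 < ‖ξ‖ := norm_pos_iff.2 hξ
    set u := ‖ξ‖⁻¹ • ξ
    have hu : (x, u) ∈ Q ×ˢ Metric.sphere (0 : EuclideanSpace ℝ (Fin m)) 1 := by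
      refine ⟨hx, ?_⟩
      simp [u, norm_smul, hn.ne']
    have hξu : ξ = ‖ξ‖ • u := by simp [u, smul_smul, hn.ne']
    have e : chartMetric g κ x ξ ξ = ‖ξ‖ ^ 2 * φ (x, u) := by
      conv_lhs => rw [hξu, chartMetric_smul_smul, ← sq]
    have h0 := hpos _ hu
    have h1 : φ (x, u) ≤ c := (le_abs_self _).trans ((hC₁ _ hu).trans (by simp [c]))
    have h2 : (φ (x, u))⁻¹ ≤ c := (le_abs_self _).trans ((hC₂ _ hu).trans (by simp [c]))
    have h3 : c⁻¹ ≤ φ (x, u) := inv_le_of_inv_le₀ h0 h2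
    rw [e, div_eq_mul_inv, mul_comm c]
    exact ⟨by gcongr, by gcongr⟩

/-- The local representation of a metric in a cell is that in the original chart, rescaled. -/
theorem IsCell.chartMetric_eq {κ κ' : PartialEquiv N (EuclideanSpace ℝ (Fin m))}
    {c : EuclideanSpace ℝ (Fin m)} {d : Fin m → ℝ} (h : IsSmoothChart κ) (h' : IsSmoothChart κ')
    (hc : IsCell κ' κ c d) (g : SmoothMetric m N) {x : EuclideanSpace ℝ (Fin m)}
    (hx : x ∈ κ'.target) (ξ η : EuclideanSpace ℝ (Fin m)) :
    chartMetric g κ' x ξ η = chartMetric g κ (c + diagCLM d x) (diagCLM d ξ) (diagCLM d η) := by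
  have hA : HasMFDerivWithinAt 𝓘(ℝ, EuclideanSpace ℝ (Fin m)) 𝓘(ℝ, EuclideanSpace ℝ (Fin m))
      (fun x => c + diagCLM d x) κ'.target x (diagCLM d) :=
    ((diagCLM d).hasFDerivWithinAt.const_add c).hasMFDerivWithinAt
  have h1 := (h.hasMFDerivWithinAt_symm (hc.mem_target hx)).comp x hA
    fun y hy => hc.mem_target hy
  have h2 := h1.congr_of_eventuallyEq (f₁ := κ'.symm)
    (Filter.eventuallyEq_of_mem self_mem_nhdsWithin fun y hy => (hc.symm_apply hy).symm)
    (hc.symm_apply hx).symm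
  have h3 := h2.mfderivWithin (h'.uniqueMDiffOn_target x hx)
  rw [chartMetric, chartMetric]
  refine metric_inner_congr g (hc.symm_apply hx).symm ?_ ?_ <;>
  · rw [h3]; rfl

theorem IsCell.chartMetric_coeff {κ κ' : PartialEquiv N (EuclideanSpace ℝ (Fin m))}
    {c : EuclideanSpace ℝ (Fin m)} {d : Fin m → ℝ} (h : IsSmoothChart κ) (h' : IsSmoothChart κ')
    (hc : IsCell κ' κ c d) (g : SmoothMetric m N) {x : EuclideanSpace ℝ (Fin m)}
    (hx : x ∈ κ'.target) (a b : Fin m) :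
    chartMetric g κ' x (EuclideanSpace.single a 1) (EuclideanSpace.single b 1) =
      (d a * d b) * chartMetric g κ (c + diagCLM d x) (EuclideanSpace.single a 1)
        (EuclideanSpace.single b 1) := by
  rw [hc.chartMetric_eq h h' g hx, diagCLM_single, diagCLM_single,
    chartMetric_smul_smul]

theorem IsCell.norm_coeff_le {κ κ' : PartialEquiv N (EuclideanSpace ℝ (Fin m))}
    {c : EuclideanSpace ℝ (Fin m)} {d : Fin m → ℝ} (h : IsSmoothChart κ) (h' : IsSmoothChart κ')
    (hc : IsCell κ' κ c d) (g : SmoothMetric m N) {Λ C : ℝ} (hΛ : ∀ i, d i ≤ Λ)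
    {x : EuclideanSpace ℝ (Fin m)} (hx : x ∈ κ'.target) (a b : Fin m) (j : ℕ)
    (hC : ∀ i ≤ j, ‖iteratedFDerivWithin ℝ i (fun y => chartMetric g κ y
      (EuclideanSpace.single a 1) (EuclideanSpace.single b 1)) κ.target (c + diagCLM d x)‖ ≤ C) :
    ‖iteratedFDerivWithin ℝ j (fun y => chartMetric g κ' y (EuclideanSpace.single a 1)
      (EuclideanSpace.single b 1)) κ'.target x‖ ≤ Λ ^ 2 * (j.factorial * C * Λ ^ j) := by
  have hΛ0 : 0 ≤ Λ := (hc.pos 0).le.trans (hΛ 0)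
  have hs := h'.uniqueDiffOn_target
  have hmaps : MapsTo (fun x => c + diagCLM d x) κ'.target κ.target := fun y hy =>
    hc.mem_target hy
  have hG := h.contDiffOn_chartMetric g (EuclideanSpace.single a 1) (EuclideanSpace.single b 1)
  set G := fun y => chartMetric g κ y (EuclideanSpace.single a 1) (EuclideanSpace.single b 1)
  have hsm : ContDiffOn ℝ ∞ (G ∘ fun x => c + diagCLM d x) κ'.target :=
    hG.comp (contDiff_const.add (diagCLM d).contDiff).contDiffOn hmaps
  have heq : EqOn (fun y => chartMetric g κ' y (EuclideanSpace.single a 1)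
      (EuclideanSpace.single b 1)) ((d a * d b) • (G ∘ fun x => c + diagCLM d x)) κ'.target :=
    fun y hy => hc.chartMetric_coeff h h' g hy a b
  rw [iteratedFDerivWithin_congr heq hx, iteratedFDerivWithin_const_smul_apply
    ((hsm x hx).of_le (by exact_mod_cast le_top)) hs hx, norm_smul]
  refine mul_le_mul ?_ ?_ (norm_nonneg _) (by positivity)
  · rw [Real.norm_eq_abs, abs_of_pos (mul_pos (hc.pos a) (hc.pos b)), sq]
    exact mul_le_mul (hΛ a) (hΛ b) (hc.pos b).le hΛ0
  · refine norm_iteratedFDerivWithin_comp_affine_le hG h.uniqueDiffOn_target hs hmaps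
      (fun _ _ => rfl) (norm_diagCLM_le hΛ0 fun i => ?_) hx hC
    rw [abs_of_pos (hc.pos i)]; exact hΛ i

end Metric

/-! ### Boxes and cells along the height -/

section EndGeometry

variable {m : ℕ} [NeZero m]

/-- The entries of the diagonal projection which sets the coordinate `j` to zero. -/
def killCoord (j : Fin m) : Fin m → ℝ := fun l => if l = j then 0 else 1

/-- The point `z` with its coordinate `j` replaced by `s`. -/
def setCoord (j : Fin m) (s : ℝ) (z : EuclideanSpace ℝ (Fin m)) : EuclideanSpace ℝ (Fin m) :=
  EuclideanSpace.single j s + diagCLM (killCoord j) z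

@[simp] theorem setCoord_same (j : Fin m) (s : ℝ) (z : EuclideanSpace ℝ (Fin m)) :
    setCoord j s z j = s := by simp [setCoord, killCoord]

theorem setCoord_of_ne {j l : Fin m} (h : l ≠ j) (s : ℝ) (z : EuclideanSpace ℝ (Fin m)) :
    setCoord j s z l = z l := by simp [setCoord, killCoord, h]

theorem setCoord_setCoord (j : Fin m) (s t : ℝ) (z : EuclideanSpace ℝ (Fin m)) :
    setCoord j s (setCoord j t z) = setCoord j s z := by
  ext l
  by_cases h : l = j
  · subst h; simp
  · simp [setCoord_of_ne h]

theorem setCoord_self (j : Fin m) (z : EuclideanSpace ℝ (Fin m)) :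
    setCoord j (z j) z = z := by
  ext l
  by_cases h : l = j
  · subst h; simp
  · simp [setCoord_of_ne h]

/-- The coordinate domain of a chart of a cylindrical end: the coordinate `j` is the height along
the end, and the coordinate `0` is nonnegative if the chart meets the boundary. The other
coordinates have absolute value less than `3`; all cells are taken from the part where they are at
most `2`, and the charts are required to cover already with the part where they are at most `1`. -/
def endBox (j : Fin m) (half : Prop) (s₀ : ℝ) : Set (EuclideanSpace ℝ (Fin m)) :=
  {z | s₀ < z j ∧ (∀ l ≠ j, |z l| < 3) ∧ (half → 0 ≤ z 0)}

/-- A compact piece of the slice of `endBox` at height `s`. -/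
def endSlice (j : Fin m) (half : Prop) (s : ℝ) : Set (EuclideanSpace ℝ (Fin m)) :=
  {z | z j = s ∧ (∀ l ≠ j, |z l| ≤ 2) ∧ (half → 0 ≤ z 0)}

/-- A compact piece of `endBox` between two heights. -/
def endSlab (j : Fin m) (half : Prop) (s s' : ℝ) : Set (EuclideanSpace ℝ (Fin m)) :=
  {z | z j ∈ Icc s s' ∧ (∀ l ≠ j, |z l| ≤ 2) ∧ (half → 0 ≤ z 0)}

theorem isCompact_endSlab (j : Fin m) (half : Prop) (s s' : ℝ) :
    IsCompact (endSlab j half s s') := by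
  have hc : ∀ l, Continuous fun z : EuclideanSpace ℝ (Fin m) => z l := fun l => by fun_prop
  refine Metric.isCompact_of_isClosed_isBounded ?_ ?_
  · have : endSlab j half s s' = (fun z : EuclideanSpace ℝ (Fin m) => z j) ⁻¹' Icc s s' ∩
        ((⋂ l, ⋂ (_ : l ≠ j), {z | |z l| ≤ 2}) ∩ ⋂ (_ : half), {z | 0 ≤ z 0}) := by
      ext z; simp [endSlab]
    rw [this]
    refine (isClosed_Icc.preimage (hc j)).inter ((isClosed_iInter fun l =>
      isClosed_iInter fun _ => isClosed_le (hc l).abs continuous_const).inter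
      (isClosed_iInter fun _ => isClosed_le continuous_const (hc 0)))
  · refine (Metric.isBounded_iff_subset_closedBall 0).2 ⟨√m * max (max |s| |s'|) 2, fun z hz => ?_⟩
    rw [mem_closedBall_zero_iff]
    refine norm_le_of_forall_abs_le (by positivity) fun l => ?_
    by_cases h : l = j
    · rw [h]; exact (abs_le_max_abs_abs hz.1.1 hz.1.2).trans (le_max_left _ _)
    · exact (hz.2.1 l h).trans (le_max_right _ _)

theorem isCompact_endSlice (j : Fin m) (half : Prop) (s : ℝ) :
    IsCompact (endSlice j half s) := by
  have : endSlice j half s = endSlab j half s s := by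
    ext z; simp [endSlice, endSlab]
  rw [this]
  exact isCompact_endSlab j half s s

theorem endSlice_subset_endBox {j : Fin m} {half : Prop} {s s₀ : ℝ} (hs : s₀ < s) :
    endSlice j half s ⊆ endBox j half s₀ := fun z hz =>
  ⟨by rw [hz.1]; exact hs, fun l hl => (hz.2.1 l hl).trans_lt (by norm_num), hz.2.2⟩

/-- The size of the cells at height `n j`: `1` in the direction of the height, and `e^(-β n j) / 2`
in the other directions. -/
def endScale (β : ℝ) (j : Fin m) (n : Fin m → ℤ) : Fin m → ℝ :=
  fun l => if l = j then 1 else Real.exp (-(β * n j)) / 2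

/-- The center of the cell with the index `n`. -/
def endCenter (β : ℝ) (j : Fin m) (n : Fin m → ℤ) : EuclideanSpace ℝ (Fin m) :=
  WithLp.toLp 2 fun l => endScale β j n l * n l

theorem endScale_pos (β : ℝ) (j : Fin m) (n : Fin m → ℤ) (l : Fin m) : 0 < endScale β j n l := by
  unfold endScale; split_ifs <;> positivity

@[simp] theorem endScale_same (β : ℝ) (j : Fin m) (n : Fin m → ℤ) : endScale β j n j = 1 := by
  simp [endScale]

theorem endScale_of_ne {β : ℝ} {j l : Fin m} (h : l ≠ j) (n : Fin m → ℤ) :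
    endScale β j n l = Real.exp (-(β * n j)) / 2 := by
  simp [endScale, h]

theorem endCenter_add_apply (β : ℝ) (j : Fin m) (n : Fin m → ℤ) (x : EuclideanSpace ℝ (Fin m))
    (l : Fin m) :
    (endCenter β j n + diagCLM (endScale β j n) x) l = endScale β j n l * (n l + x l) := by
  simp [endCenter, mul_add]

/-- The indices of the cells contained in `endBox`. The condition `bound` says that the coordinates
other than the height have absolute value at most `2` in the cell. -/
structure EndAdmissible (β s₀ : ℝ) (j : Fin m) (half : Prop) (n : Fin m → ℤ) : Prop where
  height : s₀ + 1 < n j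
  bound : ∀ l ≠ j, endScale β j n l * (|(n l : ℝ)| + 1) ≤ 2
  nonneg : half → 0 ≤ n 0

/-- The target of a normalized cell: the half-cube for the cells at the boundary, the cube
otherwise. -/
def endCellTarget (half : Prop) (n : Fin m → ℤ) : Set (EuclideanSpace ℝ (Fin m)) :=
  {x | x ∈ openCube m ∧ (half ∧ n 0 = 0 → 0 ≤ x 0)}

theorem endCellTarget_cases (half : Prop) (n : Fin m → ℤ) :
    (¬ (half ∧ n 0 = 0) ∧ endCellTarget half n = openCube m) ∨
      ((half ∧ n 0 = 0) ∧ endCellTarget half n = openCube m ∩ halfSpaceSet m) := by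
  by_cases h : half ∧ n 0 = 0
  · right; refine ⟨h, ?_⟩; ext x; simp [endCellTarget, h, halfSpaceSet]
  · left; refine ⟨h, ?_⟩; ext x
    exact ⟨fun hx => hx.1, fun hx => ⟨hx, fun h' => absurd h' h⟩⟩

theorem EndAdmissible.cell_bounds {β s₀ : ℝ} {j : Fin m} {half : Prop} {n : Fin m → ℤ}
    (hn : EndAdmissible β s₀ j half n) {x : EuclideanSpace ℝ (Fin m)}
    (hx : x ∈ endCellTarget half n) :
    s₀ < n j + x j ∧
    (∀ l ≠ j, |(endCenter β j n + diagCLM (endScale β j n) x) l| ≤ 2) ∧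
    (half → 0 ≤ (endCenter β j n + diagCLM (endScale β j n) x) 0) := by
  refine ⟨?_, fun l hl => ?_, fun hh => ?_⟩
  · have := (hx.1 j).1
    have := hn.height
    linarith
  · rw [endCenter_add_apply, abs_mul, abs_of_pos (endScale_pos β j n l)]
    refine le_trans ?_ (hn.bound l hl)
    have h1 := (abs_lt.2 (hx.1 l)).le
    have := abs_add_le (n l : ℝ) (x l)
    gcongr
    · exact (endScale_pos β j n l).le
    · linarith
  · rw [endCenter_add_apply]
    refine mul_nonneg (endScale_pos β j n 0).le ?_
    rcases (hn.nonneg hh).eq_or_lt with h0 | h0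
    · rw [← h0]; simpa using hx.2 ⟨hh, h0.symm⟩
    · have h1 : (1 : ℝ) ≤ n 0 := by exact_mod_cast h0
      have := (hx.1 0).1
      linarith

theorem EndAdmissible.mem_endBox {β s₀ : ℝ} {j : Fin m} {half : Prop} {n : Fin m → ℤ}
    (hn : EndAdmissible β s₀ j half n) {x : EuclideanSpace ℝ (Fin m)}
    (hx : x ∈ endCellTarget half n) :
    endCenter β j n + diagCLM (endScale β j n) x ∈ endBox j half s₀ := by
  obtain ⟨h1, h2, h3⟩ := hn.cell_bounds hx
  refine ⟨?_, fun l hl => (h2 l hl).trans_lt (by norm_num), h3⟩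
  rw [endCenter_add_apply, endScale_same, one_mul]
  exact h1

/-- Translated to a fixed height, all cells lie in one compact slice. -/
theorem EndAdmissible.mem_endSlice {β s₀ s : ℝ} {j : Fin m} {half : Prop} {n : Fin m → ℤ}
    (hn : EndAdmissible β s₀ j half n) (hj : half → j ≠ 0) {x : EuclideanSpace ℝ (Fin m)}
    (hx : x ∈ endCellTarget half n) :
    setCoord j s (endCenter β j n + diagCLM (endScale β j n) x) ∈ endSlice j half s := by
  obtain ⟨-, h2, h3⟩ := hn.cell_bounds hx
  refine ⟨setCoord_same _ _ _, fun l hl => ?_, fun hh => ?_⟩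
  · rw [setCoord_of_ne hl]; exact h2 l hl
  · rw [setCoord_of_ne (hj hh).symm]; exact h3 hh

/-- A sufficient condition for membership in the cube or half-cube of size `r`. -/
theorem mem_smul_set_of_forall_abs_lt {T : Set (EuclideanSpace ℝ (Fin m))} {r : ℝ} (hr : 0 < r)
    {y : EuclideanSpace ℝ (Fin m)} (hy : ∀ l, |y l| < r)
    (hT : T = openCube m ∨ T = openCube m ∩ halfSpaceSet m ∧ 0 ≤ y 0) : y ∈ r • T := by
  have h1 : r⁻¹ • y ∈ openCube m := by
    intro l
    have : |r⁻¹ * y l| < 1 := by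
      rw [abs_mul, abs_of_pos (inv_pos.2 hr), inv_mul_lt_iff₀ hr, mul_one]
      exact hy l
    exact abs_lt.1 this
  rw [mem_smul_set_iff_inv_smul_mem₀ hr.ne']
  rcases hT with rfl | ⟨rfl, h0⟩
  · exact h1
  · refine ⟨h1, ?_⟩
    change 0 ≤ r⁻¹ * y 0
    positivity

end EndGeometry

/-! ### Cylindrical ends -/

section End

variable {m : ℕ} [NeZero m] {M : Type*} [TopologicalSpace M]
  [ChartedSpace (EuclideanHalfSpace m) M] [IsManifold (𝓡∂ m) ∞ M]

/-- A family of charts `Φ a` of a manifold, each of which has a distinguished coordinate, the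
height `s`, such that the coordinate changes commute with the translations of the height and the
metric has the form `ds² + e^(2 β s) G` with `G` independent of `s`. -/
structure IsCylindricalEnd {A : Type*} (h : SmoothMetric m M)
    (Φ : A → PartialEquiv M (EuclideanSpace ℝ (Fin m))) (j : A → Fin m) (half : A → Prop)
    (s₀ β : ℝ) : Prop where
  smooth : ∀ a, IsSmoothChart (Φ a)
  target : ∀ a, (Φ a).target = endBox (j a) (half a) s₀
  half_ne : ∀ a, half a → j a ≠ 0
  base_nonneg : 0 ≤ s₀
  rate_nonneg : 0 ≤ β
  height_eq : ∀ a b, ∀ z ∈ overlap (Φ a) (Φ b), Φ b ((Φ a).symm z) (j b) = z (j a)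
  translate_mem : ∀ a b, ∀ z ∈ overlap (Φ a) (Φ b), ∀ s, s₀ < s →
    setCoord (j a) s z ∈ overlap (Φ a) (Φ b)
  translate_eq : ∀ a b, ∀ z ∈ overlap (Φ a) (Φ b), ∀ s, s₀ < s →
    Φ b ((Φ a).symm (setCoord (j a) s z)) = setCoord (j b) s (Φ b ((Φ a).symm z))
  metric_eq : ∀ a, ∀ z ∈ (Φ a).target, ∀ s, s₀ < s → ∀ ξ η,
    chartMetric h (Φ a) z ξ η = ξ (j a) * η (j a) + Real.exp (2 * β * (z (j a) - s)) *
      chartMetric h (Φ a) (setCoord (j a) s z) (diagCLM (killCoord (j a)) ξ)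
        (diagCLM (killCoord (j a)) η)

namespace IsCylindricalEnd

variable {A : Type*} {h : SmoothMetric m M} {Φ : A → PartialEquiv M (EuclideanSpace ℝ (Fin m))}
  {j : A → Fin m} {half : A → Prop} {s₀ β : ℝ}

theorem cell_mem_target (H : IsCylindricalEnd h Φ j half s₀ β) {a : A} {n : Fin m → ℤ}
    (hn : EndAdmissible β s₀ (j a) (half a) n) :
    ∀ x ∈ endCellTarget (half a) n,
      endCenter β (j a) n + diagCLM (endScale β (j a) n) x ∈ (Φ a).target := fun x hx => by
  rw [H.target]; exact hn.mem_endBox hx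

/-- The cell with the index `n` of the chart `Φ a`. -/
def cell (H : IsCylindricalEnd h Φ j half s₀ β) {a : A} {n : Fin m → ℤ}
    (hn : EndAdmissible β s₀ (j a) (half a) n) : PartialEquiv M (EuclideanSpace ℝ (Fin m)) :=
  cellChart (Φ a) (endCenter β (j a) n) (endScale_pos β (j a) n) (H.cell_mem_target hn)

theorem isCell (H : IsCylindricalEnd h Φ j half s₀ β) {a : A} {n : Fin m → ℤ}
    (hn : EndAdmissible β s₀ (j a) (half a) n) :
    IsCell (H.cell hn) (Φ a) (endCenter β (j a) n) (endScale β (j a) n) := isCell_cellChart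

theorem cell_target (H : IsCylindricalEnd h Φ j half s₀ β) {a : A} {n : Fin m → ℤ}
    (hn : EndAdmissible β s₀ (j a) (half a) n) :
    (H.cell hn).target = endCellTarget (half a) n := rfl

theorem isNormalizedChart_cell (H : IsCylindricalEnd h Φ j half s₀ β) {a : A} {n : Fin m → ℤ}
    (hn : EndAdmissible β s₀ (j a) (half a) n) : IsNormalizedChart (H.cell hn) := by
  rcases endCellTarget_cases (half a) n with ⟨hh, ht⟩ | ⟨hh, ht⟩
  · refine (isSmoothChart_cellChart (H.smooth a) isOpen_openCube (.inl ht) ?_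
      ).isNormalizedChart_of_openCube ht
    intro y _ hy'; rwa [ht]
  · refine (isSmoothChart_cellChart (H.smooth a) isOpen_openCube (.inr ht) ?_
      ).isNormalizedChart_of_halfCube ht
    intro y hy hy'
    rw [H.target] at hy
    rw [ht]
    refine ⟨hy', ?_⟩
    have h0 := hy.2.2 hh.1
    have h1 := endScale_pos β (j a) n 0
    change 0 ≤ (endScale β (j a) n 0)⁻¹ * (y 0 - endScale β (j a) n 0 * n 0)
    rw [hh.2]
    simpa using by positivity

/-- The family of all cells. -/
def cells (H : IsCylindricalEnd h Φ j half s₀ β) :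
    Set (PartialEquiv M (EuclideanSpace ℝ (Fin m))) :=
  {κ | ∃ (a : A) (n : Fin m → ℤ) (hn : EndAdmissible β s₀ (j a) (half a) n), κ = H.cell hn}

/-- The cells cover the core of the end, even after shrinking: the index of a suitable cell is
obtained by rounding the rescaled coordinates, which leaves coordinates of absolute value at most
`1 / 2`. -/
theorem exists_cell (H : IsCylindricalEnd h Φ j half s₀ β) {a : A} {p : M}
    (hp : p ∈ (Φ a).source) (hheight : s₀ + 2 ≤ Φ a p (j a))
    (hcore : ∀ l ≠ j a, |Φ a p l| ≤ 1) {r : ℝ} (hr : 3 / 4 ≤ r) :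
    ∃ κ ∈ H.cells, p ∈ κ.source ∧ κ p ∈ r • κ.target := by
  set z := Φ a p
  set i : ℤ := round (z (j a))
  set d : Fin m → ℝ := endScale β (j a) fun _ => i with hd
  set n : Fin m → ℤ := fun l => round (z l / d l)
  have hdpos : ∀ l, 0 < d l := fun l => endScale_pos _ _ _ l
  have hnj : n (j a) = i := by simp [n, d, i]
  have hdn : endScale β (j a) n = d := by
    ext l; simp only [endScale, hd, hnj]
  have hround : ∀ l, |z l / d l - n l| ≤ 1 / 2 := fun l => abs_sub_round _
  have hi := abs_le.1 (abs_sub_round (z (j a)))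
  have hi0 : (0 : ℝ) ≤ i := by have := H.base_nonneg; linarith
  have hd1 : ∀ l ≠ j a, d l ≤ 1 / 2 := by
    intro l hl
    rw [hd, endScale_of_ne hl]
    have : Real.exp (-(β * i)) ≤ 1 := Real.exp_le_one_iff.2 (by
      have := mul_nonneg H.rate_nonneg hi0; linarith)
    linarith
  have hzt : z ∈ endBox (j a) (half a) s₀ := by rw [← H.target]; exact (Φ a).map_source hp
  have hadm : EndAdmissible β s₀ (j a) (half a) n := by
    refine ⟨?_, fun l hl => ?_, fun hh => ?_⟩
    · rw [hnj]; linarith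
    · rw [hdn]
      have h1 := hround l
      have h2 : |(n l : ℝ)| ≤ |z l| / d l + 1 / 2 := by
        have := abs_sub_abs_le_abs_sub (n l : ℝ) (z l / d l)
        rw [abs_sub_comm, abs_div, abs_of_pos (hdpos l)] at this
        linarith
      calc d l * (|(n l : ℝ)| + 1) ≤ d l * (|z l| / d l + 1 / 2 + 1) := by
            have := hdpos l
            gcongr
        _ = |z l| + 3 / 2 * d l := by field_simp [(hdpos l).ne']; ring
        _ ≤ 2 := by have := hcore l hl; have := hd1 l hl; linarith
    · have : 0 ≤ z 0 / d 0 := div_nonneg (hzt.2.2 hh) (hdpos 0).le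
      by_contra! hneg
      have h1 := abs_le.1 (hround 0)
      have h2 : (n 0 : ℝ) ≤ -1 := by exact_mod_cast Int.le_sub_one_of_lt hneg
      linarith
  have hval : ∀ l, H.cell hadm p l = z l / d l - n l := by
    intro l
    change (endScale β (j a) n l)⁻¹ * (z l - endScale β (j a) n l * n l) = _
    rw [hdn]
    field_simp [(hdpos l).ne']
  have habs : ∀ l, |H.cell hadm p l| ≤ 1 / 2 := fun l => by rw [hval]; exact hround l
  have hnn : half a ∧ n 0 = 0 → 0 ≤ H.cell hadm p 0 := by
    rintro ⟨hh, h0⟩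
    rw [hval, h0]
    have : 0 ≤ z 0 / d 0 := div_nonneg (hzt.2.2 hh) (hdpos 0).le
    simpa using this
  refine ⟨H.cell hadm, ⟨a, n, hadm, rfl⟩, ⟨hp, ?_, hnn⟩, ?_⟩
  · exact fun l => abs_lt.1 ((habs l).trans_lt (by norm_num))
  · refine mem_smul_set_of_forall_abs_lt (by linarith) (fun l => ?_) ?_
    · have := habs l; linarith
    · rw [H.cell_target]
      rcases endCellTarget_cases (half a) n with ⟨hh, ht⟩ | ⟨hh, ht⟩
      · exact .inl ht
      · exact .inr ⟨ht, hnn hh⟩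

theorem finite_multiplicity [Finite A] (H : IsCylindricalEnd h Φ j half s₀ β) :
    ∃ n : ℕ, ∀ p : M, {κ ∈ H.cells | p ∈ κ.source}.encard ≤ n := by
  classical
  refine ⟨Nat.card (A × (Fin m → Bool)), fun p => ?_⟩
  -- A point `p` in a cell determines the index of the cell up to one unit in each entry.
  let ht : A → (Fin m → Bool) → ℤ := fun a b =>
    ⌊Φ a p (j a)⌋ + if b (j a) then 1 else 0
  let idx : A → (Fin m → Bool) → Fin m → ℤ := fun a b l =>
    ⌊(endScale β (j a) (fun _ => ht a b) l)⁻¹ * Φ a p l⌋ + if b l then 1 else 0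
  let f : A × (Fin m → Bool) → PartialEquiv M (EuclideanSpace ℝ (Fin m)) := fun ab =>
    if hn : EndAdmissible β s₀ (j ab.1) (half ab.1) (idx ab.1 ab.2) then H.cell hn else Φ ab.1
  have hsub : {κ ∈ H.cells | p ∈ κ.source} ⊆ range f := by
    rintro κ ⟨⟨a, n, hn, rfl⟩, hp⟩
    have hcoord : ∀ l, |(endScale β (j a) n l)⁻¹ * Φ a p l - n l| < 1 := by
      intro l
      have h1 := hp.2.1 l
      have h2 := (endScale_pos β (j a) n l).ne'
      have h3 : cellCoord (endCenter β (j a) n) (endScale β (j a) n) (Φ a p) l =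
          (endScale β (j a) n l)⁻¹ * Φ a p l - n l := by
        change (endScale β (j a) n l)⁻¹ * (Φ a p l - endScale β (j a) n l * n l) = _
        field_simp
      rw [h3] at h1
      exact abs_lt.2 h1
    let b : Fin m → Bool := fun l => decide (⌊(endScale β (j a) n l)⁻¹ * Φ a p l⌋ < n l)
    have hfloor : ∀ (t : ℝ) (k : ℤ), |t - k| < 1 → ⌊t⌋ + (if ⌊t⌋ < k then 1 else 0) = k := by
      intro t k htk
      obtain ⟨h1, h2⟩ := abs_lt.1 htk
      have h3 := Int.floor_le t
      have h4 := Int.lt_floor_add_one t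
      have h5 : k < ⌊t⌋ + 2 := by
        have : (k : ℝ) < ⌊t⌋ + 2 := by linarith
        exact_mod_cast this
      have h6 : ⌊t⌋ < k + 1 := by
        have : (⌊t⌋ : ℝ) < k + 1 := by linarith
        exact_mod_cast this
      split_ifs <;> omega
    have hht : ht a b = n (j a) := by
      have := hfloor _ _ (hcoord (j a))
      simp only [endScale_same, inv_one, one_mul] at this
      simpa [ht, b] using this
    have hidx : idx a b = n := by
      ext l
      have e : endScale β (j a) (fun _ => ht a b) = endScale β (j a) n := by
        ext l; simp only [endScale, hht]
      have := hfloor _ _ (hcoord l)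
      simp only [idx, e]
      simpa [b] using this
    refine ⟨(a, b), ?_⟩
    have key : ∀ n', n' = n → (if hn : EndAdmissible β s₀ (j a) (half a) n' then H.cell hn
        else Φ a) = H.cell hn := by
      rintro _ rfl; exact dif_pos hn
    exact key _ hidx
  calc {κ ∈ H.cells | p ∈ κ.source}.encard ≤ (range f).encard := encard_le_encard hsub
    _ ≤ (univ : Set (A × (Fin m → Bool))).encard := by
        rw [← image_univ]; exact encard_image_le _ _
    _ = (Nat.card (A × (Fin m → Bool)) : ℕ∞) := by
        rw [encard_univ, ENat.card_eq_coe_natCard]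

end IsCylindricalEnd

end End

/-! ### Coordinate changes between the cells of an end -/

section EndBounds

variable {m : ℕ} [NeZero m] {M : Type*} [TopologicalSpace M] [T2Space M]
  [ChartedSpace (EuclideanHalfSpace m) M] [IsManifold (𝓡∂ m) ∞ M]

namespace IsCylindricalEnd

variable {A : Type*} {h : SmoothMetric m M} {Φ : A → PartialEquiv M (EuclideanSpace ℝ (Fin m))}
  {j : A → Fin m} {half : A → Prop} {s₀ β : ℝ}

theorem killCoord_mul_endScale_le (a : A) {n : Fin m → ℤ} (l : Fin m) :
    |killCoord (j a) l * endScale β (j a) n l| ≤ Real.exp (-(β * n (j a))) / 2 := by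
  by_cases hl : l = j a
  · simp only [killCoord, hl, if_true, zero_mul, abs_zero]; positivity
  · rw [endScale_of_ne hl, killCoord, if_neg hl, one_mul, abs_of_pos (by positivity)]

/-- The coordinate changes between cells. Up to an affine part in the direction of the height, such
a coordinate change is a fixed coordinate change at the height `s₀ + 1`, conjugated by dilations
whose factors at comparable heights are comparable. -/
theorem transition_bounds [Finite A] (H : IsCylindricalEnd h Φ j half s₀ β) (k : ℕ) :
    ∃ C : ℝ, ∀ κ ∈ H.cells, ∀ κ' ∈ H.cells, ∀ x ∈ overlap κ κ',
      ‖iteratedFDerivWithin ℝ k (κ' ∘ κ.symm) (overlap κ κ') x‖ ≤ C := by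
  rcases Nat.eq_zero_or_pos k with rfl | hk
  · refine ⟨√m, ?_⟩
    rintro κ _ κ' ⟨b, n', hn', rfl⟩ x hx
    exact norm_transition_zero_le (H.isNormalizedChart_cell hn').target_subset_openCube hx
  have hs₁ : s₀ < s₀ + 1 := by linarith
  have hsub : ∀ a, endSlice (j a) (half a) (s₀ + 1) ⊆ (Φ a).target := fun a => by
    rw [H.target]; exact endSlice_subset_endBox hs₁
  have key : ∀ ab : A × A, ab ∈ (univ : Set (A × A)) → ∃ C : ℝ, 0 ≤ C ∧ ∀ i ≤ k,
      ∀ x ∈ endSlice (j ab.1) (half ab.1) (s₀ + 1), (Φ ab.1).symm x ∈ (Φ ab.2).source →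
      Φ ab.2 ((Φ ab.1).symm x) ∈ endSlice (j ab.2) (half ab.2) (s₀ + 1) →
      ‖iteratedFDerivWithin ℝ i (Φ ab.2 ∘ (Φ ab.1).symm) (overlap (Φ ab.1) (Φ ab.2)) x‖ ≤ C := by
    rintro ⟨a, b⟩ -
    obtain ⟨C, hC1, hC2, hC3⟩ := exists_bound_transition_of_isCompact (H.smooth a) (H.smooth b)
      (isCompact_endSlice _ _ _) (hsub a) (isCompact_endSlice _ _ _) (hsub b)
    exact ⟨C k, hC2 k, fun i hi x h1 h2 h3 => (hC3 i x h1 h2 h3).trans (hC1 hi)⟩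
  obtain ⟨C, hC⟩ := finite_univ.exists_uniform_bound key fun ab C C' hCC h =>
    ⟨h.1.trans hCC, fun i hi x h1 h2 h3 => (h.2 i hi x h1 h2 h3).trans hCC⟩
  refine ⟨1 + k.factorial * C * Real.exp β, ?_⟩
  rintro κ ⟨a, n, hn, rfl⟩ κ' ⟨b, n', hn', rfl⟩ x hx
  obtain ⟨hC0, hC⟩ := hC (a, b) (mem_univ _)
  set ε := Real.exp (-(β * n (j a))) / 2 with hε
  set ε' := Real.exp (-(β * n' (j b))) / 2 with hε'
  have hε0 : 0 < ε := by positivity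
  have hε'0 : 0 < ε' := by positivity
  have hc := H.isCell hn
  have hc' := H.isCell hn'
  have hsm := (H.isNormalizedChart_cell hn).isSmoothChart
  have hsm' := (H.isNormalizedChart_cell hn').isSmoothChart
  have hmaps := hc.mapsTo_overlap hc'
  set κ := H.cell hn
  set κ' := H.cell hn'
  have hu := hsm.uniqueDiffOn_overlap hsm'
  set c := endCenter β (j a) n with hcdef
  set d := endScale β (j a) n with hddef
  set c' := endCenter β (j b) n' with hc'def
  set d' := endScale β (j b) n' with hd'def
  -- The affine map `P` carries the domain of the cell to the slice at the height `s₀ + 1`.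
  set P : EuclideanSpace ℝ (Fin m) → EuclideanSpace ℝ (Fin m) :=
    fun y => setCoord (j a) (s₀ + 1) (c + diagCLM d y) with hP
  have hPmaps : MapsTo P (overlap κ κ') (overlap (Φ a) (Φ b)) := fun y hy =>
    H.translate_mem a b _ (hmaps hy) _ hs₁
  have hPaff : EqOn P (fun y => setCoord (j a) (s₀ + 1) c +
      diagCLM (fun l => killCoord (j a) l * d l) y) (overlap κ κ') := by
    intro y _
    ext l
    simp only [hP, setCoord, PiLp.add_apply, diagCLM_apply]
    ring
  have hPn : ‖diagCLM (fun l => killCoord (j a) l * d l)‖ ≤ ε :=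
    norm_diagCLM_le hε0.le fun l => killCoord_mul_endScale_le a l
  set W := Φ b ∘ (Φ a).symm with hW
  have hWsm : ContDiffOn ℝ ∞ W (overlap (Φ a) (Φ b)) :=
    (H.smooth a).contDiffOn_transition (H.smooth b)
  have hWP : ContDiffOn ℝ ∞ (W ∘ P) (overlap κ κ') :=
    hWsm.comp ((contDiff_const.add (ContinuousLinearMap.contDiff _)).contDiffOn.congr hPaff)
      hPmaps
  -- The coordinate change of the cells is the sum of the affine map `S + const`, which accounts for
  -- the height, and of `L' ∘ W ∘ P`, where the dilation `L'` compensates the contraction `P`.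
  set L' := diagCLM fun l => killCoord (j b) l * (d' l)⁻¹ with hL'
  have hL'n : ‖L'‖ ≤ ε'⁻¹ := by
    refine norm_diagCLM_le (by positivity) fun l => ?_
    by_cases hl : l = j b
    · simp only [killCoord, hl, if_true, zero_mul, abs_zero]; positivity
    · rw [hd'def, endScale_of_ne hl, killCoord, if_neg hl, one_mul, abs_of_pos (by positivity)]
  set S : EuclideanSpace ℝ (Fin m) →L[ℝ] EuclideanSpace ℝ (Fin m) :=
    (EuclideanSpace.proj (j a) : EuclideanSpace ℝ (Fin m) →L[ℝ] ℝ).smulRight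
      (EuclideanSpace.single (j b) (1 : ℝ)) with hS
  have hSn : ‖S‖ ≤ 1 := by
    refine ContinuousLinearMap.opNorm_le_bound _ zero_le_one fun y => ?_
    simp only [hS, ContinuousLinearMap.smulRight_apply, PiLp.proj_apply, norm_smul,
      PiLp.norm_single, norm_one, mul_one, one_mul]
    exact PiLp.norm_apply_le y (j a)
  have hdecomp : EqOn (κ' ∘ κ.symm) (fun y => (EuclideanSpace.single (j b) ((n (j a) : ℝ)) + S y)
      + (-(diagCLM (fun l => (d' l)⁻¹) c') + L' ((W ∘ P) y))) (overlap κ κ') := by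
    intro y hy
    have hy' := hmaps hy
    have e1 : W (P y) = setCoord (j b) (s₀ + 1) (W (c + diagCLM d y)) :=
      H.translate_eq a b _ hy' _ hs₁
    have e2 : W (c + diagCLM d y) (j b) = n (j a) + y (j a) := by
      rw [hW, Function.comp_apply, H.height_eq a b _ hy', endCenter_add_apply, endScale_same,
        one_mul]
    have e3 : (κ' ∘ κ.symm) y = cellCoord c' d' (W (c + diagCLM d y)) := by
      rw [Function.comp_apply, hc'.eq_cellCoord hy.2, hW, Function.comp_apply,
        hc.symm_apply hy.1]
    rw [e3]
    ext l
    by_cases hl : l = j b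
    · subst hl
      simp only [cellCoord_apply, e2, hS, hL', PiLp.add_apply, PiLp.neg_apply, diagCLM_apply,
        Function.comp_apply, ContinuousLinearMap.smulRight_apply, PiLp.proj_apply,
        PiLp.smul_apply, PiLp.single_apply, if_true, smul_eq_mul, killCoord, hd'def,
        endScale_same]
      ring
    · simp only [cellCoord_apply, e1, hS, hL', PiLp.add_apply, PiLp.neg_apply, diagCLM_apply,
        Function.comp_apply, ContinuousLinearMap.smulRight_apply, PiLp.proj_apply,
        PiLp.smul_apply, PiLp.single_apply, hl, if_false, smul_eq_mul, killCoord,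
        setCoord_of_ne hl]
      ring
  rw [iteratedFDerivWithin_congr hdecomp hx]
  have hf1 : ContDiffOn ℝ ∞ (fun y => EuclideanSpace.single (j b) ((n (j a) : ℝ)) + S y)
      (overlap κ κ') := (contDiff_const.add S.contDiff).contDiffOn
  have hf2 : ContDiffOn ℝ ∞ (fun y => -(diagCLM (fun l => (d' l)⁻¹) c') + L' ((W ∘ P) y))
      (overlap κ κ') := contDiffOn_const.add (L'.contDiff.comp_contDiffOn hWP)
  refine (norm_iteratedFDerivWithin_add_le hu hf1 hf2 hx k).trans (add_le_add ?_ ?_)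
  · simpa using norm_iteratedFDerivWithin_affine_le hu (fun y _ => rfl) hSn hx hk
  refine (norm_iteratedFDerivWithin_const_add_clm_le hu hWP _ L' hx hk).trans ?_
  have hx' := hmaps hx
  have hPx : P x ∈ endSlice (j a) (half a) (s₀ + 1) := hn.mem_endSlice (H.half_ne a) hx.1
  have hκ'x : κ' (κ.symm x) ∈ endCellTarget (half b) n' := κ'.map_source hx.2
  have hWx : W (c + diagCLM d x) = c' + diagCLM d' (κ' (κ.symm x)) := by
    rw [← hc'.apply_eq _ hx.2, hW, Function.comp_apply, hc.symm_apply hx.1]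
  have hWPx : W (P x) ∈ endSlice (j b) (half b) (s₀ + 1) := by
    have e1 : W (P x) = setCoord (j b) (s₀ + 1) (W (c + diagCLM d x)) :=
      H.translate_eq a b _ hx' _ hs₁
    rw [e1, hWx]
    exact hn'.mem_endSlice (H.half_ne b) hκ'x
  have hmain := norm_iteratedFDerivWithin_comp_affine_le (n := k) hWsm
    ((H.smooth a).uniqueDiffOn_overlap (H.smooth b)) hu hPmaps hPaff hPn hx
    fun i hi => hC i hi (P x) hPx (hPmaps hx).2 hWPx
  -- Overlapping cells have comparable sizes.
  have hheights : (n' (j b) : ℝ) < n (j a) + 2 := by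
    have e2 : W (c + diagCLM d x) (j b) = n (j a) + x (j a) := by
      rw [hW, Function.comp_apply, H.height_eq a b _ hx', endCenter_add_apply, endScale_same,
        one_mul]
    rw [hWx, endCenter_add_apply, endScale_same, one_mul] at e2
    have h1 := (hx.1.1 (j a)).2
    have h2 := (hκ'x.1 (j b)).1
    linarith
  have hheights' : (n' (j b) : ℝ) ≤ n (j a) + 1 := by
    have : n' (j b) < n (j a) + 2 := by exact_mod_cast hheights
    exact_mod_cast Int.le_of_lt_add_one (by omega)
  have hratio : ε'⁻¹ * ε ≤ Real.exp β := by
    have : ε'⁻¹ * ε = Real.exp (β * (n' (j b) - n (j a))) := by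
      rw [hε, hε', mul_sub, sub_eq_add_neg, Real.exp_add, Real.exp_neg (β * n' (j b))]
      field_simp
    rw [this, Real.exp_le_exp]
    have := mul_le_mul_of_nonneg_left hheights' H.rate_nonneg
    linarith
  have hε1 : ε ≤ 1 := by
    have h0 : (0 : ℝ) ≤ n (j a) := by have := hn.height; have := H.base_nonneg; linarith
    have : Real.exp (-(β * n (j a))) ≤ 1 := Real.exp_le_one_iff.2 (by
      have := mul_nonneg H.rate_nonneg h0; linarith)
    rw [hε]; linarith
  calc ‖L'‖ * ‖iteratedFDerivWithin ℝ k (W ∘ P) (overlap κ κ') x‖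
      ≤ ε'⁻¹ * (k.factorial * C * ε ^ k) := by gcongr
    _ ≤ ε'⁻¹ * (k.factorial * C * ε) := by
        have := pow_le_of_le_one hε0.le hε1 (by omega : k ≠ 0)
        gcongr
    _ = k.factorial * C * (ε'⁻¹ * ε) := by ring
    _ ≤ k.factorial * C * Real.exp β := by gcongr

end IsCylindricalEnd

end EndBounds

/-! ### The metric in the cells of an end -/

section EndMetric

variable {m : ℕ} [NeZero m] {M : Type*} [TopologicalSpace M]
  [ChartedSpace (EuclideanHalfSpace m) M] [IsManifold (𝓡∂ m) ∞ M]

namespace IsCylindricalEnd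

variable {A : Type*} {h : SmoothMetric m M} {Φ : A → PartialEquiv M (EuclideanSpace ℝ (Fin m))}
  {j : A → Fin m} {half : A → Prop} {s₀ β : ℝ}

/-- In a cell the factor `e^(2 β s)` of the metric is compensated by the size of the cell, up to
the bounded factor `e^(2 β x j)`. -/
theorem chartMetric_cell (H : IsCylindricalEnd h Φ j half s₀ β) {a : A} {n : Fin m → ℤ}
    (hn : EndAdmissible β s₀ (j a) (half a) n) {x : EuclideanSpace ℝ (Fin m)}
    (hx : x ∈ endCellTarget (half a) n) (ξ η : EuclideanSpace ℝ (Fin m)) :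
    chartMetric h (H.cell hn) x ξ η = ξ (j a) * η (j a) +
      Real.exp (-(2 * β * (s₀ + 1))) / 4 * Real.exp (2 * β * x (j a)) *
        chartMetric h (Φ a) (setCoord (j a) (s₀ + 1) (endCenter β (j a) n +
          diagCLM (endScale β (j a) n) x)) (diagCLM (killCoord (j a)) ξ)
          (diagCLM (killCoord (j a)) η) := by
  have hsm := (H.isNormalizedChart_cell hn).isSmoothChart
  have hmem := H.cell_mem_target hn x hx
  rw [(H.isCell hn).chartMetric_eq (H.smooth a) hsm h hx,
    H.metric_eq a _ hmem (s₀ + 1) (by linarith)]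
  have hk : ∀ ξ : EuclideanSpace ℝ (Fin m), diagCLM (killCoord (j a))
      (diagCLM (endScale β (j a) n) ξ) =
      (Real.exp (-(β * n (j a))) / 2) • diagCLM (killCoord (j a)) ξ := by
    intro ξ
    ext l
    by_cases hl : l = j a
    · simp [killCoord, hl]
    · simp [killCoord, hl, endScale_of_ne hl]
  rw [hk, hk, chartMetric_smul_smul, endCenter_add_apply, diagCLM_apply, diagCLM_apply,
    endScale_same]
  have he : Real.exp (2 * β * (1 * (n (j a) + x (j a)) - (s₀ + 1))) *
      (Real.exp (-(β * n (j a))) / 2 * (Real.exp (-(β * n (j a))) / 2)) =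
      Real.exp (-(2 * β * (s₀ + 1))) / 4 * Real.exp (2 * β * x (j a)) := by
    have : Real.exp (2 * β * (1 * (n (j a) + x (j a)) - (s₀ + 1))) =
        Real.exp (β * n (j a)) * Real.exp (β * n (j a)) * Real.exp (-(2 * β * (s₀ + 1))) *
        Real.exp (2 * β * x (j a)) := by
      rw [← Real.exp_add, ← Real.exp_add, ← Real.exp_add]
      ring_nf
    rw [this, Real.exp_neg (β * n (j a))]
    field_simp
    norm_num
  set G := chartMetric h (Φ a) (setCoord (j a) (s₀ + 1) (endCenter β (j a) n +
    diagCLM (endScale β (j a) n) x)) (diagCLM (killCoord (j a)) ξ) (diagCLM (killCoord (j a)) η)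
  linear_combination G * he

theorem sq_add_norm_kill_sq (i : Fin m) (ξ : EuclideanSpace ℝ (Fin m)) :
    ‖ξ‖ ^ 2 = ξ i ^ 2 + ‖diagCLM (killCoord i) ξ‖ ^ 2 := by
  rw [EuclideanSpace.real_norm_sq_eq, EuclideanSpace.real_norm_sq_eq,
    ← Finset.add_sum_erase _ _ (Finset.mem_univ i),
    ← Finset.add_sum_erase (f := fun l => diagCLM (killCoord i) ξ l ^ 2) _ (Finset.mem_univ i)]
  simp only [diagCLM_apply, killCoord, if_true, zero_mul]
  rw [zero_pow two_ne_zero, zero_add]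
  congr 1
  refine Finset.sum_congr rfl fun l hl => ?_
  rw [if_neg (Finset.ne_of_mem_erase hl), one_mul]

theorem slice_subset (H : IsCylindricalEnd h Φ j half s₀ β) (a : A) :
    endSlice (j a) (half a) (s₀ + 1) ⊆ (Φ a).target := by
  rw [H.target]; exact endSlice_subset_endBox (by linarith)

/-- In the cells, the metric is equivalent to the Euclidean one: in the direction of the height it
is Euclidean, and in the other directions it is comparable with the metric on a compact slice. -/
theorem metric_elliptic [Finite A] (H : IsCylindricalEnd h Φ j half s₀ β) :
    ∃ c : ℝ, 1 ≤ c ∧ ∀ κ ∈ H.cells, ∀ x ∈ κ.target, ∀ ξ : EuclideanSpace ℝ (Fin m),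
      ‖ξ‖ ^ 2 / c ≤ chartMetric h κ x ξ ξ ∧ chartMetric h κ x ξ ξ ≤ c * ‖ξ‖ ^ 2 := by
  have key : ∀ a : A, a ∈ (univ : Set A) → ∃ c : ℝ, 1 ≤ c ∧
      ∀ x ∈ endSlice (j a) (half a) (s₀ + 1), ∀ ξ : EuclideanSpace ℝ (Fin m),
      c⁻¹ * ‖ξ‖ ^ 2 ≤ chartMetric h (Φ a) x ξ ξ ∧ chartMetric h (Φ a) x ξ ξ ≤ c * ‖ξ‖ ^ 2 := by
    intro a _
    obtain ⟨c, hc1, hc2⟩ := (H.smooth a).exists_elliptic_bound h (isCompact_endSlice _ _ _)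
      (H.slice_subset a)
    refine ⟨c, hc1, fun x hx ξ => ?_⟩
    rw [inv_mul_eq_div]; exact hc2 x hx ξ
  obtain ⟨c, hc⟩ := finite_univ.exists_uniform_bound key fun a c c' hcc hh =>
    ⟨hh.1.trans hcc, fun x hx ξ => by
      obtain ⟨h1, h2⟩ := hh.2 x hx ξ
      have : 0 < c := by linarith [hh.1]
      exact ⟨le_trans (by gcongr) h1, h2.trans (by gcongr)⟩⟩
  set K := Real.exp (-(2 * β * (s₀ + 1))) / 4 with hK
  have hK0 : 0 < K := by positivity
  set c₁ := max 1 (max (K * Real.exp (2 * β) * c) (K * Real.exp (-(2 * β)) * c⁻¹)⁻¹) with hc₁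
  have hc₁1 : 1 ≤ c₁ := le_max_left _ _
  refine ⟨c₁, hc₁1, ?_⟩
  rintro κ ⟨a, n, hn, rfl⟩ x hx ξ
  obtain ⟨hc1, hc2⟩ := hc a (mem_univ _)
  have hc0 : 0 < c := by linarith
  rw [H.chartMetric_cell hn hx, sq_add_norm_kill_sq (j a) ξ, ← hK]
  obtain ⟨hG1, hG2⟩ := hc2 _ (hn.mem_endSlice (H.half_ne a) hx)
    (diagCLM (killCoord (j a)) ξ)
  set G := chartMetric h (Φ a) (setCoord (j a) (s₀ + 1) (endCenter β (j a) n +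
    diagCLM (endScale β (j a) n) x)) (diagCLM (killCoord (j a)) ξ) (diagCLM (killCoord (j a)) ξ)
  set v := ‖diagCLM (killCoord (j a)) ξ‖ ^ 2
  have hv : 0 ≤ v := by positivity
  have hG0 : 0 ≤ G := le_trans (by positivity) hG1
  have hx1 := hx.1 (j a)
  have hβ := H.rate_nonneg
  have hE1 : Real.exp (-(2 * β)) ≤ Real.exp (2 * β * x (j a)) := Real.exp_le_exp.2 (by
    nlinarith [hx1.1])
  have hE2 : Real.exp (2 * β * x (j a)) ≤ Real.exp (2 * β) := Real.exp_le_exp.2 (by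
    nlinarith [hx1.2])
  set E := Real.exp (2 * β * x (j a))
  have hlow : c₁⁻¹ * v ≤ K * E * G := by
    have h1 : c₁⁻¹ ≤ K * Real.exp (-(2 * β)) * c⁻¹ :=
      inv_le_of_inv_le₀ (by positivity) ((le_max_right _ _).trans (le_max_right _ _))
    calc c₁⁻¹ * v ≤ K * Real.exp (-(2 * β)) * c⁻¹ * v := by gcongr
      _ = K * Real.exp (-(2 * β)) * (c⁻¹ * v) := by ring
      _ ≤ K * E * G := by gcongr
  have hup : K * E * G ≤ c₁ * v := by
    have h1 : K * Real.exp (2 * β) * c ≤ c₁ := (le_max_left _ _).trans (le_max_right _ _)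
    calc K * E * G ≤ K * Real.exp (2 * β) * (c * v) := by gcongr
      _ = K * Real.exp (2 * β) * c * v := by ring
      _ ≤ c₁ * v := by gcongr
  have hc₁' : c₁⁻¹ ≤ 1 := inv_le_one_of_one_le₀ hc₁1
  have hξ : 0 ≤ ξ (j a) ^ 2 := sq_nonneg _
  constructor
  · rw [div_eq_inv_mul, mul_add]
    have := mul_le_mul_of_nonneg_right hc₁' hξ
    linarith
  · rw [mul_add]
    have := mul_le_mul_of_nonneg_right hc₁1 hξ
    linarith

/-- The derivatives of the coefficients of the metric in the cells are bounded: the coefficients are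
constants or products of `e^(2 β x j)` with the coefficients on a compact slice. -/
theorem coeff_bounds [Finite A] (H : IsCylindricalEnd h Φ j half s₀ β) (k : ℕ) :
    ∃ C : ℝ, ∀ κ ∈ H.cells, ∀ a b : Fin m, ∀ x ∈ κ.target,
      ‖iteratedFDerivWithin ℝ k (fun y => chartMetric h κ y (EuclideanSpace.single a 1)
        (EuclideanSpace.single b 1)) κ.target x‖ ≤ C := by
  have key : ∀ a : A, a ∈ (univ : Set A) → ∃ C : ℝ, 0 ≤ C ∧ ∀ i ≤ k, ∀ p q : Fin m,
      ∀ x ∈ endSlice (j a) (half a) (s₀ + 1),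
      ‖iteratedFDerivWithin ℝ i (fun y => chartMetric h (Φ a) y (EuclideanSpace.single p 1)
        (EuclideanSpace.single q 1)) (Φ a).target x‖ ≤ C := by
    intro a _
    obtain ⟨C, hC1, hC2, hC3⟩ := (H.smooth a).exists_bound_coeff h (isCompact_endSlice _ _ _)
      (H.slice_subset a)
    exact ⟨C k, hC2 k, fun i hi p q x hx => (hC3 i p q x hx).trans (hC1 hi)⟩
  obtain ⟨C, hC⟩ := finite_univ.exists_uniform_bound key fun a C C' hCC hh =>
    ⟨hh.1.trans hCC, fun i hi p q x hx => (hh.2 i hi p q x hx).trans hCC⟩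
  have key2 : ∀ il : ℕ × Fin m, il ∈ (Finset.range (k + 1) : Set ℕ) ×ˢ (univ : Set (Fin m)) →
      ∃ D : ℝ, ∀ x ∈ openCube m, ‖iteratedFDeriv ℝ il.1
      (fun y : EuclideanSpace ℝ (Fin m) => Real.exp (2 * β * y il.2)) x‖ ≤ D := by
    intro il _
    have hsm : ContDiff ℝ ∞ fun y : EuclideanSpace ℝ (Fin m) => Real.exp (2 * β * y il.2) := by
      fun_prop
    obtain ⟨D, hD⟩ := (isCompact_closedBall (0 : EuclideanSpace ℝ (Fin m))
      (√m)).exists_bound_of_continuousOn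
      (hsm.continuous_iteratedFDeriv (m := il.1) (by exact_mod_cast le_top)).continuousOn
    exact ⟨D, fun x hx => hD x (mem_closedBall_zero_iff.2 (norm_le_of_mem_openCube hx))⟩
  obtain ⟨D, hD⟩ := ((Finset.finite_toSet _).prod finite_univ).exists_uniform_bound key2
    fun il D D' hDD hh x hx => (hh x hx).trans hDD
  set K := Real.exp (-(2 * β * (s₀ + 1))) / 4 with hK
  have hK0 : 0 < K := by positivity
  refine ⟨1 + K * ∑ i ∈ Finset.range (k + 1), (k.choose i : ℝ) * |D| *
    ((k - i).factorial * C * 1 ^ (k - i)), ?_⟩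
  rintro κ ⟨a, n, hn, rfl⟩ p q x hx
  have hC := hC a (mem_univ _)
  have hsm := (H.isNormalizedChart_cell hn).isSmoothChart
  have hu := hsm.uniqueDiffOn_target
  have hsumnn : 0 ≤ K * ∑ i ∈ Finset.range (k + 1), (k.choose i : ℝ) * |D| *
      ((k - i).factorial * C * 1 ^ (k - i)) := by
    have := hC.1
    positivity
  -- The coefficients which involve the direction of the height are constant.
  by_cases hpq : p = j a ∨ q = j a
  · have heq : EqOn (fun y => chartMetric h (H.cell hn) y (EuclideanSpace.single p 1)
        (EuclideanSpace.single q 1)) (fun _ => EuclideanSpace.single p (1 : ℝ) (j a) *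
          EuclideanSpace.single q (1 : ℝ) (j a)) (H.cell hn).target := by
      intro y hy
      have hk : diagCLM (killCoord (j a)) (EuclideanSpace.single (j a) (1 : ℝ)) = 0 := by
        rw [diagCLM_single]; simp [killCoord]
      simp only [H.chartMetric_cell hn hy]
      rcases hpq with rfl | rfl <;> simp [hk, chartMetric_eq_chartForm]
    rw [iteratedFDerivWithin_congr heq hx]
    refine le_trans ?_ (le_add_of_nonneg_right hsumnn)
    rcases Nat.eq_zero_or_pos k with rfl | hk
    · rw [norm_iteratedFDerivWithin_zero]
      simp only [PiLp.single_apply]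
      split_ifs <;> simp
    · rw [iteratedFDerivWithin_const_of_ne hk.ne']; simp
  · push Not at hpq
    set P : EuclideanSpace ℝ (Fin m) → EuclideanSpace ℝ (Fin m) := fun y =>
      setCoord (j a) (s₀ + 1) (endCenter β (j a) n + diagCLM (endScale β (j a) n) y) with hP
    have hPmaps : MapsTo P (H.cell hn).target (Φ a).target := fun y hy =>
      H.slice_subset a (hn.mem_endSlice (H.half_ne a) hy)
    have hPaff : EqOn P (fun y => setCoord (j a) (s₀ + 1) (endCenter β (j a) n) +
        diagCLM (fun l => killCoord (j a) l * endScale β (j a) n l) y) (H.cell hn).target := by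
      intro y _
      ext l
      simp only [hP, setCoord, PiLp.add_apply, diagCLM_apply]
      ring
    have hε1 : Real.exp (-(β * n (j a))) / 2 ≤ 1 := by
      have h0 : (0 : ℝ) ≤ n (j a) := by have := hn.height; have := H.base_nonneg; linarith
      have : Real.exp (-(β * n (j a))) ≤ 1 := Real.exp_le_one_iff.2 (by
        have := mul_nonneg H.rate_nonneg h0; linarith)
      linarith
    have hPn : ‖diagCLM (fun l => killCoord (j a) l * endScale β (j a) n l)‖ ≤ 1 :=
      norm_diagCLM_le zero_le_one fun l => (killCoord_mul_endScale_le a l).trans hε1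
    set G := fun y => chartMetric h (Φ a) y (EuclideanSpace.single p 1)
      (EuclideanSpace.single q 1) with hG
    have hGsm : ContDiffOn ℝ ∞ G (Φ a).target := (H.smooth a).contDiffOn_chartMetric h _ _
    have hGP : ContDiffOn ℝ ∞ (G ∘ P) (H.cell hn).target :=
      hGsm.comp ((contDiff_const.add (ContinuousLinearMap.contDiff _)).contDiffOn.congr hPaff)
        hPmaps
    set E := fun y : EuclideanSpace ℝ (Fin m) => Real.exp (2 * β * y (j a)) with hE
    have hEsm : ContDiff ℝ ∞ E := by fun_prop
    have hEG : ContDiffOn ℝ ∞ (fun y => E y * (G ∘ P) y) (H.cell hn).target :=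
      hEsm.contDiffOn.mul hGP
    have heq : EqOn (fun y => chartMetric h (H.cell hn) y (EuclideanSpace.single p 1)
        (EuclideanSpace.single q 1)) (K • fun y => E y * (G ∘ P) y) (H.cell hn).target := by
      intro y hy
      have hk : ∀ l ≠ j a, diagCLM (killCoord (j a)) (EuclideanSpace.single l (1 : ℝ)) =
          EuclideanSpace.single l 1 := by
        intro l hl
        rw [diagCLM_single]; simp [killCoord, hl]
      simp only [H.chartMetric_cell hn hy, hk p hpq.1, hk q hpq.2]
      simp [hK, hE, hG, hP, hpq.1.symm, mul_assoc]
    rw [iteratedFDerivWithin_congr heq hx, iteratedFDerivWithin_const_smul_apply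
      ((hEG x hx).of_le (by exact_mod_cast le_top)) hu hx, norm_smul, Real.norm_eq_abs,
      abs_of_pos hK0]
    refine le_trans ?_ (le_add_of_nonneg_left zero_le_one)
    refine mul_le_mul_of_nonneg_left ?_ hK0.le
    refine (norm_iteratedFDerivWithin_mul_le hEsm.contDiffOn hGP hu hx
      (n := k) (by exact_mod_cast le_top)).trans ?_
    refine Finset.sum_le_sum fun i hi => ?_
    refine mul_le_mul (mul_le_mul_of_nonneg_left ?_ (by positivity)) ?_ (norm_nonneg _)
      (by positivity)
    · rw [iteratedFDerivWithin_eq_iteratedFDeriv hu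
        (hEsm.contDiffAt.of_le (by exact_mod_cast le_top)) hx]
      exact (hD (i, j a) ⟨hi, mem_univ _⟩ x hx.1).trans (le_abs_self _)
    · refine norm_iteratedFDerivWithin_comp_affine_le hGsm (H.smooth a).uniqueDiffOn_target hu
        hPmaps hPaff hPn hx fun i' hi' => hC.2 i' (hi'.trans (Nat.sub_le _ _)) p q _ ?_
      exact hn.mem_endSlice (H.half_ne a) hx

end IsCylindricalEnd

end EndMetric

/-! ### Finite families of small charts -/

section FiniteFamilies

variable {m : ℕ} [NeZero m] {M : Type*} [TopologicalSpace M]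
  [ChartedSpace (EuclideanHalfSpace m) M]

/-- A normalized chart which is a relatively compact part of a larger chart. -/
structure IsCompactCell (κ : PartialEquiv M (EuclideanSpace ℝ (Fin m)))
    (κ₀ : PartialEquiv M (EuclideanSpace ℝ (Fin m))) (c : EuclideanSpace ℝ (Fin m))
    (d : Fin m → ℝ) (Q : Set (EuclideanSpace ℝ (Fin m))) : Prop where
  normalized : IsNormalizedChart κ
  smooth : IsSmoothChart κ₀
  isCell : IsCell κ κ₀ c d
  isCompact : IsCompact Q
  subset_target : Q ⊆ κ₀.target
  mapsTo : ∀ x ∈ κ.target, c + diagCLM d x ∈ Q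

/-- The derivatives of order `k` of the coordinate changes between two families of charts are
bounded. -/
def TransitionBound (k : ℕ) (X Y : Set (PartialEquiv M (EuclideanSpace ℝ (Fin m)))) : Prop :=
  ∃ C : ℝ, ∀ κ ∈ X, ∀ κ' ∈ Y, ∀ x ∈ overlap κ κ',
    ‖iteratedFDerivWithin ℝ k (κ' ∘ κ.symm) (overlap κ κ') x‖ ≤ C

theorem TransitionBound.union_left {k : ℕ}
    {X X' Y : Set (PartialEquiv M (EuclideanSpace ℝ (Fin m)))} (h : TransitionBound k X Y)
    (h' : TransitionBound k X' Y) : TransitionBound k (X ∪ X') Y := by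
  obtain ⟨C, hC⟩ := h
  obtain ⟨C', hC'⟩ := h'
  refine ⟨max C C', ?_⟩
  rintro κ (hκ | hκ) κ' hκ' x hx
  · exact (hC κ hκ κ' hκ' x hx).trans (le_max_left _ _)
  · exact (hC' κ hκ κ' hκ' x hx).trans (le_max_right _ _)

theorem TransitionBound.union_right {k : ℕ}
    {X Y Y' : Set (PartialEquiv M (EuclideanSpace ℝ (Fin m)))} (h : TransitionBound k X Y)
    (h' : TransitionBound k X Y') : TransitionBound k X (Y ∪ Y') := by
  obtain ⟨C, hC⟩ := h
  obtain ⟨C', hC'⟩ := h'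
  refine ⟨max C C', ?_⟩
  rintro κ hκ κ' (hκ' | hκ') x hx
  · exact (hC κ hκ κ' hκ' x hx).trans (le_max_left _ _)
  · exact (hC' κ hκ κ' hκ' x hx).trans (le_max_right _ _)

theorem transitionBound_of_disjoint {k : ℕ}
    {X Y : Set (PartialEquiv M (EuclideanSpace ℝ (Fin m)))}
    (h : ∀ κ ∈ X, ∀ κ' ∈ Y, Disjoint κ.source κ'.source) : TransitionBound k X Y :=
  ⟨0, fun κ hκ κ' hκ' _ hx =>
    absurd hx.2 (disjoint_left.1 (h κ hκ κ' hκ') (κ.map_target hx.1))⟩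

theorem TransitionBound.of_finite {k : ℕ}
    {X Y : Set (PartialEquiv M (EuclideanSpace ℝ (Fin m)))} (hX : X.Finite) (hY : Y.Finite)
    (h : ∀ κ ∈ X, ∀ κ' ∈ Y, TransitionBound k {κ} {κ'}) : TransitionBound k X Y := by
  obtain ⟨C, hC⟩ := (hX.prod hY).exists_uniform_bound
    (P := fun κκ' C => ∀ x ∈ overlap κκ'.1 κκ'.2,
      ‖iteratedFDerivWithin ℝ k (κκ'.2 ∘ κκ'.1.symm) (overlap κκ'.1 κκ'.2) x‖ ≤ C)
    (fun κκ' hκ => by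
      obtain ⟨C, hC⟩ := h _ hκ.1 _ hκ.2
      exact ⟨C, hC _ rfl _ rfl⟩)
    fun _ _ _ hCC hh x hx => (hh x hx).trans hCC
  exact ⟨C, fun κ hκ κ' hκ' => hC (κ, κ') ⟨hκ, hκ'⟩⟩

theorem exists_forall_le (d : Fin m → ℝ) : ∃ Λ, ∀ i, d i ≤ Λ := by
  obtain ⟨Λ, hΛ⟩ := (finite_range d).bddAbove
  exact ⟨Λ, fun i => hΛ (mem_range_self i)⟩

theorem IsCompactCell.transitionBound [T2Space M]
    {κ κ₀ κ' κ₀' : PartialEquiv M (EuclideanSpace ℝ (Fin m))}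
    {c c' : EuclideanSpace ℝ (Fin m)} {d d' : Fin m → ℝ} {Q Q' : Set (EuclideanSpace ℝ (Fin m))}
    (h : IsCompactCell κ κ₀ c d Q) (h' : IsCompactCell κ' κ₀' c' d' Q') (k : ℕ) :
    TransitionBound k {κ} {κ'} := by
  rcases Nat.eq_zero_or_pos k with rfl | hk
  · refine ⟨√m, ?_⟩
    rintro _ rfl _ rfl x hx
    exact norm_transition_zero_le h'.normalized.target_subset_openCube hx
  obtain ⟨C, hC1, -, hC⟩ := exists_bound_transition_of_isCompact h.smooth h'.smooth h.isCompact
    h.subset_target h'.isCompact h'.subset_target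
  obtain ⟨Λ, hΛ⟩ := exists_forall_le d
  obtain ⟨Λ', hΛ'⟩ := exists_forall_le fun i => (d' i)⁻¹
  refine ⟨Λ' * (k.factorial * C k * Λ ^ k), ?_⟩
  rintro _ rfl _ rfl x hx
  refine IsCell.norm_transition_le h.smooth h.normalized.isSmoothChart h'.smooth
    h'.normalized.isSmoothChart h.isCell h'.isCell hΛ hΛ' hx hk fun i hi => ?_
  have hm := h.isCell.mapsTo_overlap h'.isCell hx
  refine (hC i _ (h.mapsTo x hx.1) hm.2 ?_).trans (hC1 hi)
  rw [h.isCell.symm_apply hx.1, h'.isCell.apply_eq _ hx.2]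
  exact h'.mapsTo _ (_root_.PartialEquiv.map_source _ hx.2)

theorem exists_monotone_transitionBound {X Y : Set (PartialEquiv M (EuclideanSpace ℝ (Fin m)))}
    (h : ∀ k, TransitionBound k X Y) (k : ℕ) :
    ∃ C : ℝ, ∀ i ≤ k, ∀ κ ∈ X, ∀ κ' ∈ Y, ∀ x ∈ overlap κ κ',
      ‖iteratedFDerivWithin ℝ i (κ' ∘ κ.symm) (overlap κ κ') x‖ ≤ C := by
  obtain ⟨C, hC1, -, hC⟩ := exists_monotone_bound h fun n C C' hCC hh κ hκ κ' hκ' x hx =>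
    (hh κ hκ κ' hκ' x hx).trans hCC
  exact ⟨C k, fun i hi κ hκ κ' hκ' x hx => (hC i κ hκ κ' hκ' x hx).trans (hC1 hi)⟩

/-- Passing to cells of finitely many charts of a family preserves bounds for the coordinate
changes with the members of the family. -/
theorem TransitionBound.cell_right {X : Set (PartialEquiv M (EuclideanSpace ℝ (Fin m)))}
    (hX : ∀ κ ∈ X, IsSmoothChart κ) (h : ∀ k, TransitionBound k X X)
    {κ' κ₀' : PartialEquiv M (EuclideanSpace ℝ (Fin m))} {c' : EuclideanSpace ℝ (Fin m)}
    {d' : Fin m → ℝ} (hκ₀' : κ₀' ∈ X) (hκ' : IsNormalizedChart κ') (hc : IsCell κ' κ₀' c' d')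
    (k : ℕ) : TransitionBound k X {κ'} := by
  rcases Nat.eq_zero_or_pos k with rfl | hk
  · refine ⟨√m, ?_⟩
    rintro _ _ _ rfl x hx
    exact norm_transition_zero_le hκ'.target_subset_openCube hx
  obtain ⟨C, hC⟩ := exists_monotone_transitionBound h k
  obtain ⟨Λ', hΛ'⟩ := exists_forall_le fun i => (d' i)⁻¹
  refine ⟨Λ' * (k.factorial * C * 1 ^ k), ?_⟩
  rintro κ hκ _ rfl x hx
  exact IsCell.norm_transition_le (hX κ hκ) (hX κ hκ) (hX _ hκ₀') hκ'.isSmoothChart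
    (IsCell.refl κ) hc (fun _ => le_rfl) hΛ' hx hk fun i hi =>
      hC i hi κ hκ κ₀' hκ₀' _ ((IsCell.refl κ).mapsTo_overlap hc hx)

theorem TransitionBound.cell_left {X : Set (PartialEquiv M (EuclideanSpace ℝ (Fin m)))}
    (hX : ∀ κ ∈ X, IsSmoothChart κ) (hX' : ∀ κ ∈ X, κ.target ⊆ openCube m)
    (h : ∀ k, TransitionBound k X X)
    {κ κ₀ : PartialEquiv M (EuclideanSpace ℝ (Fin m))} {c : EuclideanSpace ℝ (Fin m)}
    {d : Fin m → ℝ} (hκ₀ : κ₀ ∈ X) (hκ : IsNormalizedChart κ) (hc : IsCell κ κ₀ c d)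
    (k : ℕ) : TransitionBound k {κ} X := by
  rcases Nat.eq_zero_or_pos k with rfl | hk
  · refine ⟨√m, ?_⟩
    rintro _ rfl κ' hκ' x hx
    exact norm_transition_zero_le (hX' κ' hκ') hx
  obtain ⟨C, hC⟩ := exists_monotone_transitionBound h k
  obtain ⟨Λ, hΛ⟩ := exists_forall_le d
  refine ⟨1 * (k.factorial * C * Λ ^ k), ?_⟩
  rintro _ rfl κ' hκ' x hx
  exact IsCell.norm_transition_le (hX _ hκ₀) hκ.isSmoothChart (hX κ' hκ') (hX κ' hκ')
    hc (IsCell.refl κ') hΛ (fun _ => by simp) hx hk fun i hi =>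
      hC i hi κ₀ hκ₀ κ' hκ' _ (hc.mapsTo_overlap (IsCell.refl κ') hx)

variable [IsManifold (𝓡∂ m) ∞ M]

theorem IsCompactCell.elliptic {κ κ₀ : PartialEquiv M (EuclideanSpace ℝ (Fin m))}
    {c : EuclideanSpace ℝ (Fin m)} {d : Fin m → ℝ} {Q : Set (EuclideanSpace ℝ (Fin m))}
    (hκ : IsCompactCell κ κ₀ c d Q) (h : SmoothMetric m M) :
    ∃ C : ℝ, 1 ≤ C ∧ ∀ x ∈ κ.target, ∀ ξ : EuclideanSpace ℝ (Fin m),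
      ‖ξ‖ ^ 2 / C ≤ chartMetric h κ x ξ ξ ∧ chartMetric h κ x ξ ξ ≤ C * ‖ξ‖ ^ 2 := by
  obtain ⟨C, hC1, hC⟩ := hκ.smooth.exists_elliptic_bound h hκ.isCompact hκ.subset_target
  obtain ⟨Λ, hΛ⟩ := exists_forall_le d
  obtain ⟨Λ', hΛ'⟩ := exists_forall_le fun i => (d i)⁻¹
  have hpos := hκ.isCell.pos
  have hΛ0 : 0 < Λ := (hpos 0).trans_le (hΛ 0)
  have hΛ'0 : 0 < Λ' := (inv_pos.2 (hpos 0)).trans_le (hΛ' 0)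
  have hC0 : 0 < C := by linarith
  set D := max 1 (max (C * Λ ^ 2) (C * Λ' ^ 2)) with hD
  have hD1 : 1 ≤ D := le_max_left _ _
  refine ⟨D, hD1, fun x hx ξ => ?_⟩
  rw [hκ.isCell.chartMetric_eq hκ.smooth hκ.normalized.isSmoothChart h hx]
  obtain ⟨h1, h2⟩ := hC _ (hκ.mapsTo x hx) (diagCLM d ξ)
  have h3 : ‖diagCLM d ξ‖ ≤ Λ * ‖ξ‖ := (diagCLM d).le_of_opNorm_le
    (norm_diagCLM_le hΛ0.le fun i => by rw [abs_of_pos (hpos i)]; exact hΛ i) ξ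
  have h4 : ‖ξ‖ ≤ Λ' * ‖diagCLM d ξ‖ := by
    have : diagCLM (fun i => (d i)⁻¹) (diagCLM d ξ) = ξ := by
      ext i; simp [(hpos i).ne']
    conv_lhs => rw [← this]
    exact (diagCLM fun i => (d i)⁻¹).le_of_opNorm_le (norm_diagCLM_le hΛ'0.le fun i => by
      rw [abs_of_pos (inv_pos.2 (hpos i))]; exact hΛ' i) _
  constructor
  · refine le_trans ?_ h1
    rw [div_le_div_iff₀ (by linarith) hC0]
    calc ‖ξ‖ ^ 2 * C ≤ (Λ' * ‖diagCLM d ξ‖) ^ 2 * C := by gcongr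
      _ = ‖diagCLM d ξ‖ ^ 2 * (C * Λ' ^ 2) := by ring
      _ ≤ ‖diagCLM d ξ‖ ^ 2 * D := by
        gcongr; exact (le_max_right _ _).trans (le_max_right _ _)
  · calc _ ≤ C * ‖diagCLM d ξ‖ ^ 2 := h2
      _ ≤ C * (Λ * ‖ξ‖) ^ 2 := by gcongr
      _ = C * Λ ^ 2 * ‖ξ‖ ^ 2 := by ring
      _ ≤ D * ‖ξ‖ ^ 2 := by gcongr; exact (le_max_left _ _).trans (le_max_right _ _)

theorem IsCompactCell.coeff_bound {κ κ₀ : PartialEquiv M (EuclideanSpace ℝ (Fin m))}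
    {c : EuclideanSpace ℝ (Fin m)} {d : Fin m → ℝ} {Q : Set (EuclideanSpace ℝ (Fin m))}
    (hκ : IsCompactCell κ κ₀ c d Q) (h : SmoothMetric m M) (k : ℕ) :
    ∃ C : ℝ, ∀ a b : Fin m, ∀ x ∈ κ.target,
      ‖iteratedFDerivWithin ℝ k (fun y => chartMetric h κ y (EuclideanSpace.single a 1)
        (EuclideanSpace.single b 1)) κ.target x‖ ≤ C := by
  obtain ⟨C, hC1, -, hC⟩ := hκ.smooth.exists_bound_coeff h hκ.isCompact hκ.subset_target
  obtain ⟨Λ, hΛ⟩ := exists_forall_le d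
  exact ⟨_, fun a b x hx => hκ.isCell.norm_coeff_le hκ.smooth hκ.normalized.isSmoothChart h hΛ hx
    a b k fun i hi => (hC i a b _ (hκ.mapsTo x hx)).trans (hC1 hi)⟩

/-- Small normalized charts exist around every point of the domain of a chart. -/
theorem IsSmoothChart.exists_compactCell {κ₀ : PartialEquiv M (EuclideanSpace ℝ (Fin m))}
    (h : IsSmoothChart κ₀) {p : M} (hp : p ∈ κ₀.source) {V : Set M} (hV : V ∈ 𝓝 p) :
    ∃ κ c d Q, IsCompactCell κ κ₀ c d Q ∧ κ.source ⊆ V ∧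
      {q ∈ κ.source | κ q ∈ (3 / 4 : ℝ) • κ.target} ∈ 𝓝 p := by
  set x := κ₀ p with hx
  have hxt : x ∈ κ₀.target := κ₀.map_source hp
  -- Either `x` is an interior point of the target or it lies on the boundary hyperplane.
  obtain ⟨D, b, hD, hxD, hDt, hb⟩ : ∃ (D : Set (EuclideanSpace ℝ (Fin m))) (b : Prop),
      IsOpen D ∧ x ∈ D ∧ (∀ y ∈ D, y ∈ κ₀.target ↔ (b → 0 ≤ y 0)) ∧
      (b → x 0 = 0 ∧ ∀ y ∈ κ₀.target, 0 ≤ y 0) := by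
    obtain ⟨D, hD, hDt | hDt⟩ := h.target_eq
    · exact ⟨D, False, hD, hDt ▸ hxt, fun y hy => by simp [hDt, hy], False.elim⟩
    · have hx0 : 0 ≤ x 0 := (hDt ▸ hxt : x ∈ D ∩ halfSpaceSet m).2
      have hxD : x ∈ D := (hDt ▸ hxt : x ∈ D ∩ halfSpaceSet m).1
      rcases hx0.eq_or_lt with h0 | h0
      · refine ⟨D, True, hD, hxD, fun y hy => ?_, fun _ => ⟨h0.symm, fun y hy => ?_⟩⟩
        · rw [hDt]; simp [hy, halfSpaceSet]
        · rw [hDt] at hy; exact hy.2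
      · have ho : IsOpen {y : EuclideanSpace ℝ (Fin m) | 0 < y 0} :=
          isOpen_lt continuous_const (by fun_prop)
        refine ⟨D ∩ {y | 0 < y 0}, False, hD.inter ho, ⟨hxD, h0⟩, fun y hy => ?_, False.elim⟩
        rw [hDt]
        exact ⟨fun _ hf => hf.elim, fun _ => ⟨hy.1, le_of_lt (show 0 < y 0 from hy.2)⟩⟩
  have hVx : κ₀.symm ⁻¹' V ∈ 𝓝[κ₀.target] x := by
    refine h.continuousOn_symm x hxt ?_
    rw [hx, κ₀.left_inv hp]; exact hV
  obtain ⟨U, hU, hUV⟩ := mem_nhdsWithin_iff_exists_mem_nhds_inter.1 hVx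
  obtain ⟨ρ, hρ, hball⟩ := Metric.nhds_basis_closedBall.mem_iff.1
    (Filter.inter_mem hU (hD.mem_nhds hxD))
  set δ := ρ / √m with hδ
  have hm : 0 < √m := Real.sqrt_pos.2 (by exact_mod_cast Nat.pos_of_ne_zero (NeZero.ne m))
  have hδ0 : 0 < δ := by positivity
  set T : Set (EuclideanSpace ℝ (Fin m)) := {y | y ∈ openCube m ∧ (b → 0 ≤ y 0)} with hT
  set d : Fin m → ℝ := fun _ => δ with hd
  set Q := Metric.closedBall x ρ ∩ {y | b → 0 ≤ y 0} with hQ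
  have hQt : Q ⊆ κ₀.target := fun y hy => (hDt y (hball hy.1).2).2 hy.2
  have hTQ : ∀ y ∈ T, x + diagCLM d y ∈ Q := by
    intro y hy
    refine ⟨?_, fun hb' => ?_⟩
    · rw [mem_closedBall_iff_norm, add_sub_cancel_left]
      have h1 : ‖diagCLM d y‖ ≤ δ * ‖y‖ := (diagCLM d).le_of_opNorm_le
        (norm_diagCLM_le hδ0.le fun i => by rw [hd, abs_of_pos hδ0]) y
      have h2 := norm_le_of_mem_openCube hy.1
      calc ‖diagCLM d y‖ ≤ δ * √m := h1.trans (by gcongr)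
        _ = ρ := by rw [hδ]; field_simp
    · rw [PiLp.add_apply, diagCLM_apply, (hb hb').1, zero_add]
      exact mul_nonneg hδ0.le (hy.2 hb')
  have hQc : IsCompact Q := by
    refine (isCompact_closedBall x ρ).inter_right ?_
    have : {y : EuclideanSpace ℝ (Fin m) | b → 0 ≤ y 0} = ⋂ (_ : b), {y | 0 ≤ y 0} := by
      ext; simp
    rw [this]
    exact isClosed_iInter fun _ => isClosed_le continuous_const (by fun_prop)
  have hd0 : ∀ i, 0 < d i := fun _ => hδ0
  set κ := cellChart κ₀ x hd0 fun y hy => hQt (hTQ y hy) with hκ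
  have hpos : b → ∀ y ∈ κ₀.target, 0 ≤ cellCoord x d y 0 := by
    intro hb' y hy
    rw [cellCoord_apply, (hb hb').1, sub_zero]
    exact mul_nonneg (inv_pos.2 hδ0).le ((hb hb').2 y hy)
  have hTb : (¬ b ∧ T = openCube m) ∨ (b ∧ T = openCube m ∩ halfSpaceSet m) := by
    by_cases hb' : b
    · right; refine ⟨hb', ?_⟩; ext y; simp [hT, hb', halfSpaceSet]
    · left; refine ⟨hb', ?_⟩; ext y; simp [hT, hb']
  have hnorm : IsNormalizedChart κ := by
    have hDT : ∀ y ∈ κ₀.target, cellCoord x d y ∈ openCube m → cellCoord x d y ∈ T :=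
      fun y hy hy' => ⟨hy', fun hb' => hpos hb' y hy⟩
    rcases hTb with ⟨-, hTb⟩ | ⟨-, hTb⟩
    · exact (isSmoothChart_cellChart h isOpen_openCube (.inl hTb) hDT
        ).isNormalizedChart_of_openCube hTb
    · exact (isSmoothChart_cellChart h isOpen_openCube (.inr hTb) hDT
        ).isNormalizedChart_of_halfCube hTb
  refine ⟨κ, x, d, Q, ⟨hnorm, h, isCell_cellChart, hQc, hQt, hTQ⟩, fun q hq => ?_, ?_⟩
  · have hq' : κ₀ q ∈ Q := by
      rw [← add_diagCLM_cellCoord hd0 (κ₀ q)]; exact hTQ _ hq.2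
    have := hUV ⟨(hball hq'.1).1, hQt hq'⟩
    rwa [mem_preimage, κ₀.left_inv hq.1] at this
  · have hN : κ₀.source ∩ κ₀ ⁻¹' Metric.ball x (δ / 2) ∈ 𝓝 p :=
      (h.isOpen_inter_preimage Metric.isOpen_ball).mem_nhds
        ⟨hp, Metric.mem_ball_self (by positivity)⟩
    refine Filter.mem_of_superset hN fun q hq => ?_
    have habs : ∀ l, |cellCoord x d (κ₀ q) l| < 1 / 2 := by
      intro l
      have h1 : ‖κ₀ q - x‖ < δ / 2 := mem_ball_iff_norm.1 hq.2
      have h2 : |(κ₀ q - x) l| < δ / 2 := (PiLp.norm_apply_le (κ₀ q - x) l).trans_lt h1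
      rw [cellCoord_apply, abs_mul, abs_of_pos (inv_pos.2 hδ0), inv_mul_lt_iff₀ hδ0]
      rw [PiLp.sub_apply] at h2
      linarith
    refine ⟨⟨hq.1, fun l => abs_lt.1 ((habs l).trans (by norm_num)),
      fun hb' => hpos hb' _ (κ₀.map_source hq.1)⟩, ?_⟩
    refine mem_smul_set_of_forall_abs_lt (by norm_num) (fun l => (habs l).trans (by norm_num)) ?_
    rcases hTb with ⟨-, hTb⟩ | ⟨hb', hTb⟩
    · exact .inl hTb
    · exact .inr ⟨hTb, hpos hb' _ (κ₀.map_source hq.1)⟩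

end FiniteFamilies

/-! ### Gluing an end to a uniformly regular part -/

section Gluing

variable {m : ℕ} [NeZero m] {M : Type*} [TopologicalSpace M] [T2Space M]
  [ChartedSpace (EuclideanHalfSpace m) M] [IsManifold (𝓡∂ m) ∞ M]

namespace IsCylindricalEnd

variable {A : Type*} {h : SmoothMetric m M} {Φ : A → PartialEquiv M (EuclideanSpace ℝ (Fin m))}
  {j : A → Fin m} {half : A → Prop} {s₀ β : ℝ}

theorem exists_isCompactCell (H : IsCylindricalEnd h Φ j half s₀ β) {a : A} {n : Fin m → ℤ}
    (hn : EndAdmissible β s₀ (j a) (half a) n) :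
    ∃ κ₀ c d Q, IsCompactCell (H.cell hn) κ₀ c d Q := by
  refine ⟨Φ a, _, _, endSlab (j a) (half a) (n (j a) - 1) (n (j a) + 1),
    H.isNormalizedChart_cell hn, H.smooth a, H.isCell hn, isCompact_endSlab _ _ _ _, ?_, ?_⟩
  · intro z hz
    rw [H.target]
    have := hn.height
    exact ⟨by have := hz.1.1; linarith, fun l hl => (hz.2.1 l hl).trans_lt (by norm_num), hz.2.2⟩
  · intro x hx
    obtain ⟨-, h2, h3⟩ := hn.cell_bounds hx
    refine ⟨?_, h2, h3⟩
    rw [endCenter_add_apply, endScale_same, one_mul]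
    have := hx.1 (j a)
    exact ⟨by linarith [this.1], by linarith [this.2]⟩

/-- The cells which do not lie above the height `R`. -/
def lowCells (H : IsCylindricalEnd h Φ j half s₀ β) (R : ℝ) :
    Set (PartialEquiv M (EuclideanSpace ℝ (Fin m))) :=
  {κ | ∃ (a : A) (n : Fin m → ℤ) (hn : EndAdmissible β s₀ (j a) (half a) n),
    n (j a) ≤ R + 1 ∧ κ = H.cell hn}

/-- Up to any given height there are only finitely many cells, because the width of the cells is
bounded from below there. -/
theorem finite_lowCells [Finite A] (H : IsCylindricalEnd h Φ j half s₀ β) (R : ℝ) :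
    (H.lowCells R).Finite := by
  classical
  set B : ℝ := max (R + 1) (4 * Real.exp (β * (R + 1)))
  have hfin : (univ ×ˢ Icc (fun _ => -⌈B⌉) (fun _ => ⌈B⌉) : Set (A × (Fin m → ℤ))).Finite :=
    finite_univ.prod (finite_Icc _ _)
  let f : A × (Fin m → ℤ) → PartialEquiv M (EuclideanSpace ℝ (Fin m)) := fun an =>
    if hn : EndAdmissible β s₀ (j an.1) (half an.1) an.2 then H.cell hn else Φ an.1
  refine (hfin.image f).subset ?_
  rintro κ ⟨a, n, hn, hR, rfl⟩
  have hj0 : (0 : ℝ) ≤ n (j a) := by have := hn.height; have := H.base_nonneg; linarith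
  have hB : ∀ l, |(n l : ℝ)| ≤ B := by
    intro l
    by_cases hl : l = j a
    · subst hl
      rw [abs_of_nonneg hj0]; exact hR.trans (le_max_left _ _)
    · refine le_trans ?_ (le_max_right _ _)
      have h1 := hn.bound l hl
      rw [endScale_of_ne hl, Real.exp_neg] at h1
      have h2 : Real.exp (β * n (j a)) ≤ Real.exp (β * (R + 1)) :=
        Real.exp_le_exp.2 (mul_le_mul_of_nonneg_left hR H.rate_nonneg)
      have h3 := Real.exp_pos (β * n (j a))
      have h4 : |(n l : ℝ)| + 1 ≤ 4 * Real.exp (β * n (j a)) := by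
        rw [div_mul_eq_mul_div, div_le_iff₀ two_pos, inv_mul_le_iff₀ h3] at h1
        linarith
      linarith
  refine ⟨(a, n), ⟨mem_univ _, fun l => ?_, fun l => ?_⟩, dif_pos hn⟩
  · have := (abs_le.1 ((hB l).trans (Int.le_ceil B))).1
    exact_mod_cast this
  · have := (abs_le.1 ((hB l).trans (Int.le_ceil B))).2
    exact_mod_cast this

theorem mem_lowCells (H : IsCylindricalEnd h Φ j half s₀ β) {κ} (hκ : κ ∈ H.cells) {R : ℝ}
    {p : M} (hp : p ∈ κ.source) (hR : ∀ a, p ∈ (Φ a).source → Φ a p (j a) ≤ R) :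
    κ ∈ H.lowCells R := by
  obtain ⟨a, n, hn, rfl⟩ := hκ
  refine ⟨a, n, hn, ?_, rfl⟩
  have h1 := hR a ((H.isCell hn).source_subset hp)
  rw [(H.isCell hn).apply_eq p hp, endCenter_add_apply, endScale_same, one_mul] at h1
  have h2 := (((H.cell hn).map_source hp).1 (j a)).1
  linarith

end IsCylindricalEnd

theorem smul_target_mono {κ : PartialEquiv M (EuclideanSpace ℝ (Fin m))}
    (hκ : IsNormalizedChart κ) {r r' : ℝ} (hr : 0 < r) (hrr : r ≤ r') :
    r • κ.target ⊆ r' • κ.target := by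
  have hr' : 0 < r' := hr.trans_le hrr
  have hstar : ∀ x ∈ κ.target, ∀ t : ℝ, 0 ≤ t → t ≤ 1 → t • x ∈ κ.target := by
    have hcube : ∀ x ∈ openCube m, ∀ t : ℝ, 0 ≤ t → t ≤ 1 → t • x ∈ openCube m := by
      intro x hx t ht ht1 i
      have h1 := abs_lt.2 (hx i)
      refine abs_lt.1 ?_
      rw [PiLp.smul_apply, smul_eq_mul, abs_mul, abs_of_nonneg ht]
      exact (mul_le_of_le_one_left (abs_nonneg _) ht1).trans_lt h1
    rcases hκ.target_cases with h | h <;> rw [h]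
    · exact hcube
    · exact fun x hx t ht ht1 => ⟨hcube x hx.1 t ht ht1, mul_nonneg ht hx.2⟩
  rintro _ ⟨x, hx, rfl⟩
  refine ⟨(r / r') • x, hstar x hx _ (by positivity) ((div_le_one hr').2 hrr), ?_⟩
  simp only [smul_smul]
  rw [mul_div_cancel₀ _ hr'.ne']

/-- A manifold which is covered by the shrunk charts of a uniformly regular family `K₁`, a compact
set `B` and a cylindrical end is uniformly regular. The charts in `K₁` do not meet the end; they
belong to a larger family `K`, with bounded coordinate changes, which covers `B`. Near every point,
the height along the end is bounded, so that a compact set meets only finitely many cells of the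
end. -/
theorem isUniformlyRegular_of_cylindricalEnd [Nonempty M] {A : Type*} [Finite A]
    {h : SmoothMetric m M}
    {Φ : A → PartialEquiv M (EuclideanSpace ℝ (Fin m))} {j : A → Fin m} {half : A → Prop}
    {s₀ β : ℝ} (H : IsCylindricalEnd h Φ j half s₀ β)
    (K K₁ : Set (PartialEquiv M (EuclideanSpace ℝ (Fin m))))
    (hK : ∀ κ ∈ K, IsSmoothChart κ) (hKQ : ∀ κ ∈ K, κ.target ⊆ openCube m)
    (hKt : ∀ k, TransitionBound k K K) (hK₁K : K₁ ⊆ K) (hK₁n : ∀ κ ∈ K₁, IsNormalizedChart κ)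
    (hK₁m : ∃ n : ℕ, ∀ p : M, {κ ∈ K₁ | p ∈ κ.source}.encard ≤ n)
    (hK₁h : IsUniformlyRegularMetric h K₁)
    (hdisj : ∀ κ ∈ K₁, ∀ a, Disjoint κ.source (Φ a).source)
    {B : Set M} (hB : IsCompact B) (hBK : ∀ p ∈ B, ∃ κ ∈ K, p ∈ κ.source)
    {r : ℝ} (hr : r ∈ Ioo (0 : ℝ) 1)
    (hcover : ∀ p : M, (∃ κ ∈ K₁, p ∈ κ.source ∧ κ p ∈ r • κ.target) ∨ p ∈ B ∨
      ∃ a, p ∈ (Φ a).source ∧ s₀ + 2 ≤ Φ a p (j a) ∧ ∀ l ≠ j a, |Φ a p l| ≤ 1)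
    (hproper : ∀ p : M, ∃ V ∈ 𝓝 p, ∃ R : ℝ, ∀ a, ∀ q ∈ V, q ∈ (Φ a).source → Φ a q (j a) ≤ R) :
    IsUniformlyRegular h := by
  -- Cover `B` by finitely many small cells.
  have : Nonempty (PartialEquiv M (EuclideanSpace ℝ (Fin m))) :=
    ⟨⟨fun _ => 0, fun _ => Classical.arbitrary M, ∅, ∅, by simp, by simp, by simp, by simp⟩⟩
  choose! κB hκB hκB' using hBK
  choose V hV R hR using hproper
  have hcell : ∀ p ∈ B, ∃ κ c d Q, IsCompactCell κ (κB p) c d Q ∧ κ.source ⊆ V p ∧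
      {q ∈ κ.source | κ q ∈ (3 / 4 : ℝ) • κ.target} ∈ 𝓝 p := fun p hp =>
    (hK _ (hκB p hp)).exists_compactCell (hκB' p hp) (hV p)
  choose! F c d Q hF hFV hFn using hcell
  obtain ⟨t, htB, ht⟩ := hB.elim_nhds_subcover _ hFn
  set Fs : Set (PartialEquiv M (EuclideanSpace ℝ (Fin m))) := F '' (t : Set M) with hFs
  have hFfin : Fs.Finite := (Finset.finite_toSet t).image F
  have hFcell : ∀ κ ∈ Fs, ∃ κ₀ ∈ K, ∃ c d Q, IsCompactCell κ κ₀ c d Q := by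
    rintro _ ⟨p, hp, rfl⟩
    exact ⟨κB p, hκB p (htB p hp), _, _, _, hF p (htB p hp)⟩
  obtain ⟨Rmax, hRmax⟩ := ((Finset.finite_toSet t).image R).bddAbove
  have hFR : ∀ κ ∈ Fs, ∀ q ∈ κ.source, ∀ a, q ∈ (Φ a).source → Φ a q (j a) ≤ Rmax := by
    rintro _ ⟨p, hp, rfl⟩ q hq a ha
    exact (hR p a q (hFV p (htB p hp) hq) ha).trans (hRmax (mem_image_of_mem R hp))
  have hFnorm : ∀ κ ∈ Fs, IsNormalizedChart κ := fun κ hκ => by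
    obtain ⟨_, _, _, _, _, h⟩ := hFcell κ hκ
    exact h.normalized
  have hcnorm : ∀ κ ∈ H.cells, IsNormalizedChart κ := by
    rintro _ ⟨a, n, hn, rfl⟩; exact H.isNormalizedChart_cell hn
  have hnorm : ∀ κ ∈ K₁ ∪ Fs ∪ H.cells, IsNormalizedChart κ := by
    rintro κ ((hκ | hκ) | hκ)
    exacts [hK₁n κ hκ, hFnorm κ hκ, hcnorm κ hκ]
  have hlow : H.lowCells Rmax ⊆ H.cells := by
    rintro _ ⟨a, n, hn, -, rfl⟩; exact ⟨a, n, hn, rfl⟩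
  have hlowcell : ∀ κ ∈ H.lowCells Rmax, ∃ κ₀ c d Q, IsCompactCell κ κ₀ c d Q := by
    rintro _ ⟨a, n, hn, -, rfl⟩; exact H.exists_isCompactCell hn
  have hcellsub : ∀ κ ∈ H.cells, ∃ a, κ.source ⊆ (Φ a).source := by
    rintro _ ⟨a, n, hn, rfl⟩; exact ⟨a, (H.isCell hn).source_subset⟩
  have hK₁c : ∀ κ ∈ K₁, ∀ κ' ∈ H.cells, Disjoint κ.source κ'.source := fun κ hκ κ' hκ' => by
    obtain ⟨a, ha⟩ := hcellsub κ' hκ'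
    exact (hdisj κ hκ a).mono_right ha
  have hKK : ∀ k, TransitionBound k K₁ K₁ := fun k => by
    obtain ⟨C, hC⟩ := hKt k
    exact ⟨C, fun κ hκ κ' hκ' => hC κ (hK₁K hκ) κ' (hK₁K hκ')⟩
  have hKF : ∀ k, TransitionBound k K₁ Fs := fun k => by
    obtain ⟨C, hC⟩ := hFfin.exists_uniform_bound (P := fun κ' C => ∀ κ ∈ K₁, ∀ x ∈ overlap κ κ',
      ‖iteratedFDerivWithin ℝ k (κ' ∘ κ.symm) (overlap κ κ') x‖ ≤ C) (fun κ' hκ' => by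
        obtain ⟨κ₀, hκ₀, c, d, Q, hcc⟩ := hFcell κ' hκ'
        obtain ⟨C, hC⟩ := TransitionBound.cell_right hK hKt hκ₀ hcc.normalized hcc.isCell k
        exact ⟨C, fun κ hκ => hC κ (hK₁K hκ) κ' rfl⟩)
      fun _ _ _ hCC hh κ hκ x hx => (hh κ hκ x hx).trans hCC
    exact ⟨C, fun κ hκ κ' hκ' => hC κ' hκ' κ hκ⟩
  have hFK : ∀ k, TransitionBound k Fs K₁ := fun k => by
    obtain ⟨C, hC⟩ := hFfin.exists_uniform_bound (P := fun κ C => ∀ κ' ∈ K₁, ∀ x ∈ overlap κ κ',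
      ‖iteratedFDerivWithin ℝ k (κ' ∘ κ.symm) (overlap κ κ') x‖ ≤ C) (fun κ hκ => by
        obtain ⟨κ₀, hκ₀, c, d, Q, hcc⟩ := hFcell κ hκ
        obtain ⟨C, hC⟩ := TransitionBound.cell_left hK hKQ hKt hκ₀ hcc.normalized hcc.isCell k
        exact ⟨C, fun κ' hκ' => hC κ rfl κ' (hK₁K hκ')⟩)
      fun _ _ _ hCC hh κ hκ x hx => (hh κ hκ x hx).trans hCC
    exact ⟨C, fun κ hκ κ' hκ' => hC κ hκ κ' hκ'⟩
  have hFF : ∀ k, TransitionBound k Fs Fs := fun k =>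
    TransitionBound.of_finite hFfin hFfin fun κ hκ κ' hκ' => by
      obtain ⟨_, _, _, _, _, h1⟩ := hFcell κ hκ
      obtain ⟨_, _, _, _, _, h2⟩ := hFcell κ' hκ'
      exact h1.transitionBound h2 k
  -- Only finitely many cells of the end meet the cells which cover `B`.
  have hFE : ∀ k, TransitionBound k Fs H.cells := fun k => by
    obtain ⟨C, hC⟩ : TransitionBound k Fs (H.lowCells Rmax) :=
      TransitionBound.of_finite hFfin (H.finite_lowCells Rmax) fun κ hκ κ' hκ' => by
        obtain ⟨_, _, _, _, _, h1⟩ := hFcell κ hκ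
        obtain ⟨_, _, _, _, h2⟩ := hlowcell κ' hκ'
        exact h1.transitionBound h2 k
    exact ⟨C, fun κ hκ κ' hκ' x hx => hC κ hκ κ' (H.mem_lowCells hκ' hx.2
      (hFR κ hκ _ (κ.map_target hx.1))) x hx⟩
  have hEF : ∀ k, TransitionBound k H.cells Fs := fun k => by
    obtain ⟨C, hC⟩ : TransitionBound k (H.lowCells Rmax) Fs :=
      TransitionBound.of_finite (H.finite_lowCells Rmax) hFfin fun κ hκ κ' hκ' => by
        obtain ⟨_, _, _, _, _, h1⟩ := hFcell κ' hκ'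
        obtain ⟨_, _, _, _, h2⟩ := hlowcell κ hκ
        exact h2.transitionBound h1 k
    exact ⟨C, fun κ hκ κ' hκ' x hx => hC κ (H.mem_lowCells hκ (κ.map_target hx.1)
      (hFR κ' hκ' _ hx.2)) κ' hκ' x hx⟩
  have hr' : max r (3 / 4) ∈ Ioo (0 : ℝ) 1 :=
    ⟨lt_max_of_lt_left hr.1, max_lt hr.2 (by norm_num)⟩
  refine ⟨K₁ ∪ Fs ∪ H.cells, ⟨hnorm, ⟨max r (3 / 4), hr', fun p => ?_⟩, ?_, fun k => ?_⟩, ?_, ?_⟩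
  · rcases hcover p with ⟨κ, hκ, hp, hp'⟩ | hp | ⟨a, hp, hp1, hp2⟩
    · exact ⟨κ, .inl (.inl hκ), hp, smul_target_mono (hK₁n κ hκ) hr.1 (le_max_left _ _) hp'⟩
    · obtain ⟨q, hq, hpq⟩ := mem_iUnion₂.1 (ht hp)
      have hq' : F q ∈ Fs := mem_image_of_mem F hq
      exact ⟨F q, .inl (.inr hq'), hpq.1,
        smul_target_mono (hFnorm _ hq') (by norm_num) (le_max_right _ _) hpq.2⟩
    · obtain ⟨κ, hκ, hκ'⟩ := H.exists_cell hp hp1 hp2 (le_max_right r _)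
      exact ⟨κ, .inr hκ, hκ'⟩
  · obtain ⟨n₁, hn₁⟩ := hK₁m
    obtain ⟨n₂, hn₂⟩ := H.finite_multiplicity
    refine ⟨n₁ + Fs.ncard + n₂, fun p => ?_⟩
    have hsub : {κ ∈ K₁ ∪ Fs ∪ H.cells | p ∈ κ.source} ⊆
        {κ ∈ K₁ | p ∈ κ.source} ∪ Fs ∪ {κ ∈ H.cells | p ∈ κ.source} := by
      rintro κ ⟨(hκ | hκ) | hκ, hp⟩
      exacts [.inl (.inl ⟨hκ, hp⟩), .inl (.inr hκ), .inr ⟨hκ, hp⟩]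
    refine (encard_le_encard hsub).trans ((encard_union_le _ _).trans ?_)
    push_cast
    refine add_le_add ((encard_union_le _ _).trans (add_le_add (hn₁ p) ?_)) (hn₂ p)
    rw [hFfin.cast_ncard_eq]
  · have hKE : TransitionBound k K₁ H.cells := transitionBound_of_disjoint hK₁c
    have hEK : TransitionBound k H.cells K₁ :=
      transitionBound_of_disjoint fun κ hκ κ' hκ' => (hK₁c κ' hκ' κ hκ).symm
    have hEE : TransitionBound k H.cells H.cells := H.transition_bounds k
    exact (((hKK k).union_right (hKF k)).union_right hKE).union_left
      (((hFK k).union_right (hFF k)).union_right (hFE k)) |>.union_left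
      ((hEK.union_right (hEF k)).union_right hEE)
  · obtain ⟨c₁, hc₁, h₁⟩ := hK₁h.equiv_euclidean
    obtain ⟨c₂, hc₂⟩ := hFfin.exists_uniform_bound (P := fun κ C => 1 ≤ C ∧ ∀ x ∈ κ.target,
      ∀ ξ : EuclideanSpace ℝ (Fin m), ‖ξ‖ ^ 2 / C ≤ chartMetric h κ x ξ ξ ∧
        chartMetric h κ x ξ ξ ≤ C * ‖ξ‖ ^ 2) (fun κ hκ => by
          obtain ⟨_, _, _, _, _, h1⟩ := hFcell κ hκ
          exact h1.elliptic h)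
      fun κ C C' hCC hh => ⟨hh.1.trans hCC, fun x hx ξ => by
        have : 0 < C := by linarith [hh.1]
        obtain ⟨h1, h2⟩ := hh.2 x hx ξ
        exact ⟨le_trans (by gcongr) h1, h2.trans (by gcongr)⟩⟩
    obtain ⟨c₃, hc₃, h₃⟩ := H.metric_elliptic
    set C := max c₁ (max c₂ c₃) with hC
    have hmono : ∀ {c κ}, 1 ≤ c → c ≤ C → ∀ {x ξ : EuclideanSpace ℝ (Fin m)},
        (‖ξ‖ ^ 2 / c ≤ chartMetric h κ x ξ ξ ∧ chartMetric h κ x ξ ξ ≤ c * ‖ξ‖ ^ 2) →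
        ‖ξ‖ ^ 2 / C ≤ chartMetric h κ x ξ ξ ∧ chartMetric h κ x ξ ξ ≤ C * ‖ξ‖ ^ 2 := by
      rintro c κ hc hcC x ξ ⟨h1, h2⟩
      have : 0 < c := by linarith
      exact ⟨le_trans (by gcongr) h1, h2.trans (by gcongr)⟩
    refine ⟨C, hc₁.trans (le_max_left _ _), ?_⟩
    rintro κ ((hκ | hκ) | hκ) x hx ξ
    · exact hmono hc₁ (le_max_left _ _) (h₁ κ hκ x hx ξ)
    · exact hmono (hc₂ κ hκ).1 ((le_max_left _ _).trans (le_max_right _ _)) ((hc₂ κ hκ).2 x hx ξ)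
    · exact hmono hc₃ ((le_max_right _ _).trans (le_max_right _ _)) (h₃ κ hκ x hx ξ)
  · intro k
    obtain ⟨C₁, h₁⟩ := hK₁h.coeff_bounds k
    obtain ⟨C₂, h₂⟩ := hFfin.exists_uniform_bound (P := fun κ C => ∀ a b : Fin m, ∀ x ∈ κ.target,
      ‖iteratedFDerivWithin ℝ k (fun y => chartMetric h κ y (EuclideanSpace.single a 1)
        (EuclideanSpace.single b 1)) κ.target x‖ ≤ C) (fun κ hκ => by
          obtain ⟨_, _, _, _, _, h1⟩ := hFcell κ hκ
          exact h1.coeff_bound h k)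
      fun κ C C' hCC hh a b x hx => (hh a b x hx).trans hCC
    obtain ⟨C₃, h₃⟩ := H.coeff_bounds k
    refine ⟨max C₁ (max C₂ C₃), ?_⟩
    rintro κ ((hκ | hκ) | hκ) a b x hx
    · exact (h₁ κ hκ a b x hx).trans (le_max_left _ _)
    · exact (h₂ κ hκ a b x hx).trans ((le_max_left _ _).trans (le_max_right _ _))
    · exact (h₃ κ hκ a b x hx).trans ((le_max_right _ _).trans (le_max_right _ _))

end Gluing

/-! ### Paths of bounded speed and relative compactness of the tube -/

section Compactness

variable {m : ℕ} [NeZero m] {N : Type*} [TopologicalSpace N]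
  [ChartedSpace (EuclideanHalfSpace m) N]

/-- A path in `N`, parametrized by `[0, 1]`, whose velocity is bounded by `D` in all charts
belonging to `K`. -/
structure HasSpeedLE (K : Set (PartialEquiv N (EuclideanSpace ℝ (Fin m)))) (γ : ℝ → N) (D : ℝ) :
    Prop where
  continuousOn : ContinuousOn γ (Icc 0 1)
  exists_deriv : ∀ κ ∈ K, ∀ t ∈ Icc (0 : ℝ) 1, γ t ∈ κ.source →
    ∃ d, HasDerivWithinAt (κ ∘ γ) d (Icc 0 1) t ∧ ‖d‖ ≤ D

variable {K : Set (PartialEquiv N (EuclideanSpace ℝ (Fin m)))} {γ : ℝ → N} {D D' r : ℝ}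

theorem HasSpeedLE.mono (h : HasSpeedLE K γ D) (hD : D ≤ D') : HasSpeedLE K γ D' :=
  ⟨h.continuousOn, fun κ hκ t ht hs => (h.exists_deriv κ hκ t ht hs).imp fun _ hd =>
    ⟨hd.1, hd.2.trans hD⟩⟩

theorem HasSpeedLE.comp_affine (h : HasSpeedLE K γ D) {a b : ℝ} (ha : 0 ≤ a) (hb : 0 ≤ b)
    (hab : a + b ≤ 1) : HasSpeedLE K (fun t => γ (a + b * t)) (b * D) := by
  have hmaps : MapsTo (fun t : ℝ => a + b * t) (Icc 0 1) (Icc 0 1) := fun t ht =>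
    ⟨by have := ht.1; positivity, by nlinarith [ht.1, ht.2]⟩
  refine ⟨h.continuousOn.comp (by fun_prop) hmaps, fun κ hκ t ht hs => ?_⟩
  obtain ⟨d, hd, hd'⟩ := h.exists_deriv κ hκ _ (hmaps ht) hs
  refine ⟨b • d, ?_, ?_⟩
  · have h1 : HasDerivWithinAt (fun t : ℝ => a + b * t) b (Icc 0 1) t := by
      simpa using (((hasDerivAt_id t).const_mul b).const_add a).hasDerivWithinAt
    exact hd.scomp t h1 hmaps
  · rw [norm_smul, Real.norm_of_nonneg hb]
    gcongr

theorem IsNormalizedChart.mem_smul_target_iff {κ : PartialEquiv N (EuclideanSpace ℝ (Fin m))}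
    (h : IsNormalizedChart κ) (hr : r ∈ Ioo (0 : ℝ) 1) {x : EuclideanSpace ℝ (Fin m)} :
    x ∈ r • κ.target ↔ x ∈ κ.target ∧ ∀ i, |x i| < r := by
  have h1 : ∀ i, |r⁻¹ * x i| < 1 ↔ |x i| < r := fun i => by
    rw [abs_mul, abs_of_pos (inv_pos.2 hr.1), inv_mul_lt_iff₀ hr.1, mul_one]
  rw [mem_smul_set_iff_inv_smul_mem₀ hr.1.ne']
  have h2 : r⁻¹ • x ∈ openCube m ↔ ∀ i, |x i| < r :=
    forall_congr' fun i => by rw [← h1 i, abs_lt]; rfl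
  have h3 : (∀ i, |x i| < r) → x ∈ openCube m := fun hx i => abs_lt.1 ((hx i).trans hr.2)
  have h4 : r⁻¹ • x ∈ halfSpaceSet m ↔ x ∈ halfSpaceSet m := by
    change 0 ≤ r⁻¹ * x 0 ↔ 0 ≤ x 0
    exact mul_nonneg_iff_of_pos_left (inv_pos.2 hr.1)
  rcases h.target_cases with ht | ht <;> rw [ht]
  · rw [h2]; exact ⟨fun hx => ⟨h3 hx, hx⟩, fun hx => hx.2⟩
  · rw [mem_inter_iff, h2, h4]
    exact ⟨fun hx => ⟨⟨h3 hx.1, hx.2⟩, hx.1⟩, fun hx => ⟨hx.2, hx.1.2⟩⟩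

theorem IsNormalizedChart.isCompact_closedCube {κ : PartialEquiv N (EuclideanSpace ℝ (Fin m))}
    (h : IsNormalizedChart κ) (hr : r < 1) :
    IsCompact (κ.target ∩ {x | ∀ i, |x i| ≤ r}) := by
  have hc : IsClosed {x : EuclideanSpace ℝ (Fin m) | ∀ i, |x i| ≤ r} := by
    simp only [ofPred_forall]
    exact isClosed_iInter fun i => isClosed_le (by fun_prop) continuous_const
  have hb : Bornology.IsBounded {x : EuclideanSpace ℝ (Fin m) | ∀ i, |x i| ≤ r} :=
    isBounded_iff_forall_norm_le.2 ⟨√m * r, fun x hx => norm_le_of_forall_abs_le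
      ((abs_nonneg _).trans (hx 0)) hx⟩
  have hs : {x : EuclideanSpace ℝ (Fin m) | ∀ i, |x i| ≤ r} ⊆ openCube m := fun x hx i =>
    abs_lt.1 ((hx i).trans_lt hr)
  rcases h.target_cases with ht | ht <;> rw [ht]
  · rw [inter_eq_right.2 hs]
    exact Metric.isCompact_of_isClosed_isBounded hc hb
  · rw [inter_right_comm, inter_eq_right.2 hs]
    exact (Metric.isCompact_of_isClosed_isBounded hc hb).inter_right isClosed_halfSpaceSet

theorem IsNormalizedChart.isCompact_symm_image {κ : PartialEquiv N (EuclideanSpace ℝ (Fin m))}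
    (h : IsNormalizedChart κ) (hr : r < 1) :
    IsCompact (κ.symm '' (κ.target ∩ {x | ∀ i, |x i| ≤ r})) :=
  (h.isCompact_closedCube hr).image_of_continuousOn
    (h.isSmoothChart.continuousOn_symm.mono inter_subset_left)

/-- A sufficiently slow path which starts in the core of a chart stays in a fixed compact part of
the chart. -/
theorem HasSpeedLE.mem_symm_image [T2Space N] (h : HasSpeedLE K γ ((1 - r) / 2))
    {κ : PartialEquiv N (EuclideanSpace ℝ (Fin m))} (hκK : κ ∈ K) (hκ : IsNormalizedChart κ)
    (hr : r ∈ Ioo (0 : ℝ) 1) (h0 : γ 0 ∈ κ.source) (h0' : κ (γ 0) ∈ r • κ.target) :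
    γ 1 ∈ κ.symm '' (κ.target ∩ {x | ∀ i, |x i| ≤ (1 + r) / 2}) := by
  set D := (1 - r) / 2 with hD
  have hD0 : 0 < D := by have := hr.2; rw [hD]; linarith
  set Z := κ.symm '' (κ.target ∩ {x | ∀ i, |x i| ≤ (1 + r) / 2}) with hZdef
  have hr2 : (1 + r) / 2 < 1 := by have := hr.2; linarith
  have hZ : IsClosed Z := (hκ.isCompact_symm_image hr2).isClosed
  have hZs : Z ⊆ κ.source := by rintro _ ⟨x, hx, rfl⟩; exact κ.map_target hx.1
  have hmemZ : ∀ t ∈ Icc (0 : ℝ) 1, γ t ∈ κ.source → ‖κ (γ t) - κ (γ 0)‖ ≤ D * t → γ t ∈ Z := by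
    intro t ht hs hn
    refine ⟨κ (γ t), ⟨κ.map_source hs, fun i => ?_⟩, κ.left_inv hs⟩
    have h1 := ((hκ.mem_smul_target_iff hr).1 h0').2 i
    have h2 : |κ (γ t) i - κ (γ 0) i| ≤ D := by
      have := (PiLp.norm_apply_le (κ (γ t) - κ (γ 0)) i).trans hn
      rw [PiLp.sub_apply, Real.norm_eq_abs] at this
      nlinarith [ht.2]
    have h3 := abs_sub_abs_le_abs_sub (κ (γ t) i) (κ (γ 0) i)
    linarith
  -- The times up to which the path has stayed in the chart form a closed set, because the path then
  -- lies in the compact set `Z`, and an open one by the mean value inequality.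
  set s := {t | γ t ∈ κ.source ∧ ‖κ (γ t) - κ (γ 0)‖ ≤ D * t} with hs
  have hclosed : IsClosed (s ∩ Icc 0 1) := by
    have h1 : IsClosed (Icc (0 : ℝ) 1 ∩ γ ⁻¹' Z) :=
      h.continuousOn.preimage_isClosed_of_isClosed isClosed_Icc hZ
    have h2 : ContinuousOn (fun t => ‖κ (γ t) - κ (γ 0)‖ - D * t) (Icc (0 : ℝ) 1 ∩ γ ⁻¹' Z) := by
      have : ContinuousOn (fun t => κ (γ t)) (Icc (0 : ℝ) 1 ∩ γ ⁻¹' Z) :=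
        hκ.smooth.continuousOn.comp (h.continuousOn.mono inter_subset_left) fun t ht => hZs ht.2
      exact (this.sub continuousOn_const).norm.sub (by fun_prop)
    have h3 := h2.preimage_isClosed_of_isClosed h1 (isClosed_Iic (a := (0 : ℝ)))
    convert h3 using 1
    ext t
    simp only [hs, mem_inter_iff, mem_ofPred_eq, mem_preimage, mem_Iic, sub_nonpos]
    exact ⟨fun ht => ⟨⟨ht.2, hmemZ t ht.2 ht.1.1 ht.1.2⟩, ht.1.2⟩,
      fun ht => ⟨⟨hZs ht.1.2, ht.2⟩, ht.1.1⟩⟩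
  have hsub := hclosed.Icc_subset_of_forall_exists_gt (by simp [hs, h0]) fun x hx y hy => by
    have hx1 : x ∈ Icc (0 : ℝ) 1 := Ico_subset_Icc_self hx.2
    have hev : ∀ᶠ t in 𝓝[Icc 0 1] x, γ t ∈ κ.source :=
      (h.continuousOn x hx1).preimage_mem_nhdsWithin (hκ.open_source.mem_nhds hx.1.1)
    obtain ⟨ε, hε, hε'⟩ := Metric.mem_nhdsWithin_iff.1 hev
    set z := min (min y 1) (x + ε / 2) with hz
    have hxz : x < z := lt_min (lt_min hy hx.2.2) (by linarith)
    have hz1 : z ≤ 1 := (min_le_left _ _).trans (min_le_right _ _)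
    have hIcc : Icc x z ⊆ Icc 0 1 := Icc_subset_Icc hx1.1 hz1
    have hsrc : ∀ t ∈ Icc x z, γ t ∈ κ.source := fun t ht => hε' ⟨by
      rw [Metric.mem_ball, Real.dist_eq, abs_of_nonneg (sub_nonneg.2 ht.1)]
      have : z ≤ x + ε / 2 := min_le_right _ _
      linarith [ht.2], hIcc ht⟩
    choose! d hd hd' using fun t ht => h.exists_deriv κ hκK t (hIcc ht) (hsrc t ht)
    have hmv := (convex_Icc x z).norm_image_sub_le_of_norm_hasDerivWithin_le
      (fun t ht => (hd t ht).mono hIcc) hd' (left_mem_Icc.2 hxz.le) (right_mem_Icc.2 hxz.le)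
    refine ⟨z, ⟨hsrc z (right_mem_Icc.2 hxz.le), ?_⟩, hxz,
      (min_le_left _ _).trans (min_le_left _ _)⟩
    rw [Real.norm_of_nonneg (sub_nonneg.2 hxz.le)] at hmv
    calc ‖κ (γ z) - κ (γ 0)‖ ≤ ‖κ (γ z) - κ (γ x)‖ + ‖κ (γ x) - κ (γ 0)‖ := by
          rw [show κ (γ z) - κ (γ 0) = (κ (γ z) - κ (γ x)) + (κ (γ x) - κ (γ 0)) by abel]
          exact norm_add_le _ _
      _ ≤ D * (z - x) + D * x := add_le_add hmv hx.1.2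
      _ = D * z := by ring
  have h1 := hsub (right_mem_Icc.2 zero_le_one)
  exact hmemZ 1 (right_mem_Icc.2 zero_le_one) h1.1 h1.2

/-- A path which moves by at most `(1 - r) / 2` in each chart cannot leave the charts in whose cores
it starts, and finitely many cores cover a compact set. -/
theorem IsUniformlyRegularAtlas.exists_compact_of_slow_path [T2Space N]
    (hK : ∀ κ ∈ K, IsNormalizedChart κ) (hr : r ∈ Ioo (0 : ℝ) 1)
    (hcov : ∀ p : N, ∃ κ ∈ K, p ∈ κ.source ∧ κ p ∈ r • κ.target) {C : Set N} (hC : IsCompact C) :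
    ∃ C', IsCompact C' ∧ ∀ γ, HasSpeedLE K γ ((1 - r) / 2) → γ 0 ∈ C → γ 1 ∈ C' := by
  choose κ hκ hκs hκr using hcov
  have ho : ∀ p : N, IsOpen ((κ p).source ∩ κ p ⁻¹' {x | ∀ i, |x i| < r}) := fun p => by
    refine (hK _ (hκ p)).isSmoothChart.isOpen_inter_preimage ?_
    simp only [ofPred_forall]
    exact isOpen_iInter_of_finite fun i => isOpen_lt (by fun_prop) continuous_const
  obtain ⟨t, ht⟩ := hC.elim_finite_subcover _ ho fun p _ => mem_iUnion.2 ⟨p, hκs p,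
    (((hK _ (hκ p)).mem_smul_target_iff hr).1 (hκr p)).2⟩
  refine ⟨⋃ p ∈ t, (κ p).symm '' ((κ p).target ∩ {x | ∀ i, |x i| ≤ (1 + r) / 2}),
    t.finite_toSet.isCompact_biUnion fun p _ => (hK _ (hκ p)).isCompact_symm_image
      (by have := hr.2; linarith), fun γ hγ h0 => ?_⟩
  obtain ⟨p, hp, hp'⟩ := mem_iUnion₂.1 (ht h0)
  exact mem_iUnion₂.2 ⟨p, hp, hγ.mem_symm_image (hκ p) (hK _ (hκ p)) hr hp'.1
    (((hK _ (hκ p)).mem_smul_target_iff hr).2 ⟨(κ p).map_source hp'.1, hp'.2⟩)⟩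

/-- In a uniformly regular manifold, the paths of bounded speed and unit duration which start in a
given compact set end in a common compact set. -/
theorem IsUniformlyRegularAtlas.exists_compact_of_path [T2Space N]
    (hK : IsUniformlyRegularAtlas K) {C : Set N} (hC : IsCompact C) (D : ℝ) :
    ∃ C', IsCompact C' ∧ ∀ γ, HasSpeedLE K γ D → γ 0 ∈ C → γ 1 ∈ C' := by
  obtain ⟨r, hr, hcov⟩ := hK.shrinkable
  set δ := (1 - r) / 2 with hδ
  have hδ0 : 0 < δ := by have := hr.2; rw [hδ]; linarith
  have key : ∀ n : ℕ, ∃ C', IsCompact C' ∧ ∀ γ, HasSpeedLE K γ ((n + 1) * δ) → γ 0 ∈ C →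
      γ 1 ∈ C' := by
    intro n
    induction n with
    | zero => simpa using exists_compact_of_slow_path hK.normalized hr hcov hC
    | succ n ih =>
      obtain ⟨C₁, hC₁, h₁⟩ := ih
      obtain ⟨C₂, hC₂, h₂⟩ := exists_compact_of_slow_path hK.normalized hr hcov hC₁
      refine ⟨C₂, hC₂, fun γ hγ h0 => ?_⟩
      push_cast at hγ
      have hn : (0 : ℝ) < n + 1 + 1 := by positivity
      have e : ((n : ℝ) + 1) / (n + 1 + 1) + 1 / (n + 1 + 1) = 1 := by field_simp
      have a₁ := hγ.comp_affine (a := 0) (b := ((n : ℝ) + 1) / (n + 1 + 1)) le_rfl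
        (by positivity) (by rw [zero_add, div_le_one hn]; linarith)
      have a₂ := hγ.comp_affine (a := ((n : ℝ) + 1) / (n + 1 + 1)) (b := 1 / (n + 1 + 1))
        (by positivity) (by positivity) e.le
      have b₁ := h₁ _ (a₁.mono (by field_simp; rfl)) (by simpa using h0)
      have b₂ := h₂ _ (a₂.mono (by field_simp; rw [hδ]; linarith)) (by simpa using b₁)
      rwa [mul_one, e] at b₂
  obtain ⟨n, hn⟩ := exists_nat_ge (D / δ)
  obtain ⟨C', hC', h⟩ := key n
  refine ⟨C', hC', fun γ hγ => h γ (hγ.mono ?_)⟩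
  rw [div_le_iff₀ hδ0] at hn
  nlinarith

theorem IsNormalizedChart.convex_target {κ : PartialEquiv N (EuclideanSpace ℝ (Fin m))}
    (h : IsNormalizedChart κ) : Convex ℝ κ.target := by
  have hc : Convex ℝ (openCube m) := by
    have : openCube m = ⋂ i, (EuclideanSpace.proj (𝕜 := ℝ) i : EuclideanSpace ℝ (Fin m) →L[ℝ]
        ℝ) ⁻¹' Ioo (-1) 1 := by
      ext x; simp [openCube]
    rw [this]
    exact convex_iInter fun i => (convex_Ioo _ _).linear_preimage
      (EuclideanSpace.proj (𝕜 := ℝ) i : EuclideanSpace ℝ (Fin m) →L[ℝ] ℝ).toLinearMap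
  rcases h.target_cases with ht | ht <;> rw [ht]
  · exact hc
  · exact hc.inter convex_halfSpaceSet

/-- The charts of a uniformly regular atlas which meet a compact set are contained in a compact
set. -/
theorem IsUniformlyRegularAtlas.exists_compact_source_subset [T2Space N]
    (hK : IsUniformlyRegularAtlas K) {C : Set N} (hC : IsCompact C) :
    ∃ C', IsCompact C' ∧ ∀ κ ∈ K, (κ.source ∩ C).Nonempty → κ.source ⊆ C' := by
  obtain ⟨c, hc⟩ := hK.transition_bounds 1
  obtain ⟨C', hC', h⟩ := hK.exists_compact_of_path hC (c * (√m + √m))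
  refine ⟨C', hC', fun κ hκ ⟨p, hp, hpC⟩ q hq => ?_⟩
  have hκn := hK.normalized κ hκ
  have hx := κ.map_source hp
  have hy := κ.map_source hq
  set x := κ p
  set y := κ q
  -- Two points of a chart are joined by a segment, of bounded speed in all other charts.
  have hmaps : MapsTo (fun t : ℝ => x + t • (y - x)) (Icc 0 1) κ.target := fun t ht =>
    hκn.convex_target.add_smul_sub_mem hx hy ht
  have hpath : HasSpeedLE K (fun t : ℝ => κ.symm (x + t • (y - x))) (c * (√m + √m)) := by
    refine ⟨hκn.isSmoothChart.continuousOn_symm.comp (by fun_prop) hmaps,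
      fun κ' hκ' t ht hs => ?_⟩
    have hκ'n := hK.normalized κ' hκ'
    have hov : x + t • (y - x) ∈ overlap κ κ' := ⟨hmaps ht, hs⟩
    have hd := ((hκn.isSmoothChart.contDiffOn_transition hκ'n.isSmoothChart)
      _ hov).differentiableWithinAt (by simp)
    have hb := hc κ hκ κ' hκ' _ hov
    have hu := hκn.isSmoothChart.uniqueDiffOn_overlap hκ'n.isSmoothChart
    obtain ⟨U, hU, hU'⟩ := hκn.isSmoothChart.exists_open_overlap hκ'n.isSmoothChart
    have hd' : HasFDerivWithinAt (κ' ∘ κ.symm) (fderivWithin ℝ (κ' ∘ κ.symm) (overlap κ κ')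
        (x + t • (y - x))) κ.target (x + t • (y - x)) := by
      have := hd.hasFDerivWithinAt
      rw [hU'] at this hov ⊢
      exact (hasFDerivWithinAt_inter (hU.mem_nhds hov.2)).1 this
    have hl : HasDerivWithinAt (fun t : ℝ => x + t • (y - x)) (y - x) (Icc 0 1) t := by
      simpa using (((hasDerivAt_id t).smul_const (y - x)).const_add x).hasDerivWithinAt
    have hcomp := hd'.comp_hasDerivWithinAt (f := fun t : ℝ => x + t • (y - x)) t hl hmaps
    refine ⟨_, hcomp, ?_⟩
    rw [show κ.target ∩ κ.symm ⁻¹' κ'.source = overlap κ κ' from rfl,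
      norm_iteratedFDerivWithin_one _ (hu _ hov)] at hb
    refine (ContinuousLinearMap.le_opNorm _ _).trans (mul_le_mul hb ?_ (norm_nonneg _)
      ((norm_nonneg _).trans hb))
    exact (norm_sub_le _ _).trans (add_le_add
      (norm_le_of_mem_openCube (hκn.target_subset_openCube hy))
      (norm_le_of_mem_openCube (hκn.target_subset_openCube hx)))
  have := h _ hpath (by simpa [x, κ.left_inv hp] using hpC)
  simpa [y, κ.left_inv hq] using this

variable [IsManifold (𝓡∂ m) ∞ N] {k ℓ : ℕ} [NeZero ℓ]
  {Γ : Type*} [TopologicalSpace Γ] [ChartedSpace (EuclideanSpace ℝ (Fin k)) Γ]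

theorem IsTubularDiffeo.hasMFDerivWithinAt_symm {g : SmoothMetric m N} {ι : Γ → N}
    {τ : PartialEquiv N (EuclideanSpace ℝ (Fin ℓ) × Γ)} (hτ : IsTubularDiffeo (k := k) g ι τ)
    {z : EuclideanSpace ℝ (Fin ℓ) × Γ} (hz : z ∈ τ.target) :
    HasMFDerivWithinAt (𝓘(ℝ, EuclideanSpace ℝ (Fin ℓ)).prod (𝓡 k)) (𝓡∂ m) τ.symm τ.target z
      (mfderivWithin (𝓘(ℝ, EuclideanSpace ℝ (Fin ℓ)).prod (𝓡 k)) (𝓡∂ m) τ.symm τ.target z) :=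
  ((hτ.smooth_symm z hz).mdifferentiableWithinAt (by simp)).hasMFDerivWithinAt

theorem IsTubularDiffeo.hasMFDerivAt {g : SmoothMetric m N} {ι : Γ → N}
    {τ : PartialEquiv N (EuclideanSpace ℝ (Fin ℓ) × Γ)} (hτ : IsTubularDiffeo (k := k) g ι τ)
    {p : N} (hp : p ∈ τ.source) :
    HasMFDerivAt (𝓡∂ m) (𝓘(ℝ, EuclideanSpace ℝ (Fin ℓ)).prod (𝓡 k)) τ p
      (mfderiv (𝓡∂ m) (𝓘(ℝ, EuclideanSpace ℝ (Fin ℓ)).prod (𝓡 k)) τ p) :=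
  (((hτ.smooth p hp).contMDiffAt (hτ.open_source.mem_nhds hp)).mdifferentiableAt
    (by simp)).hasMFDerivAt

/-- The Euclidean length of a vector in a chart is controlled by its length in the metric. -/
theorem IsSmoothChart.norm_mfderiv_sq_le {g : SmoothMetric m N} {c : ℝ} (hc : 0 < c)
    {κ : PartialEquiv N (EuclideanSpace ℝ (Fin m))} (h : IsSmoothChart κ)
    (hg : ∀ x ∈ κ.target, ∀ ξ : EuclideanSpace ℝ (Fin m), ‖ξ‖ ^ 2 / c ≤ chartMetric g κ x ξ ξ)
    {p : N} (hp : p ∈ κ.source) (v : TangentSpace (𝓡∂ m) p) {w : EuclideanSpace ℝ (Fin m)}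
    (hw : w = mfderiv (𝓡∂ m) 𝓘(ℝ, EuclideanSpace ℝ (Fin m)) κ p v) :
    ‖w‖ ^ 2 ≤ c * g.inner p v v := by
  subst hw
  have h1 := hg _ (κ.map_source hp) (mfderiv (𝓡∂ m) 𝓘(ℝ, EuclideanSpace ℝ (Fin m)) κ p v)
  have h2 := h.mfderiv_symm_mfderiv hp v
  have h3 : chartMetric g κ (κ p) (mfderiv (𝓡∂ m) 𝓘(ℝ, EuclideanSpace ℝ (Fin m)) κ p v)
      (mfderiv (𝓡∂ m) 𝓘(ℝ, EuclideanSpace ℝ (Fin m)) κ p v) = g.inner p v v :=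
    metric_inner_congr g (κ.left_inv hp) h2 h2
  rw [h3, div_le_iff₀ hc] at h1
  linarith

/-- Vectors tangent to the fibres `𝔹 × {q}` of the tube have lengths controlled by their Euclidean
lengths in the ball. -/
theorem IsTubularDiffeo.exists_inner_le_of_normal {g : SmoothMetric m N} {ι : Γ → N}
    {τ : PartialEquiv N (EuclideanSpace ℝ (Fin ℓ) × Γ)} (hτ : IsTubularDiffeo (k := k) g ι τ) :
    ∃ c : ℝ, 1 ≤ c ∧ ∀ p ∈ τ.source, ∀ (v : TangentSpace (𝓡∂ m) p) (x : EuclideanSpace ℝ (Fin ℓ)),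
      mfderiv (𝓡∂ m) (𝓘(ℝ, EuclideanSpace ℝ (Fin ℓ)).prod (𝓡 k)) τ p v
        = (x, (0 : EuclideanSpace ℝ (Fin k))) → g.inner p v v ≤ c * ‖x‖ ^ 2 := by
  obtain ⟨c, hc1, hc⟩ := hτ.equiv_product
  refine ⟨c, hc1, fun p hp v x hv => ?_⟩
  have h1 := (hc p hp v).2
  have h0 : inducedForm g ι (τ p).2 (0 : TangentSpace (𝓡 k) (τ p).2)
      (0 : TangentSpace (𝓡 k) (τ p).2) = 0 := by
    simp [inducedForm]
  rw [hv] at h1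
  refine h1.trans_eq ?_
  change c * (‖x‖ ^ 2 + inducedForm g ι (τ p).2 (0 : TangentSpace (𝓡 k) (τ p).2)
      (0 : TangentSpace (𝓡 k) (τ p).2)) = _
  rw [h0, add_zero]

/-- The tube is relatively compact. Indeed, each of its points is the end of a path which starts in
the compact set `Γ`, the image of a radius of the ball, and whose speed is controlled because the
metric of the tube is equivalent to the product metric. -/
theorem IsTubularDiffeo.exists_compact_source_subset [T2Space N] [CompactSpace Γ]
    {g : SmoothMetric m N} {ι : Γ → N} (hι : Continuous ι)
    {τ : PartialEquiv N (EuclideanSpace ℝ (Fin ℓ) × Γ)} (hτ : IsTubularDiffeo (k := k) g ι τ)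
    (hrad : ∀ x q, (x, q) ∈ τ.target → ‖x‖ ≤ 1 ∧ ∀ t ∈ Icc (0 : ℝ) 1, (t • x, q) ∈ τ.target)
    (hK : IsUniformlyRegularAtlas K) (hg : IsUniformlyRegularMetric g K) :
    ∃ C, IsCompact C ∧ τ.source ⊆ C := by
  obtain ⟨c, hc1, hc⟩ := hg.equiv_euclidean
  obtain ⟨c', hc1', hc'⟩ := hτ.exists_inner_le_of_normal
  obtain ⟨C, hC, h⟩ := hK.exists_compact_of_path (isCompact_range hι) (√(c * c'))
  refine ⟨C, hC, fun p hp => ?_⟩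
  rcases hxq : τ p with ⟨x, q⟩
  have hxt : (x, q) ∈ τ.target := hxq ▸ τ.map_source hp
  obtain ⟨hx1, hmaps⟩ := hrad x q hxt
  set β : ℝ → EuclideanSpace ℝ (Fin ℓ) × Γ := fun t => (t • x, q) with hβ
  have hβd : ∀ t : ℝ, HasMFDerivWithinAt 𝓘(ℝ, ℝ) (𝓘(ℝ, EuclideanSpace ℝ (Fin ℓ)).prod (𝓡 k)) β
      (Icc 0 1) t ((ContinuousLinearMap.toSpanSingleton ℝ x).prod
        (0 : ℝ →L[ℝ] EuclideanSpace ℝ (Fin k))) := fun t => by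
    refine HasMFDerivWithinAt.prodMk ?_ (hasMFDerivWithinAt_const _ _ _)
    exact ((ContinuousLinearMap.toSpanSingleton ℝ x).hasFDerivWithinAt).hasMFDerivWithinAt
  have hpath : HasSpeedLE K (fun t => τ.symm (β t)) (√(c * c')) := by
    have hβc : ContinuousOn β (Icc 0 1) := by fun_prop
    refine ⟨hτ.smooth_symm.continuousOn.comp hβc hmaps, fun κ hκ t ht hs => ?_⟩
    have hκs := (hK.normalized κ hκ).isSmoothChart
    have h1 := (hτ.hasMFDerivWithinAt_symm (hmaps t ht)).comp t (hβd t) hmaps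
    have h2 := (hκs.mdifferentiableAt hs).hasMFDerivAt.comp_hasMFDerivWithinAt t h1
    have h3 := (hτ.hasMFDerivAt (τ.map_target (hmaps t ht))).comp_hasMFDerivWithinAt t h1
    have h4 := (hβd t).congr_of_eventuallyEq (f₁ := τ ∘ τ.symm ∘ β)
      (Filter.eventuallyEq_of_mem self_mem_nhdsWithin fun y hy => τ.right_inv (hmaps y hy))
      (τ.right_inv (hmaps t ht))
    have h5 := ((uniqueDiffOn_Icc (zero_lt_one' ℝ)).uniqueMDiffOn t ht).eq h3 h4
    have h6 : mfderiv (𝓡∂ m) (𝓘(ℝ, EuclideanSpace ℝ (Fin ℓ)).prod (𝓡 k)) τ (τ.symm (β t))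
        ((mfderivWithin (𝓘(ℝ, EuclideanSpace ℝ (Fin ℓ)).prod (𝓡 k)) (𝓡∂ m) τ.symm τ.target (β t))
          (x, (0 : EuclideanSpace ℝ (Fin k)))) = (x, (0 : EuclideanSpace ℝ (Fin k))) := by
      have := congrArg (fun L => L (1 : ℝ)) h5
      have e : ((ContinuousLinearMap.toSpanSingleton ℝ x).prod
        (0 : ℝ →L[ℝ] EuclideanSpace ℝ (Fin k))) 1 = (x, 0) := Prod.ext (one_smul ℝ x) rfl
      rw [← e]
      exact this
    have h7 := hκs.norm_mfderiv_sq_le (by linarith) (fun x hx ξ => (hc κ hκ x hx ξ).1) hs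
      ((mfderivWithin (𝓘(ℝ, EuclideanSpace ℝ (Fin ℓ)).prod (𝓡 k)) (𝓡∂ m) τ.symm τ.target (β t))
          (x, (0 : EuclideanSpace ℝ (Fin k)))) rfl
    have e : ((ContinuousLinearMap.toSpanSingleton ℝ x).prod
        (0 : ℝ →L[ℝ] EuclideanSpace ℝ (Fin k))) 1 = (x, 0) := Prod.ext (one_smul ℝ x) rfl
    obtain ⟨d, hd, hd1⟩ : ∃ d : ℝ →L[ℝ] EuclideanSpace ℝ (Fin m),
        HasFDerivWithinAt (κ ∘ fun t => τ.symm (β t)) d (Icc 0 1) t ∧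
        d 1 = mfderiv (𝓡∂ m) 𝓘(ℝ, EuclideanSpace ℝ (Fin m)) κ (τ.symm (β t))
          ((mfderivWithin (𝓘(ℝ, EuclideanSpace ℝ (Fin ℓ)).prod (𝓡 k)) (𝓡∂ m) τ.symm τ.target (β t))
            (x, (0 : EuclideanSpace ℝ (Fin k)))) :=
      ⟨_, h2.hasFDerivWithinAt, by rw [← e]; rfl⟩
    rw [← hd1] at h7
    exact ⟨d 1, hd.hasDerivWithinAt, Real.le_sqrt_of_sq_le (h7.trans
      (mul_le_mul_of_nonneg_left ((hc' _ (τ.map_target (hmaps t ht)) _ _ h6).trans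
        (mul_le_of_le_one_right (by linarith) (pow_le_one₀ (norm_nonneg _) hx1))) (by linarith)))⟩
  have := h _ hpath ⟨q, ?_⟩
  · simpa [hβ, ← hxq, τ.left_inv hp] using this
  · have h0 : β 0 = τ (ι q) := by rw [hτ.map_submanifold, hβ]; simp
    simp only [h0, τ.left_inv (hτ.mem_source q)]

end Compactness

/-! ### The radial variable -/

section Profile

/-- The coefficient of `dt²` in the model metric. -/
def radialWeight (α t : ℝ) : ℝ := if α ≤ 1 then t ^ (-2 : ℝ) else t ^ (-2 * (α + 1))

/-- The coefficient of `g_S + g_Γ` in the model metric. -/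
def tangentialWeight (α t : ℝ) : ℝ := if α ≤ 1 then t ^ (-2 * α) else 1

/-- A change of the radial variable `s = S t`, `t = T s`, with `s → ∞` as `t → 0`, which turns the
model metric into `ds² + e^(2βs) (g_S + g_Γ)`. -/
structure IsEndProfile (α β : ℝ) (S T T' : ℝ → ℝ) : Prop where
  rate_nonneg : 0 ≤ β
  contDiffOn_height : ContDiffOn ℝ ∞ S (Ioi 0)
  contDiffOn_radius : ContDiffOn ℝ ∞ T (Ioi 0)
  height_le : ∀ t t', 0 < t → t ≤ t' → S t' ≤ S t
  radius_pos : ∀ s, 0 < s → 0 < T s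
  height_radius : ∀ s, 0 < s → S (T s) = s
  radius_height : ∀ t, 0 < t → T (S t) = t
  hasDerivAt_radius : ∀ s, 0 < s → HasDerivAt T (T' s) s
  radialWeight_mul : ∀ s, 0 < s → radialWeight α (T s) * T' s ^ 2 = 1
  tangentialWeight_eq : ∀ s, 0 < s → tangentialWeight α (T s) = Real.exp (2 * β * s)

/-- For `α ≤ 1` the height is `s = -log t`, and the rate is `β = α`. -/
theorem isEndProfile_exp {α : ℝ} (hα : 0 < α) (hα1 : α ≤ 1) :
    IsEndProfile α α (fun t => -Real.log t) (fun s => Real.exp (-s)) (fun s => -Real.exp (-s)) where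
  rate_nonneg := hα.le
  contDiffOn_height := ((Real.contDiffOn_log (n := ∞)).mono fun t ht => ne_of_gt ht).neg
  contDiffOn_radius := (Real.contDiff_exp.comp contDiff_neg).contDiffOn
  height_le t t' ht htt' := neg_le_neg (Real.log_le_log ht htt')
  radius_pos s _ := Real.exp_pos _
  height_radius s _ := by simp
  radius_height t ht := by simp [Real.exp_log ht]
  hasDerivAt_radius s _ := by simpa using (hasDerivAt_neg s).exp
  radialWeight_mul s _ := by
    rw [radialWeight, if_pos hα1, ← Real.exp_mul, neg_sq, ← Real.exp_nat_mul, ← Real.exp_add]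
    simp only [Real.exp_eq_one_iff]; push_cast; ring
  tangentialWeight_eq s _ := by
    rw [tangentialWeight, if_pos hα1, ← Real.exp_mul]
    ring_nf

/-- For `α > 1` the height is `s = t^(-α) / α`, and the end is a cylinder, with the rate `β = 0`. -/
theorem isEndProfile_rpow {α : ℝ} (hα1 : 1 < α) :
    IsEndProfile α 0 (fun t => t ^ (-α) / α) (fun s => (α * s) ^ (-α⁻¹))
      (fun s => -(α * s) ^ (-α⁻¹ - 1)) where
  rate_nonneg := le_rfl
  contDiffOn_height := by
    refine ContDiffOn.div_const (fun t ht => ?_) α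
    exact (contDiffAt_id.rpow_const_of_ne (ne_of_gt ht)).contDiffWithinAt
  contDiffOn_radius := fun s hs => by
    have hs' : 0 < s := hs
    exact (ContDiffAt.rpow_const_of_ne (by fun_prop) (by positivity)).contDiffWithinAt
  height_le t t' ht htt' := by
    have := Real.rpow_le_rpow_of_nonpos ht htt' (by linarith : -α ≤ 0)
    exact div_le_div_of_nonneg_right this (by linarith)
  radius_pos s hs := Real.rpow_pos_of_pos (by positivity) _
  height_radius s hs := by
    rw [← Real.rpow_mul (by positivity)]
    simp [show α ≠ 0 by positivity]
  radius_height t ht := by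
    have h0 : α ≠ 0 := by positivity
    rw [mul_div_cancel₀ _ h0, ← Real.rpow_mul ht.le]
    simp [h0]
  hasDerivAt_radius s hs := by
    have h0 : α ≠ 0 := by positivity
    have := ((hasDerivAt_id s).const_mul α).rpow_const (p := -α⁻¹)
      (.inl (by simp only [id]; positivity))
    rw [mul_one, mul_neg, mul_inv_cancel₀ h0, neg_one_mul] at this
    exact this
  radialWeight_mul s hs := by
    have h0 : α ≠ 0 := by positivity
    have hp : 0 < α * s := by positivity
    rw [radialWeight, if_neg (not_le.2 hα1), ← Real.rpow_mul hp.le, neg_sq, ← Real.rpow_natCast,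
      ← Real.rpow_mul hp.le, ← Real.rpow_add hp]
    convert Real.rpow_zero _ using 2
    field_simp
    push_cast
    ring
  tangentialWeight_eq s _ := by simp [tangentialWeight, not_le.2 hα1]

theorem exists_isEndProfile {α : ℝ} (hα : 0 < α) : ∃ β S T T', IsEndProfile α β S T T' := by
  rcases le_or_gt α 1 with h | h
  · exact ⟨_, _, _, _, isEndProfile_exp hα h⟩
  · exact ⟨_, _, _, _, isEndProfile_rpow h⟩

variable {m k ℓ : ℕ} [NeZero m] [NeZero ℓ]
  {N : Type*} [TopologicalSpace N] [ChartedSpace (EuclideanHalfSpace m) N] [IsManifold (𝓡∂ m) ∞ N]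
  {Γ : Type*} [TopologicalSpace Γ] [ChartedSpace (EuclideanSpace ℝ (Fin k)) Γ]

/-- The model metric in the variables `(s, y, q)`, where `t = T s` and `dt = T' s ds`. -/
theorem IsEndProfile.modelForm_eq {α β : ℝ} {S T T' : ℝ → ℝ} (h : IsEndProfile α β S T T')
    (g : SmoothMetric m N) (ι : Γ → N) {s : ℝ} (hs : 0 < s)
    (y : EuclideanSpace ℝ (Fin ℓ)) (q : Γ) (a b : ℝ)
    (v w : EuclideanSpace ℝ (Fin ℓ) × EuclideanSpace ℝ (Fin k)) :
    modelForm g ι α (T s, y, q) (T' s * a, v) (T' s * b, w) =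
      a * b + Real.exp (2 * β * s) * (inner ℝ v.1 w.1 + inducedForm g ι q v.2 w.2) := by
  have h1 : modelForm g ι α (T s, y, q) (T' s * a, v) (T' s * b, w) =
      radialWeight α (T s) * (T' s * a * (T' s * b)) +
        tangentialWeight α (T s) * (inner ℝ v.1 w.1 + inducedForm g ι q v.2 w.2) := by
    simp only [modelForm, radialWeight, tangentialWeight]
    split_ifs <;> simp
  rw [h1, h.tangentialWeight_eq s hs, ← one_mul (a * b), ← h.radialWeight_mul s hs]
  ring

end Profile

/-! ### Polar coordinates on the punctured tube -/

section PolarChart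

/-- The signs `±1`. -/
def sgn : Bool → ℝ
  | true => 1
  | false => -1

theorem sgn_mul_self (σ : Bool) : sgn σ * sgn σ = 1 := by cases σ <;> simp [sgn]

variable {m k ℓ : ℕ} [NeZero m] [NeZero ℓ]

/-- The first `ℓ` coordinates, with respect to a splitting of the index set. -/
def normalPart (J : Fin ℓ ⊕ Fin k ≃ Fin m) :
    EuclideanSpace ℝ (Fin m) →L[ℝ] EuclideanSpace ℝ (Fin ℓ) :=
  LinearMap.toContinuousLinearMap
    { toFun := fun z => WithLp.toLp 2 fun i => z (J (.inl i))
      map_add' := fun x y => by ext i; simp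
      map_smul' := fun c x => by ext i; simp }

/-- The last `k` coordinates, with respect to a splitting of the index set. -/
def tangentialPart (J : Fin ℓ ⊕ Fin k ≃ Fin m) :
    EuclideanSpace ℝ (Fin m) →L[ℝ] EuclideanSpace ℝ (Fin k) :=
  LinearMap.toContinuousLinearMap
    { toFun := fun z => WithLp.toLp 2 fun i => z (J (.inr i))
      map_add' := fun x y => by ext i; simp
      map_smul' := fun c x => by ext i; simp }

/-- The vector with given first `ℓ` and last `k` coordinates. -/
def assemble (J : Fin ℓ ⊕ Fin k ≃ Fin m) :
    EuclideanSpace ℝ (Fin ℓ) × EuclideanSpace ℝ (Fin k) →L[ℝ] EuclideanSpace ℝ (Fin m) :=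
  LinearMap.toContinuousLinearMap
    { toFun := fun z => WithLp.toLp 2 fun i => Sum.elim z.1 z.2 (J.symm i)
      map_add' := fun x y => by ext i; rcases h : J.symm i with l | l <;> simp [h]
      map_smul' := fun c x => by ext i; rcases h : J.symm i with l | l <;> simp [h] }

section

variable (J : Fin ℓ ⊕ Fin k ≃ Fin m)

@[simp] theorem normalPart_apply (z : EuclideanSpace ℝ (Fin m)) (i : Fin ℓ) :
    normalPart J z i = z (J (.inl i)) := rfl

@[simp] theorem tangentialPart_apply (z : EuclideanSpace ℝ (Fin m)) (i : Fin k) :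
    tangentialPart J z i = z (J (.inr i)) := rfl

@[simp] theorem assemble_inl (u : EuclideanSpace ℝ (Fin ℓ) × EuclideanSpace ℝ (Fin k))
    (i : Fin ℓ) : assemble J u (J (.inl i)) = u.1 i := by
  change Sum.elim u.1 u.2 (J.symm (J (.inl i))) = u.1 i
  simp

@[simp] theorem assemble_inr (u : EuclideanSpace ℝ (Fin ℓ) × EuclideanSpace ℝ (Fin k))
    (i : Fin k) : assemble J u (J (.inr i)) = u.2 i := by
  change Sum.elim u.1 u.2 (J.symm (J (.inr i))) = u.2 i
  simp

theorem ext_of_split {z z' : EuclideanSpace ℝ (Fin m)}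
    (h₁ : ∀ i, z (J (.inl i)) = z' (J (.inl i))) (h₂ : ∀ i, z (J (.inr i)) = z' (J (.inr i))) :
    z = z' := by
  ext i
  obtain ⟨l | l, rfl⟩ := J.surjective i
  exacts [h₁ l, h₂ l]

/-- The point `y / |y|` of the unit sphere, where `y` has the entry `±1` at the place `j` and the
entries of `x` at the other places: the inverse of a central projection of the sphere. -/
def direction (j : Fin ℓ) (σ : Bool) (x : EuclideanSpace ℝ (Fin ℓ)) : EuclideanSpace ℝ (Fin ℓ) :=
  ‖setCoord j (sgn σ) x‖⁻¹ • setCoord j (sgn σ) x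

theorem norm_setCoord_sgn_pos (j : Fin ℓ) (σ : Bool) (x : EuclideanSpace ℝ (Fin ℓ)) :
    0 < ‖setCoord j (sgn σ) x‖ := by
  refine norm_pos_iff.2 fun h => ?_
  have h1 := setCoord_same j (sgn σ) x
  have h2 := sgn_mul_self σ
  rw [h, PiLp.zero_apply] at h1
  rw [← h1] at h2
  simp at h2

theorem norm_direction (j : Fin ℓ) (σ : Bool) (x : EuclideanSpace ℝ (Fin ℓ)) :
    ‖direction j σ x‖ = 1 := by
  rw [direction, norm_smul, norm_inv, norm_norm, inv_mul_cancel₀ (norm_setCoord_sgn_pos j σ x).ne']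

theorem contDiff_setCoord_const (j : Fin ℓ) (s : ℝ) :
    ContDiff ℝ ∞ (setCoord (m := ℓ) j s) :=
  contDiff_const.add (diagCLM _).contDiff

theorem contDiff_direction (j : Fin ℓ) (σ : Bool) : ContDiff ℝ ∞ (direction j σ) := by
  have h := contDiff_setCoord_const j (sgn σ)
  refine ContDiff.smul (ContDiff.inv ?_ fun x => (norm_setCoord_sgn_pos j σ x).ne') h
  exact h.norm ℝ fun x => norm_pos_iff.1 (norm_setCoord_sgn_pos j σ x)

theorem direction_setCoord (j : Fin ℓ) (σ : Bool) (s : ℝ) (x : EuclideanSpace ℝ (Fin ℓ)) :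
    direction j σ (setCoord j s x) = direction j σ x := by
  rw [direction, setCoord_setCoord, direction]

end

/-- The central projection of `{x | 0 < ± x j}` to the hyperplane `x j = ± 1`. It is homogeneous of
degree zero. -/
def centralProj (j : Fin ℓ) (σ : Bool) (x : EuclideanSpace ℝ (Fin ℓ)) : EuclideanSpace ℝ (Fin ℓ) :=
  (sgn σ * x j)⁻¹ • x

theorem centralProj_smul {c : ℝ} (hc : c ≠ 0) (j : Fin ℓ) (σ : Bool)
    (x : EuclideanSpace ℝ (Fin ℓ)) : centralProj j σ (c • x) = centralProj j σ x := by
  rw [centralProj, centralProj, smul_smul, PiLp.smul_apply, smul_eq_mul]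
  congr 1
  rw [mul_left_comm, mul_inv, mul_comm, ← mul_assoc, mul_inv_cancel₀ hc, one_mul]

theorem centralProj_direction (j : Fin ℓ) (σ : Bool) (x : EuclideanSpace ℝ (Fin ℓ)) :
    centralProj j σ (direction j σ x) = setCoord j (sgn σ) x := by
  rw [direction, centralProj_smul (inv_pos.2 (norm_setCoord_sgn_pos j σ x)).ne', centralProj,
    setCoord_same, sgn_mul_self, inv_one, one_smul]

theorem direction_centralProj {j : Fin ℓ} {σ : Bool} {x : EuclideanSpace ℝ (Fin ℓ)}
    (hx : 0 < sgn σ * x j) : direction j σ (centralProj j σ x) = ‖x‖⁻¹ • x := by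
  have h1 : setCoord j (sgn σ) (centralProj j σ x) = centralProj j σ x := by
    have : centralProj j σ x j = sgn σ := by
      have h0 : x j ≠ 0 := fun h => by simp [h] at hx
      have h2 : sgn σ ≠ 0 := fun h => by simp [h] at hx
      have h3 := sgn_mul_self σ
      simp only [centralProj, PiLp.smul_apply, smul_eq_mul]
      field_simp
      linarith
    conv_lhs => rw [← this]
    exact setCoord_self j _
  have hc : 0 < (sgn σ * x j)⁻¹ := inv_pos.2 hx
  rw [direction, h1, centralProj, norm_smul, Real.norm_of_nonneg hc.le, smul_smul, mul_inv,
    mul_right_comm, inv_mul_cancel₀ hc.ne', one_mul]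

variable {Γ : Type*} [TopologicalSpace Γ] [ChartedSpace (EuclideanSpace ℝ (Fin k)) Γ]

/-- The data of a chart of the end: the chart of the sphere given by the central projection to
`{x | x j = ± 1}`, and a chart of `Γ` with values in `(-3, 3)ᵏ`. The flag `half` indicates that the
chart meets the boundary, that is, the coordinate `x 0` is restricted to nonnegative values. -/
structure PolarCell (k ℓ : ℕ) [NeZero ℓ] (Γ : Type*) [TopologicalSpace Γ]
    [ChartedSpace (EuclideanSpace ℝ (Fin k)) Γ] where
  /-- The coordinate which does not vanish. -/
  axis : Fin ℓ
  /-- The sign of the coordinate `axis`. -/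
  sign : Bool
  /-- Whether the chart meets the boundary. -/
  half : Prop
  /-- The chart of `Γ`. -/
  chart : PartialEquiv Γ (EuclideanSpace ℝ (Fin k))
  half_ne : half → axis ≠ 0
  open_source : IsOpen chart.source
  smooth : ContMDiffOn (𝓡 k) (𝓡 k) ∞ chart chart.source
  smooth_symm : ContMDiffOn (𝓡 k) (𝓡 k) ∞ chart.symm chart.target
  chart_target : chart.target = {w | ∀ i, |w i| < 3}

variable {α β s₀ : ℝ} {S T T' : ℝ → ℝ} (J : Fin ℓ ⊕ Fin k ≃ Fin m)

/-- The coordinates `(s, y, w)` on a part of the punctured tube, where `s = S |x|` is the height,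
`y` is the central projection of `x / |x|`, and `w` are coordinates on `Γ`. -/
def polarChart (hJ : J (.inl 0) = 0) (hP : IsEndProfile α β S T T') (hs₀ : 0 ≤ s₀)
    (c : PolarCell k ℓ Γ) :
    PartialEquiv (EuclideanSpace ℝ (Fin ℓ) × Γ) (EuclideanSpace ℝ (Fin m)) where
  toFun u := assemble J (setCoord c.axis (S ‖u.1‖) (centralProj c.axis c.sign u.1), c.chart u.2)
  invFun z := (T (z (J (.inl c.axis))) • direction c.axis c.sign (normalPart J z),
    c.chart.symm (tangentialPart J z))
  source := {u | 0 < sgn c.sign * u.1 c.axis ∧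
    (∀ i ≠ c.axis, |u.1 i| < 3 * (sgn c.sign * u.1 c.axis)) ∧ s₀ < S ‖u.1‖ ∧
    (c.half → 0 ≤ u.1 0) ∧ u.2 ∈ c.chart.source}
  target := endBox (J (.inl c.axis)) c.half s₀
  map_source' := by
    rintro ⟨x, q⟩ ⟨h1, h2, h3, h4, h5⟩
    refine ⟨by simpa using h3, fun l hl => ?_, fun hh => ?_⟩
    · obtain ⟨i | i, rfl⟩ := J.surjective l
      · have hi : i ≠ c.axis := fun h => hl (by rw [h])
        rw [assemble_inl, setCoord_of_ne hi, centralProj, PiLp.smul_apply, smul_eq_mul, abs_mul,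
          abs_of_pos (inv_pos.2 h1), inv_mul_lt_iff₀ h1, mul_comm]
        exact h2 i hi
      · rw [assemble_inr]
        have := c.chart.map_source h5
        rw [c.chart_target] at this
        exact this i
    · rw [← hJ, assemble_inl, setCoord_of_ne (c.half_ne hh).symm]
      exact mul_nonneg (inv_pos.2 h1).le (h4 hh)
  map_target' := by
    rintro z ⟨h1, h2, h3⟩
    have hs : 0 < z (J (.inl c.axis)) := hs₀.trans_lt h1
    have hT := hP.radius_pos _ hs
    have hn := norm_setCoord_sgn_pos c.axis c.sign (normalPart J z)
    have e : ∀ i, (T (z (J (.inl c.axis))) • direction c.axis c.sign (normalPart J z)) i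
        = (T (z (J (.inl c.axis))) * ‖setCoord c.axis (sgn c.sign) (normalPart J z)‖⁻¹) *
          setCoord c.axis (sgn c.sign) (normalPart J z) i := fun i => by
      simp only [direction, PiLp.smul_apply, smul_eq_mul, mul_assoc]
    have hc : 0 < T (z (J (.inl c.axis))) *
        ‖setCoord c.axis (sgn c.sign) (normalPart J z)‖⁻¹ := by positivity
    have e1 := e c.axis
    rw [setCoord_same] at e1
    have e2 : sgn c.sign * (T (z (J (.inl c.axis))) •
        direction c.axis c.sign (normalPart J z)) c.axis =
        T (z (J (.inl c.axis))) * ‖setCoord c.axis (sgn c.sign) (normalPart J z)‖⁻¹ := by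
      rw [e1, mul_left_comm, sgn_mul_self, mul_one]
    refine ⟨by simpa only [e2] using hc, fun i hi => ?_, ?_, fun hh => ?_, c.chart.map_target ?_⟩
    · simp only [e2]
      rw [e, setCoord_of_ne hi, abs_mul, abs_of_pos hc, mul_comm]
      exact mul_lt_mul_of_pos_right (h2 _ fun h => hi (by simpa using h)) hc
    · simp only [norm_smul, norm_direction, mul_one, Real.norm_of_nonneg hT.le,
        hP.height_radius _ hs]
      exact h1
    · rw [e, setCoord_of_ne (c.half_ne hh).symm, normalPart_apply, hJ]
      exact mul_nonneg hc.le (h3 hh)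
    · rw [c.chart_target]
      exact fun i => h2 _ (by simp)
  left_inv' := by
    rintro ⟨x, q⟩ ⟨h1, h2, h3, h4, h5⟩
    have hx : 0 < ‖x‖ := norm_pos_iff.2 fun h => by simp [h] at h1
    refine Prod.ext ?_ ?_
    · have e : normalPart J (assemble J (setCoord c.axis (S ‖x‖) (centralProj c.axis c.sign x),
          c.chart q)) = setCoord c.axis (S ‖x‖) (centralProj c.axis c.sign x) := by
        ext i; simp
      simp only [e, assemble_inl, setCoord_same, hP.radius_height _ hx, direction_setCoord]
      rw [direction_centralProj h1, smul_smul, mul_inv_cancel₀ hx.ne', one_smul]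
    · have e : tangentialPart J (assemble J (setCoord c.axis (S ‖x‖) (centralProj c.axis c.sign x),
          c.chart q)) = c.chart q := by
        ext i; simp
      simp only [e, c.chart.left_inv h5]
  right_inv' := by
    rintro z ⟨h1, h2, h3⟩
    have hs : 0 < z (J (.inl c.axis)) := hs₀.trans_lt h1
    have hT := hP.radius_pos _ hs
    refine ext_of_split J (fun i => ?_) fun i => ?_
    · simp only [assemble_inl, norm_smul, norm_direction, mul_one, Real.norm_of_nonneg hT.le,
        hP.height_radius _ hs, centralProj_smul hT.ne', centralProj_direction]
      rw [setCoord_setCoord]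
      by_cases hi : i = c.axis
      · subst hi; simp
      · rw [setCoord_of_ne hi, normalPart_apply]
    · rw [assemble_inr]
      have : tangentialPart J z ∈ c.chart.target := by
        rw [c.chart_target]
        exact fun i => h2 _ (by simp)
      simp only [c.chart.right_inv this, tangentialPart_apply]

variable {J} {hJ : J (.inl 0) = 0} {hP : IsEndProfile α β S T T'} {hs₀ : 0 ≤ s₀}

theorem isOpen_endBox_false (j : Fin m) : IsOpen (endBox j False s₀) := by
  have : endBox j False s₀ = (fun z : EuclideanSpace ℝ (Fin m) => z j) ⁻¹' Ioi s₀ ∩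
      ⋂ l, ⋂ (_ : l ≠ j), {z | |z l| < 3} := by
    ext z; simp [endBox]
  rw [this]
  exact (isOpen_Ioi.preimage (by fun_prop)).inter (isOpen_iInter_of_finite fun l =>
    isOpen_iInter_of_finite fun _ => isOpen_lt (by fun_prop) continuous_const)

theorem contMDiffOn_polarChart (c : PolarCell k ℓ Γ) :
    ContMDiffOn (𝓘(ℝ, EuclideanSpace ℝ (Fin ℓ)).prod (𝓡 k)) 𝓘(ℝ, EuclideanSpace ℝ (Fin m)) ∞
      (polarChart J hJ hP hs₀ c) (polarChart J hJ hP hs₀ c).source := by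
  have h1 : ContDiffOn ℝ ∞ (fun x : EuclideanSpace ℝ (Fin ℓ) =>
      setCoord c.axis (S ‖x‖) (centralProj c.axis c.sign x)) {x | 0 < sgn c.sign * x c.axis} := by
    have hx : ∀ x ∈ {x : EuclideanSpace ℝ (Fin ℓ) | 0 < sgn c.sign * x c.axis}, x ≠ 0 := by
      rintro x hx rfl
      simp at hx
    have hp : ContDiffOn ℝ ∞ (centralProj c.axis c.sign) {x | 0 < sgn c.sign * x c.axis} := by
      have hl : ContDiffOn ℝ ∞ (fun x : EuclideanSpace ℝ (Fin ℓ) => sgn c.sign * x c.axis)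
          {x | 0 < sgn c.sign * x c.axis} :=
        (contDiff_const.mul (contDiff_piLp_apply (p := 2))).contDiffOn
      exact (hl.inv fun x hx => (show 0 < sgn c.sign * x c.axis from hx).ne').smul contDiffOn_id
    have hS : ContDiffOn ℝ ∞ (fun x : EuclideanSpace ℝ (Fin ℓ) => S ‖x‖)
        {x | 0 < sgn c.sign * x c.axis} :=
      hP.contDiffOn_height.comp (contDiffOn_id.norm ℝ hx) fun x h => norm_pos_iff.2 (hx x h)
    have e : (fun x : EuclideanSpace ℝ (Fin ℓ) =>
        setCoord c.axis (S ‖x‖) (centralProj c.axis c.sign x)) = fun x =>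
        S ‖x‖ • EuclideanSpace.single c.axis (1 : ℝ) +
          diagCLM (killCoord c.axis) (centralProj c.axis c.sign x) := by
      ext x i
      simp [setCoord]
    rw [e]
    exact (hS.smul contDiffOn_const).add ((diagCLM _).contDiff.comp_contDiffOn hp)
  have h2 := h1.contMDiffOn.comp (contMDiffOn_fst (I := 𝓘(ℝ, EuclideanSpace ℝ (Fin ℓ)))
    (J := 𝓡 k) (N := Γ) (s := (polarChart J hJ hP hs₀ c).source)) fun u hu => hu.1
  have h3 := c.smooth.comp (contMDiffOn_snd (I := 𝓘(ℝ, EuclideanSpace ℝ (Fin ℓ)))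
    (J := 𝓡 k) (N := Γ) (s := (polarChart J hJ hP hs₀ c).source)) fun u hu => hu.2.2.2.2
  exact (assemble J).contDiff.contMDiff.comp_contMDiffOn (h2.prodMk_space h3)

theorem contMDiffOn_polarChart_symm (c : PolarCell k ℓ Γ) :
    ContMDiffOn 𝓘(ℝ, EuclideanSpace ℝ (Fin m)) (𝓘(ℝ, EuclideanSpace ℝ (Fin ℓ)).prod (𝓡 k)) ∞
      (polarChart J hJ hP hs₀ c).symm (polarChart J hJ hP hs₀ c).target := by
  refine ContMDiffOn.prodMk ?_ ?_
  · have h1 : ContDiffOn ℝ ∞ (fun z : EuclideanSpace ℝ (Fin m) => T (z (J (.inl c.axis))))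
        (polarChart J hJ hP hs₀ c).target :=
      hP.contDiffOn_radius.comp (contDiff_piLp_apply (p := 2)).contDiffOn
        fun z hz => hs₀.trans_lt hz.1
    exact (h1.smul ((contDiff_direction c.axis c.sign).comp
      (normalPart J).contDiff).contDiffOn).contMDiffOn
  · refine c.smooth_symm.comp (tangentialPart J).contDiff.contMDiff.contMDiffOn fun z hz => ?_
    rw [mem_preimage, c.chart_target]
    exact fun i => hz.2.1 _ (by simp)

/-- Dilations in the normal directions are translations of the height. -/
theorem polarChart_smul {c : PolarCell k ℓ Γ} {x : EuclideanSpace ℝ (Fin ℓ)} {q : Γ} {t : ℝ}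
    (ht : 0 < t) :
    polarChart J hJ hP hs₀ c (t • x, q) =
      setCoord (J (.inl c.axis)) (S ‖t • x‖) (polarChart J hJ hP hs₀ c (x, q)) := by
  refine ext_of_split J (fun i => ?_) fun i => ?_
  · by_cases hi : i = c.axis
    · subst hi; simp [polarChart]
    · rw [setCoord_of_ne (by simpa using hi)]
      simp [polarChart, setCoord_of_ne hi, centralProj_smul ht.ne']
  · rw [setCoord_of_ne (by simp)]
    simp [polarChart]

theorem smul_mem_polarChart_source {c : PolarCell k ℓ Γ} {u : EuclideanSpace ℝ (Fin ℓ) × Γ}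
    {t : ℝ} (ht : 0 < t) (hu : u ∈ (polarChart J hJ hP hs₀ c).source)
    (hS : s₀ < S ‖t • u.1‖) : (t • u.1, u.2) ∈ (polarChart J hJ hP hs₀ c).source := by
  rcases u with ⟨x, q⟩
  obtain ⟨h1, h2, h3, h4, h5⟩ := hu
  have e : sgn c.sign * (t • x) c.axis = t * (sgn c.sign * x c.axis) := by
    rw [PiLp.smul_apply, smul_eq_mul]; ring
  refine ⟨?_, fun i hi => ?_, hS, fun hh => mul_nonneg ht.le (h4 hh), h5⟩
  · simp only [e]; exact mul_pos ht h1
  · simp only [e]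
    rw [PiLp.smul_apply, smul_eq_mul, abs_mul, abs_of_pos ht, mul_left_comm]
    exact mul_lt_mul_of_pos_left (h2 i hi) ht

theorem polarChart_symm_setCoord {c : PolarCell k ℓ Γ} {z : EuclideanSpace ℝ (Fin m)}
    (hz : z ∈ endBox (J (.inl c.axis)) c.half s₀) (s : ℝ) :
    (polarChart J hJ hP hs₀ c).symm (setCoord (J (.inl c.axis)) s z) =
      ((T s * (T (z (J (.inl c.axis))))⁻¹) • ((polarChart J hJ hP hs₀ c).symm z).1,
        ((polarChart J hJ hP hs₀ c).symm z).2) := by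
  have hT := hP.radius_pos _ (hs₀.trans_lt hz.1)
  have e : normalPart J (setCoord (J (.inl c.axis)) s z) =
      setCoord c.axis s (normalPart J z) := by
    ext i
    by_cases hi : i = c.axis
    · subst hi; simp
    · rw [setCoord_of_ne hi, normalPart_apply, setCoord_of_ne (by simpa using hi),
        normalPart_apply]
  have e' : tangentialPart J (setCoord (J (.inl c.axis)) s z) = tangentialPart J z := by
    ext i
    rw [tangentialPart_apply, setCoord_of_ne (by simp), tangentialPart_apply]
  refine Prod.ext ?_ ?_
  · change T (setCoord (J (.inl c.axis)) s z (J (.inl c.axis))) • direction _ _ _ =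
      (T s * (T (z (J (.inl c.axis))))⁻¹) • T (z (J (.inl c.axis))) • direction _ _ _
    rw [e, direction_setCoord, setCoord_same, smul_smul, inv_mul_cancel_right₀ hT.ne']
  · change c.chart.symm _ = c.chart.symm _
    rw [e']

end PolarChart

/-! ### The punctured tube as a cylindrical end -/

section TubeEnd

variable {m k ℓ : ℕ} [NeZero m] [NeZero ℓ]
  {N : Type*} [TopologicalSpace N] [ChartedSpace (EuclideanHalfSpace m) N]
  [IsManifold (𝓡∂ m) ∞ N]
  {Γ : Type*} [TopologicalSpace Γ] [ChartedSpace (EuclideanSpace ℝ (Fin k)) Γ]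
  {α β s₀ : ℝ} {S T T' : ℝ → ℝ} {J : Fin ℓ ⊕ Fin k ≃ Fin m}

/-- The setting in which the tube around `Γ` is described by finitely many charts `c a`: the
metric `h` is the model metric where the height is greater than `s₀`, and `bd` states that `Γ` lies
in the boundary. -/
structure IsTubeEnd (g : SmoothMetric m N) (ι : Γ → N)
    (τ : PartialEquiv N (EuclideanSpace ℝ (Fin ℓ) × Γ)) (M : TopologicalSpace.Opens N)
    (h : SmoothMetric m M) (α : ℝ) (S T : ℝ → ℝ) (s₀ : ℝ) (bd : Prop) {A : Type*}
    (c : A → PolarCell k ℓ Γ) : Prop where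
  tubular : IsTubularDiffeo (k := k) g ι τ
  opens_eq : (M : Set N) = (range ι)ᶜ
  mem_target_iff : ∀ x q, (x, q) ∈ τ.target ↔ ‖x‖ < 1 ∧ (bd → 0 ≤ x 0)
  half_iff : ∀ a, (c a).half ↔ bd ∧ (c a).axis ≠ 0
  sign_eq : ∀ a, bd → (c a).axis = 0 → (c a).sign = true
  radius_lt : ∀ s, s₀ < s → T s < 1
  metric_eq : ∀ p : M, (p : N) ∈ τ.source → s₀ < S ‖(τ p).1‖ →
    ∀ v w : TangentSpace (𝓡∂ m) p, h.inner p v w = pulledBackModelForm (k := k) g ι τ α M p v w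

/-- The point of the unit sphere and the point of `Γ` with given coordinates. -/
def crossSection (J : Fin ℓ ⊕ Fin k ≃ Fin m) (c : PolarCell k ℓ Γ)
    (z : EuclideanSpace ℝ (Fin m)) : EuclideanSpace ℝ (Fin ℓ) × Γ :=
  (direction c.axis c.sign (normalPart J z), c.chart.symm (tangentialPart J z))

theorem contMDiffOn_crossSection (c : PolarCell k ℓ Γ) (half : Prop) :
    ContMDiffOn 𝓘(ℝ, EuclideanSpace ℝ (Fin m)) (𝓘(ℝ, EuclideanSpace ℝ (Fin ℓ)).prod (𝓡 k)) ∞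
      (crossSection J c) (endBox (J (.inl c.axis)) half s₀) := by
  refine ContMDiffOn.prodMk ?_ ?_
  · exact ((contDiff_direction c.axis c.sign).comp
      (normalPart J).contDiff).contDiffOn.contMDiffOn
  · refine c.smooth_symm.comp (tangentialPart J).contDiff.contMDiff.contMDiffOn fun z hz => ?_
    rw [mem_preimage, c.chart_target]
    exact fun i => hz.2.1 _ (by simp)

theorem crossSection_setCoord (c : PolarCell k ℓ Γ) (s : ℝ) (z : EuclideanSpace ℝ (Fin m)) :
    crossSection J c (setCoord (J (.inl c.axis)) s z) = crossSection J c z := by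
  have e : normalPart J (setCoord (J (.inl c.axis)) s z) =
      setCoord c.axis s (normalPart J z) := by
    ext i
    by_cases hi : i = c.axis
    · subst hi; simp
    · rw [setCoord_of_ne hi, normalPart_apply, setCoord_of_ne (by simpa using hi),
        normalPart_apply]
  have e' : tangentialPart J (setCoord (J (.inl c.axis)) s z) = tangentialPart J z := by
    ext i
    rw [tangentialPart_apply, setCoord_of_ne (by simp), tangentialPart_apply]
  rw [crossSection, crossSection, e, e', direction_setCoord]

theorem setCoord_mem_endBox {j : Fin m} {half : Prop} (hj : half → j ≠ 0)
    {z : EuclideanSpace ℝ (Fin m)} (hz : z ∈ endBox j half s₀) {s : ℝ} (hs : s₀ < s) :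
    setCoord j s z ∈ endBox j half s₀ :=
  ⟨by simpa using hs, fun l hl => by rw [setCoord_of_ne hl]; exact hz.2.1 l hl,
    fun hh => by rw [setCoord_of_ne (hj hh).symm]; exact hz.2.2 hh⟩

theorem uniqueDiffOn_endBox (j : Fin m) (half : Prop) :
    UniqueDiffOn ℝ (endBox j half s₀) := by
  by_cases hh : half
  · have : endBox j half s₀ = halfSpaceSet m ∩ endBox j False s₀ := by
      ext z
      simp only [endBox, halfSpaceSet, mem_ofPred_eq, mem_inter_iff, hh]
      tauto
    rw [this]
    exact uniqueDiffOn_halfSpaceSet.inter (isOpen_endBox_false j)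
  · have : endBox j half s₀ = endBox j False s₀ := by
      ext z; simp [endBox, hh]
    rw [this]
    exact (isOpen_endBox_false j).uniqueDiffOn

/-- The differential of `crossSection`. -/
def crossDeriv (J : Fin ℓ ⊕ Fin k ≃ Fin m) (s₀ : ℝ) (c : PolarCell k ℓ Γ)
    (z : EuclideanSpace ℝ (Fin m)) :
    EuclideanSpace ℝ (Fin m) →L[ℝ] EuclideanSpace ℝ (Fin ℓ) × EuclideanSpace ℝ (Fin k) :=
  mfderivWithin 𝓘(ℝ, EuclideanSpace ℝ (Fin m)) (𝓘(ℝ, EuclideanSpace ℝ (Fin ℓ)).prod (𝓡 k))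
    (crossSection J c) (endBox (J (.inl c.axis)) c.half s₀) z

theorem hasMFDerivWithinAt_crossSection [IsManifold (𝓡 k) ∞ Γ] (c : PolarCell k ℓ Γ)
    {z : EuclideanSpace ℝ (Fin m)}
    (hz : z ∈ endBox (J (.inl c.axis)) c.half s₀) :
    HasMFDerivWithinAt 𝓘(ℝ, EuclideanSpace ℝ (Fin m)) (𝓘(ℝ, EuclideanSpace ℝ (Fin ℓ)).prod (𝓡 k))
      (crossSection J c) (endBox (J (.inl c.axis)) c.half s₀) z (crossDeriv J s₀ c z) :=
  ((contMDiffOn_crossSection c c.half z hz).mdifferentiableWithinAt (by simp)).hasMFDerivWithinAt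

theorem half_ne_zero (hJ : J (.inl 0) = 0) (c : PolarCell k ℓ Γ) (hh : c.half) :
    J (.inl c.axis) ≠ 0 := by
  rw [← hJ]
  simpa using c.half_ne hh

/-- As the cross section does not depend on the height, neither does its differential, which
vanishes in the direction of the height. -/
theorem crossDeriv_eq [IsManifold (𝓡 k) ∞ Γ] (hJ : J (.inl 0) = 0) (c : PolarCell k ℓ Γ)
    {z : EuclideanSpace ℝ (Fin m)} (hz : z ∈ endBox (J (.inl c.axis)) c.half s₀) {s : ℝ}
    (hs : s₀ < s) (ξ : EuclideanSpace ℝ (Fin m)) :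
    crossDeriv J s₀ c z ξ = crossDeriv J s₀ c (setCoord (J (.inl c.axis)) s z)
      (diagCLM (killCoord (J (.inl c.axis))) ξ) := by
  have hmaps : MapsTo (setCoord (J (.inl c.axis)) s) (endBox (J (.inl c.axis)) c.half s₀)
      (endBox (J (.inl c.axis)) c.half s₀) := fun y hy =>
    setCoord_mem_endBox (half_ne_zero hJ c) hy hs
  have hA : HasMFDerivWithinAt 𝓘(ℝ, EuclideanSpace ℝ (Fin m)) 𝓘(ℝ, EuclideanSpace ℝ (Fin m))
      (setCoord (J (.inl c.axis)) s) (endBox (J (.inl c.axis)) c.half s₀) z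
      (diagCLM (killCoord (J (.inl c.axis)))) :=
    ((diagCLM (killCoord (J (.inl c.axis)))).hasFDerivWithinAt.const_add _).hasMFDerivWithinAt
  have h1 := (hasMFDerivWithinAt_crossSection c (hmaps hz)).comp z hA hmaps
  have h2 := h1.congr_of_eventuallyEq (f₁ := crossSection J c)
    (Filter.eventuallyEq_of_mem self_mem_nhdsWithin fun y hy => (crossSection_setCoord c s y).symm)
    (crossSection_setCoord c s z).symm
  have h3 := ((uniqueDiffOn_endBox _ _).uniqueMDiffOn z hz).eq
    (hasMFDerivWithinAt_crossSection c hz) h2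
  exact congrArg (fun L => L ξ) h3

variable (J) in
/-- The charts of the tube: polar coordinates composed with the tubular diffeomorphism. -/
def tubeChart (hJ : J (.inl 0) = 0) (hP : IsEndProfile α β S T T') (hs₀ : 0 ≤ s₀)
    (τ : PartialEquiv N (EuclideanSpace ℝ (Fin ℓ) × Γ)) (M : TopologicalSpace.Opens N) [Nonempty M]
    (c : PolarCell k ℓ Γ) : PartialEquiv M (EuclideanSpace ℝ (Fin m)) :=
  restrictOpens M (τ.trans (polarChart J hJ hP hs₀ c))

theorem norm_polarChart_symm {hJ : J (.inl 0) = 0} {hP : IsEndProfile α β S T T'} {hs₀ : 0 ≤ s₀}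
    (c : PolarCell k ℓ Γ) {z : EuclideanSpace ℝ (Fin m)}
    (hz : z ∈ endBox (J (.inl c.axis)) c.half s₀) :
    ‖((polarChart J hJ hP hs₀ c).symm z).1‖ = T (z (J (.inl c.axis))) := by
  change ‖T (z (J (.inl c.axis))) • direction c.axis c.sign (normalPart J z)‖ = _
  rw [norm_smul, norm_direction, mul_one,
    Real.norm_of_nonneg (hP.radius_pos _ (hs₀.trans_lt hz.1)).le]

namespace IsTubeEnd

variable {g : SmoothMetric m N} {ι : Γ → N}
  {τ : PartialEquiv N (EuclideanSpace ℝ (Fin ℓ) × Γ)} {M : TopologicalSpace.Opens N} [Nonempty M]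
  {h : SmoothMetric m M} {bd : Prop} {A : Type*} {c : A → PolarCell k ℓ Γ}
  {hJ : J (.inl 0) = 0} {hP : IsEndProfile α β S T T'} {hs₀ : 0 ≤ s₀}

theorem mem_opens_iff (H : IsTubeEnd g ι τ M h α S T s₀ bd c) {p : N} (hp : p ∈ τ.source) :
    p ∈ M ↔ (τ p).1 ≠ 0 := by
  have : p ∈ M ↔ p ∈ (range ι)ᶜ := by rw [← H.opens_eq]; rfl
  rw [this, mem_compl_iff, not_iff_not]
  constructor
  · rintro ⟨q, rfl⟩
    rw [H.tubular.map_submanifold]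
  · intro h0
    refine ⟨(τ p).2, τ.injOn (H.tubular.mem_source _) hp ?_⟩
    rw [H.tubular.map_submanifold]
    exact Prod.ext h0.symm rfl

theorem polarChart_symm_mem_target (H : IsTubeEnd g ι τ M h α S T s₀ bd c) {a : A}
    {z : EuclideanSpace ℝ (Fin m)} (hz : z ∈ endBox (J (.inl (c a).axis)) (c a).half s₀) :
    (polarChart J hJ hP hs₀ (c a)).symm z ∈ τ.target := by
  have hs := (polarChart J hJ hP hs₀ (c a)).map_target hz
  refine (H.mem_target_iff _ _).2 ⟨?_, fun hb => ?_⟩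
  · exact (norm_polarChart_symm (hJ := hJ) (hP := hP) (hs₀ := hs₀) (c a) hz).trans_lt
      (H.radius_lt _ hz.1)
  · by_cases h0 : (c a).axis = 0
    · have h1 := hs.1
      rw [h0, H.sign_eq a hb h0, sgn, one_mul] at h1
      exact h1.le
    · exact hs.2.2.2.1 ((H.half_iff a).2 ⟨hb, h0⟩)

theorem polarChart_symm_ne_zero {c : PolarCell k ℓ Γ}
    {z : EuclideanSpace ℝ (Fin m)} (hz : z ∈ endBox (J (.inl c.axis)) c.half s₀) :
    ((polarChart J hJ hP hs₀ c).symm z).1 ≠ 0 := by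
  rw [← norm_pos_iff, norm_polarChart_symm c hz]
  exact hP.radius_pos _ (hs₀.trans_lt hz.1)

theorem tubeChart_target (H : IsTubeEnd g ι τ M h α S T s₀ bd c) (a : A) :
    (tubeChart J hJ hP hs₀ τ M (c a)).target = endBox (J (.inl (c a).axis)) (c a).half s₀ := by
  refine Subset.antisymm (fun z hz => hz.1.1) fun z hz => ?_
  have h1 := H.polarChart_symm_mem_target (hJ := hJ) (hP := hP) (hs₀ := hs₀) hz
  refine ⟨⟨hz, h1⟩, (H.mem_opens_iff (τ.map_target h1)).2 ?_⟩
  rw [τ.right_inv h1]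
  exact polarChart_symm_ne_zero hz

theorem tubeChart_symm_apply (H : IsTubeEnd g ι τ M h α S T s₀ bd c) {a : A}
    {z : EuclideanSpace ℝ (Fin m)} (hz : z ∈ endBox (J (.inl (c a).axis)) (c a).half s₀) :
    ((tubeChart J hJ hP hs₀ τ M (c a)).symm z : N) =
      τ.symm ((polarChart J hJ hP hs₀ (c a)).symm z) :=
  restrictOpens_symm_apply
    (by rwa [← H.tubeChart_target (hJ := hJ) (hP := hP) (hs₀ := hs₀)] at hz)

theorem apply_tubeChart_symm (H : IsTubeEnd g ι τ M h α S T s₀ bd c) {a : A}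
    {z : EuclideanSpace ℝ (Fin m)} (hz : z ∈ endBox (J (.inl (c a).axis)) (c a).half s₀) :
    τ ((tubeChart J hJ hP hs₀ τ M (c a)).symm z) = (polarChart J hJ hP hs₀ (c a)).symm z := by
  rw [H.tubeChart_symm_apply hz, τ.right_inv (H.polarChart_symm_mem_target hz)]

theorem tubeChart_symm_mem_source (H : IsTubeEnd g ι τ M h α S T s₀ bd c) {a : A}
    {z : EuclideanSpace ℝ (Fin m)} (hz : z ∈ endBox (J (.inl (c a).axis)) (c a).half s₀) :
    ((tubeChart J hJ hP hs₀ τ M (c a)).symm z : N) ∈ τ.source := by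
  rw [H.tubeChart_symm_apply hz]
  exact τ.map_target (H.polarChart_symm_mem_target hz)

theorem canonicalRep_tubeChart_symm (H : IsTubeEnd g ι τ M h α S T s₀ bd c) {a : A}
    {z : EuclideanSpace ℝ (Fin m)} (hz : z ∈ endBox (J (.inl (c a).axis)) (c a).half s₀) :
    canonicalRep τ ((tubeChart J hJ hP hs₀ τ M (c a)).symm z : N) =
      (T (z (J (.inl (c a).axis))), crossSection J (c a) z) := by
  have hT := hP.radius_pos _ (hs₀.trans_lt hz.1)
  rw [canonicalRep, H.apply_tubeChart_symm hz, norm_polarChart_symm (c a) hz]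
  refine Prod.ext rfl (Prod.ext ?_ rfl)
  change (T (z (J (.inl (c a).axis))))⁻¹ • T (z (J (.inl (c a).axis))) • _ = _
  rw [smul_smul, inv_mul_cancel₀ hT.ne', one_smul]
  rfl

theorem isSmoothChart_tubeChart (H : IsTubeEnd g ι τ M h α S T s₀ bd c) (a : A) :
    IsSmoothChart (tubeChart J hJ hP hs₀ τ M (c a)) := by
  have hτ := H.tubular
  refine IsSmoothChart.restrictOpens ⟨?_, ?_, ?_, ?_⟩
  · set U : Set (EuclideanSpace ℝ (Fin ℓ)) := {x | 0 < sgn (c a).sign * x (c a).axis} with hUdef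
    have hU : IsOpen U := isOpen_lt continuous_const (by fun_prop)
    have hSU : ContinuousOn (fun x : EuclideanSpace ℝ (Fin ℓ) => S ‖x‖) U :=
      hP.contDiffOn_height.continuousOn.comp continuous_norm.continuousOn fun x hx =>
        norm_pos_iff.2 fun h0 => by simp [hUdef, h0] at hx
    have hW : IsOpen ((U ∩ (fun x => S ‖x‖) ⁻¹' Ioi s₀) ∩ ⋂ i, ⋂ (_ : i ≠ (c a).axis),
        {x : EuclideanSpace ℝ (Fin ℓ) | |x i| < 3 * (sgn (c a).sign * x (c a).axis)}) :=
      (hSU.isOpen_inter_preimage hU isOpen_Ioi).inter (isOpen_iInter_of_finite fun i =>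
        isOpen_iInter_of_finite fun _ => isOpen_lt (by fun_prop) (by fun_prop))
    have := hτ.smooth.continuousOn.isOpen_inter_preimage hτ.open_source
      (hW.prod (c a).open_source)
    convert this using 1
    ext p
    refine and_congr_right fun hp => ?_
    have hb := ((H.mem_target_iff _ _).1 (τ.map_source hp)).2
    simp only [polarChart, mem_preimage, mem_ofPred_eq, mem_prod, mem_inter_iff, mem_iInter, hUdef,
      mem_Ioi]
    exact ⟨fun ⟨h1, h2, h3, _, h5⟩ => ⟨⟨⟨h1, h3⟩, h2⟩, h5⟩,
      fun ⟨⟨⟨h1, h3⟩, h2⟩, h5⟩ => ⟨h1, h2, h3, fun hh => hb ((H.half_iff a).1 hh).1, h5⟩⟩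
  · exact (contMDiffOn_polarChart (c a)).comp (hτ.smooth.mono inter_subset_left) fun p hp => hp.2
  · exact hτ.smooth_symm.comp ((contMDiffOn_polarChart_symm (c a)).mono inter_subset_left)
      fun p hp => hp.2
  · refine ⟨endBox (J (.inl (c a).axis)) False s₀, isOpen_endBox_false _, ?_⟩
    have ht : (τ.trans (polarChart J hJ hP hs₀ (c a))).target =
        endBox (J (.inl (c a).axis)) (c a).half s₀ :=
      Subset.antisymm inter_subset_left fun z hz => ⟨hz, H.polarChart_symm_mem_target hz⟩
    rw [ht]
    by_cases hh : (c a).half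
    · right; ext z; simp [endBox, halfSpaceSet, hh, and_assoc]
    · left; ext z; simp [endBox, hh]

theorem tubeChart_apply {c : PolarCell k ℓ Γ} {p : M} :
    tubeChart J hJ hP hs₀ τ M c p = polarChart J hJ hP hs₀ c (τ p) := rfl

theorem polarChart_apply_axis {c : PolarCell k ℓ Γ} {u : EuclideanSpace ℝ (Fin ℓ) × Γ} :
    polarChart J hJ hP hs₀ c u (J (.inl c.axis)) = S ‖u.1‖ := by
  simp [polarChart]

theorem hasMFDerivAt_canonicalRep [IsManifold (𝓡 k) ∞ Γ] (H : IsTubeEnd g ι τ M h α S T s₀ bd c)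
    {p : M} (hp : (p : N) ∈ τ.source) :
    HasMFDerivAt (𝓡∂ m) (𝓘(ℝ, ℝ).prod (𝓘(ℝ, EuclideanSpace ℝ (Fin ℓ)).prod (𝓡 k)))
      (fun p' : M => canonicalRep τ p') p
      (mfderiv (𝓡∂ m) (𝓘(ℝ, ℝ).prod (𝓘(ℝ, EuclideanSpace ℝ (Fin ℓ)).prod (𝓡 k)))
        (fun p' : M => canonicalRep τ p') p) := by
  refine MDifferentiableAt.hasMFDerivAt (ContMDiffAt.mdifferentiableAt (n := ∞) ?_ (by simp))
  have hx : (τ p).1 ≠ 0 := (H.mem_opens_iff hp).1 p.2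
  have h1 : ContMDiffAt (𝓡∂ m) (𝓘(ℝ, EuclideanSpace ℝ (Fin ℓ)).prod (𝓡 k)) ∞
      (fun p' : M => τ p') p :=
    ((H.tubular.smooth p hp).contMDiffAt (H.tubular.open_source.mem_nhds hp)).comp p
      contMDiff_subtype_val.contMDiffAt
  have h2 : ContDiffAt ℝ ∞ (fun x : EuclideanSpace ℝ (Fin ℓ) => ‖x‖) (τ p).1 :=
    contDiffAt_id.norm ℝ hx
  have h3 : ContDiffAt ℝ ∞ (fun x : EuclideanSpace ℝ (Fin ℓ) => ‖x‖⁻¹ • x) (τ p).1 :=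
    (h2.inv (norm_ne_zero_iff.2 hx)).smul contDiffAt_id
  exact (h2.contMDiffAt.comp p h1.fst).prodMk
    ((h3.contMDiffAt.comp p h1.fst).prodMk h1.snd)

/-- The tangent vector with the coordinates `ξ`, transported by the canonical representation: the
radius `t = T s` depends on the height only, and the sphere and `Γ` components on the other
coordinates only. -/
theorem mfderiv_canonicalRep [IsManifold (𝓡 k) ∞ Γ] (H : IsTubeEnd g ι τ M h α S T s₀ bd c)
    {a : A} {z : EuclideanSpace ℝ (Fin m)}
    (hz : z ∈ endBox (J (.inl (c a).axis)) (c a).half s₀) (ξ : EuclideanSpace ℝ (Fin m)) :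
    mfderiv (𝓡∂ m) (𝓘(ℝ, ℝ).prod (𝓘(ℝ, EuclideanSpace ℝ (Fin ℓ)).prod (𝓡 k)))
        (fun p' : M => canonicalRep τ p') ((tubeChart J hJ hP hs₀ τ M (c a)).symm z)
        (mfderivWithin 𝓘(ℝ, EuclideanSpace ℝ (Fin m)) (𝓡∂ m)
          (tubeChart J hJ hP hs₀ τ M (c a)).symm (tubeChart J hJ hP hs₀ τ M (c a)).target z ξ)
      = (T' (z (J (.inl (c a).axis))) * ξ (J (.inl (c a).axis)), crossDeriv J s₀ (c a) z ξ) := by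
  have hΦ := H.isSmoothChart_tubeChart (hJ := hJ) (hP := hP) (hs₀ := hs₀) a
  have hz' : z ∈ (tubeChart J hJ hP hs₀ τ M (c a)).target := by rwa [H.tubeChart_target]
  have h1 := (H.hasMFDerivAt_canonicalRep (H.tubeChart_symm_mem_source
    (hJ := hJ) (hP := hP) (hs₀ := hs₀) hz)).comp_hasMFDerivWithinAt z
      (hΦ.hasMFDerivWithinAt_symm hz')
  have h2 : HasMFDerivWithinAt 𝓘(ℝ, EuclideanSpace ℝ (Fin m)) 𝓘(ℝ, ℝ)
      (fun y : EuclideanSpace ℝ (Fin m) => T (y (J (.inl (c a).axis))))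
      (tubeChart J hJ hP hs₀ τ M (c a)).target z
      (T' (z (J (.inl (c a).axis))) • (EuclideanSpace.proj (J (.inl (c a).axis)) :
        EuclideanSpace ℝ (Fin m) →L[ℝ] ℝ)) := by
    have := (hP.hasDerivAt_radius _ (hs₀.trans_lt hz.1)).comp_hasFDerivWithinAt
      (s := (tubeChart J hJ hP hs₀ τ M (c a)).target) z
      (EuclideanSpace.proj (𝕜 := ℝ) (J (.inl (c a).axis)) :
        EuclideanSpace ℝ (Fin m) →L[ℝ] ℝ).hasFDerivWithinAt
    exact this.hasMFDerivWithinAt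
  have h3 := hasMFDerivWithinAt_crossSection (J := J) (s₀ := s₀) (c a) hz
  rw [← H.tubeChart_target (hJ := hJ) (hP := hP) (hs₀ := hs₀)] at h3
  have h4 := (h2.prodMk h3).congr_of_eventuallyEq
    (f₁ := (fun p' : M => canonicalRep τ p') ∘ (tubeChart J hJ hP hs₀ τ M (c a)).symm)
    (Filter.eventuallyEq_of_mem self_mem_nhdsWithin fun y hy =>
      H.canonicalRep_tubeChart_symm (by rwa [← H.tubeChart_target (hJ := hJ) (hP := hP)
        (hs₀ := hs₀)])) (H.canonicalRep_tubeChart_symm hz)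
  have h5 := (hΦ.uniqueMDiffOn_target z hz').eq h1 h4
  exact congrArg (fun L => L ξ) h5

/-- The new metric in the charts of the tube is `ds² + e^(2 β s) (g_S + g_Γ)`. -/
theorem chartMetric_tubeChart [IsManifold (𝓡 k) ∞ Γ] (H : IsTubeEnd g ι τ M h α S T s₀ bd c)
    {a : A} {z : EuclideanSpace ℝ (Fin m)}
    (hz : z ∈ endBox (J (.inl (c a).axis)) (c a).half s₀) (ξ η : EuclideanSpace ℝ (Fin m)) :
    chartMetric h (tubeChart J hJ hP hs₀ τ M (c a)) z ξ η =
      ξ (J (.inl (c a).axis)) * η (J (.inl (c a).axis)) +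
      Real.exp (2 * β * z (J (.inl (c a).axis))) *
        (inner ℝ (crossDeriv J s₀ (c a) z ξ).1 (crossDeriv J s₀ (c a) z η).1 +
          inducedForm g ι (crossSection J (c a) z).2 (crossDeriv J s₀ (c a) z ξ).2
            (crossDeriv J s₀ (c a) z η).2) := by
  have hS : s₀ < S ‖(τ ((tubeChart J hJ hP hs₀ τ M (c a)).symm z)).1‖ := by
    rw [H.apply_tubeChart_symm hz, norm_polarChart_symm (c a) hz,
      hP.height_radius _ (hs₀.trans_lt hz.1)]
    exact hz.1
  rw [chartMetric, H.metric_eq _ (H.tubeChart_symm_mem_source hz) hS, pulledBackModelForm,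
    H.mfderiv_canonicalRep hz, H.mfderiv_canonicalRep hz, H.canonicalRep_tubeChart_symm hz]
  exact hP.modelForm_eq g ι (hs₀.trans_lt hz.1) _ _ _ _ _ _

theorem mem_endBox_of_mem_overlap (H : IsTubeEnd g ι τ M h α S T s₀ bd c) {a b : A}
    {z : EuclideanSpace ℝ (Fin m)} (hz : z ∈ overlap (tubeChart J hJ hP hs₀ τ M (c a))
      (tubeChart J hJ hP hs₀ τ M (c b))) :
    z ∈ endBox (J (.inl (c a).axis)) (c a).half s₀ := by
  rw [← H.tubeChart_target (hJ := hJ) (hP := hP) (hs₀ := hs₀)]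
  exact hz.1

theorem height_tubeChart (H : IsTubeEnd g ι τ M h α S T s₀ bd c) {a b : A}
    {z : EuclideanSpace ℝ (Fin m)} (hz : z ∈ overlap (tubeChart J hJ hP hs₀ τ M (c a))
      (tubeChart J hJ hP hs₀ τ M (c b))) :
    tubeChart J hJ hP hs₀ τ M (c b) ((tubeChart J hJ hP hs₀ τ M (c a)).symm z)
      (J (.inl (c b).axis)) = z (J (.inl (c a).axis)) := by
  have hz' := H.mem_endBox_of_mem_overlap hz
  rw [tubeChart_apply, polarChart_apply_axis, H.apply_tubeChart_symm hz',
    norm_polarChart_symm (c a) hz', hP.height_radius _ (hs₀.trans_lt hz'.1)]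

theorem translate_mem_tubeChart (H : IsTubeEnd g ι τ M h α S T s₀ bd c) {a b : A}
    {z : EuclideanSpace ℝ (Fin m)} (hz : z ∈ overlap (tubeChart J hJ hP hs₀ τ M (c a))
      (tubeChart J hJ hP hs₀ τ M (c b))) {s : ℝ} (hs : s₀ < s) :
    setCoord (J (.inl (c a).axis)) s z ∈ overlap (tubeChart J hJ hP hs₀ τ M (c a))
      (tubeChart J hJ hP hs₀ τ M (c b)) := by
  have hz' := H.mem_endBox_of_mem_overlap hz
  have hz'' := setCoord_mem_endBox (half_ne_zero hJ (c a)) hz' hs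
  have h1 : τ ((tubeChart J hJ hP hs₀ τ M (c a)).symm z) ∈
      (polarChart J hJ hP hs₀ (c b)).source := hz.2.2
  have h2 : τ ((tubeChart J hJ hP hs₀ τ M (c a)).symm (setCoord (J (.inl (c a).axis)) s z)) ∈
      (polarChart J hJ hP hs₀ (c b)).source := by
    have hn := norm_polarChart_symm (hJ := hJ) (hP := hP) (hs₀ := hs₀) (c a) hz''
    rw [H.apply_tubeChart_symm hz'] at h1
    rw [H.apply_tubeChart_symm hz'']
    rw [polarChart_symm_setCoord hz'] at hn ⊢
    have hT := hP.radius_pos _ (hs₀.trans_lt hz'.1)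
    have hT' := hP.radius_pos _ (hs₀.trans_lt hs)
    refine smul_mem_polarChart_source (mul_pos hT' (inv_pos.2 hT)) h1 ?_
    rw [hn, setCoord_same, hP.height_radius _ (hs₀.trans_lt hs)]
    exact hs
  exact ⟨by rwa [H.tubeChart_target], H.tubeChart_symm_mem_source hz'', h2⟩

theorem translate_tubeChart (H : IsTubeEnd g ι τ M h α S T s₀ bd c) {a b : A}
    {z : EuclideanSpace ℝ (Fin m)} (hz : z ∈ overlap (tubeChart J hJ hP hs₀ τ M (c a))
      (tubeChart J hJ hP hs₀ τ M (c b))) {s : ℝ} (hs : s₀ < s) :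
    tubeChart J hJ hP hs₀ τ M (c b) ((tubeChart J hJ hP hs₀ τ M (c a)).symm
      (setCoord (J (.inl (c a).axis)) s z)) = setCoord (J (.inl (c b).axis)) s
        (tubeChart J hJ hP hs₀ τ M (c b) ((tubeChart J hJ hP hs₀ τ M (c a)).symm z)) := by
  have hz' := H.mem_endBox_of_mem_overlap hz
  have hz'' := setCoord_mem_endBox (half_ne_zero hJ (c a)) hz' hs
  have hn := norm_polarChart_symm (hJ := hJ) (hP := hP) (hs₀ := hs₀) (c a) hz''
  rw [tubeChart_apply, tubeChart_apply, H.apply_tubeChart_symm hz', H.apply_tubeChart_symm hz'']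
  rw [polarChart_symm_setCoord hz'] at hn ⊢
  have hT := hP.radius_pos _ (hs₀.trans_lt hz'.1)
  have hT' := hP.radius_pos _ (hs₀.trans_lt hs)
  rw [polarChart_smul (by positivity), hn, setCoord_same, hP.height_radius _ (hs₀.trans_lt hs)]

theorem chartMetric_tubeChart_translate [IsManifold (𝓡 k) ∞ Γ]
    (H : IsTubeEnd g ι τ M h α S T s₀ bd c) {a : A} {z : EuclideanSpace ℝ (Fin m)}
    (hz : z ∈ endBox (J (.inl (c a).axis)) (c a).half s₀) {s : ℝ} (hs : s₀ < s)
    (ξ η : EuclideanSpace ℝ (Fin m)) :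
    chartMetric h (tubeChart J hJ hP hs₀ τ M (c a)) z ξ η =
      ξ (J (.inl (c a).axis)) * η (J (.inl (c a).axis)) +
      Real.exp (2 * β * (z (J (.inl (c a).axis)) - s)) *
        chartMetric h (tubeChart J hJ hP hs₀ τ M (c a)) (setCoord (J (.inl (c a).axis)) s z)
          (diagCLM (killCoord (J (.inl (c a).axis))) ξ)
          (diagCLM (killCoord (J (.inl (c a).axis))) η) := by
  have hz'' := setCoord_mem_endBox (half_ne_zero hJ (c a)) hz hs
  rw [H.chartMetric_tubeChart hz, H.chartMetric_tubeChart hz'', ← crossDeriv_eq hJ (c a) hz hs,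
    ← crossDeriv_eq hJ (c a) hz hs, crossSection_setCoord]
  have e : ∀ ζ : EuclideanSpace ℝ (Fin m), diagCLM (killCoord (J (.inl (c a).axis))) ζ
      (J (.inl (c a).axis)) = 0 := fun ζ => by simp [killCoord]
  rw [e, e, setCoord_same, mul_zero, zero_add, ← mul_assoc, ← Real.exp_add, mul_sub,
    sub_add_cancel]

/-- The punctured tube, with the model metric, is a cylindrical end. -/
theorem isCylindricalEnd [IsManifold (𝓡 k) ∞ Γ] (H : IsTubeEnd g ι τ M h α S T s₀ bd c)
    (hJ : J (.inl 0) = 0) (hP : IsEndProfile α β S T T') (hs₀ : 0 ≤ s₀) :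
    IsCylindricalEnd h (fun a => tubeChart J hJ hP hs₀ τ M (c a))
      (fun a => J (.inl (c a).axis)) (fun a => (c a).half) s₀ β where
  smooth a := H.isSmoothChart_tubeChart a
  target a := H.tubeChart_target a
  half_ne a := half_ne_zero hJ (c a)
  base_nonneg := hs₀
  rate_nonneg := hP.rate_nonneg
  height_eq _ _ _ hz := H.height_tubeChart hz
  translate_mem _ _ _ hz _ hs := H.translate_mem_tubeChart hz hs
  translate_eq _ _ _ hz _ hs := H.translate_tubeChart hz hs
  metric_eq _ _ hz _ hs ξ η := H.chartMetric_tubeChart_translate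
    (by rwa [← H.tubeChart_target (hJ := hJ) (hP := hP) (hs₀ := hs₀)]) hs ξ η

end IsTubeEnd

end TubeEnd

/-! ### Coverings of the tube -/

section Covering

variable {m k ℓ : ℕ} [NeZero m] [NeZero ℓ]
  {N : Type*} [TopologicalSpace N] [ChartedSpace (EuclideanHalfSpace m) N]
  {Γ : Type*} [TopologicalSpace Γ] [ChartedSpace (EuclideanSpace ℝ (Fin k)) Γ]

/-- Charts of `Γ` around a point, rescaled so that they have values in `(-3, 3)ᵏ`. -/
theorem exists_cube_chart [IsManifold (𝓡 k) ∞ Γ] (q₀ : Γ) :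
    ∃ χ : PartialEquiv Γ (EuclideanSpace ℝ (Fin k)), IsOpen χ.source ∧
      ContMDiffOn (𝓡 k) (𝓡 k) ∞ χ χ.source ∧ ContMDiffOn (𝓡 k) (𝓡 k) ∞ χ.symm χ.target ∧
      χ.target = {w | ∀ i, |w i| < 3} ∧ q₀ ∈ χ.source ∧ χ q₀ = 0 := by
  set e := extChartAt (𝓡 k) q₀ with he
  obtain ⟨ε, hε, hεt⟩ := Metric.isOpen_iff.1 (isOpen_extChartAt_target (I := 𝓡 k) q₀) (e q₀)
    (mem_extChartAt_target q₀)
  set ρ := ε / (√k * 3 + 1) with hρ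
  have hρ0 : 0 < ρ := by positivity
  have hmem : ∀ w : EuclideanSpace ℝ (Fin k), (∀ i, |w i| < 3) → e q₀ + ρ • w ∈ e.target := by
    intro w hw
    refine hεt ?_
    have h1 := norm_le_of_forall_abs_le (by norm_num : (0 : ℝ) ≤ 3) fun i => (hw i).le
    rw [Metric.mem_ball, dist_eq_norm, add_sub_cancel_left, norm_smul, Real.norm_of_nonneg hρ0.le,
      hρ, div_mul_eq_mul_div, div_lt_iff₀ (by positivity)]
    nlinarith
  have hT : IsOpen {w : EuclideanSpace ℝ (Fin k) | ∀ i, |w i| < 3} := by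
    simp only [ofPred_forall]
    exact isOpen_iInter_of_finite fun i => isOpen_lt (by fun_prop) continuous_const
  refine ⟨{ toFun := fun q => ρ⁻¹ • (e q - e q₀)
            invFun := fun w => e.symm (e q₀ + ρ • w)
            source := e.source ∩ {q | ∀ i, |(ρ⁻¹ • (e q - e q₀)) i| < 3}
            target := {w | ∀ i, |w i| < 3}
            map_source' := fun q hq => hq.2
            map_target' := fun w hw => ⟨e.map_target (hmem w hw), ?_⟩
            left_inv' := fun q hq => ?_
            right_inv' := fun w hw => ?_ }, ?_, ?_, ?_, rfl, ⟨mem_extChartAt_source q₀, ?_⟩, ?_⟩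
  · simp only [mem_ofPred_eq]
    rw [e.right_inv (hmem w hw), add_sub_cancel_left, smul_smul, inv_mul_cancel₀ hρ0.ne', one_smul]
    exact hw
  · rw [smul_smul, mul_inv_cancel₀ hρ0.ne', one_smul, add_sub_cancel, e.left_inv hq.1]
  · rw [e.right_inv (hmem w hw), add_sub_cancel_left, smul_smul, inv_mul_cancel₀ hρ0.ne', one_smul]
  · have hc₀ : ContinuousOn e e.source := continuousOn_extChartAt q₀
    have hc : ContinuousOn (fun q => ρ⁻¹ • (e q - e q₀)) e.source :=
      (hc₀.sub continuousOn_const).const_smul ρ⁻¹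
    exact hc.isOpen_inter_preimage (isOpen_extChartAt_source q₀) hT
  · have h1 : ContMDiffOn (𝓡 k) (𝓡 k) ∞ e e.source := by
      rw [he, extChartAt_source]
      exact contMDiffOn_extChartAt
    have h2 : ContDiff ℝ ∞ fun x : EuclideanSpace ℝ (Fin k) => ρ⁻¹ • (x - e q₀) := by fun_prop
    exact h2.contMDiff.comp_contMDiffOn (h1.mono inter_subset_left)
  · have h2 : ContDiff ℝ ∞ fun x : EuclideanSpace ℝ (Fin k) => e q₀ + ρ • x := by fun_prop
    exact (contMDiffOn_extChartAt_symm q₀).comp h2.contMDiff.contMDiffOn hmem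
  · simp
  · simp

theorem exists_finite_cube_charts [CompactSpace Γ] [IsManifold (𝓡 k) ∞ Γ] :
    ∃ (n : ℕ) (χ : Fin n → PartialEquiv Γ (EuclideanSpace ℝ (Fin k))),
      (∀ b, IsOpen (χ b).source ∧ ContMDiffOn (𝓡 k) (𝓡 k) ∞ (χ b) (χ b).source ∧
        ContMDiffOn (𝓡 k) (𝓡 k) ∞ (χ b).symm (χ b).target ∧
        (χ b).target = {w | ∀ i, |w i| < 3}) ∧
      ∀ q, ∃ b, q ∈ (χ b).source ∧ ∀ i, |χ b q i| ≤ 1 := by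
  choose χ h1 h2 h3 h4 h5 h6 using exists_cube_chart (k := k) (Γ := Γ)
  have hT : IsOpen {w : EuclideanSpace ℝ (Fin k) | ∀ i, |w i| < 1} := by
    simp only [ofPred_forall]
    exact isOpen_iInter_of_finite fun i => isOpen_lt (by fun_prop) continuous_const
  obtain ⟨t, ht⟩ := isCompact_univ.elim_finite_subcover
    (fun q => (χ q).source ∩ χ q ⁻¹' {w | ∀ i, |w i| < 1})
    (fun q => (h2 q).continuousOn.isOpen_inter_preimage (h1 q) hT)
    fun q _ => mem_iUnion.2 ⟨q, h5 q, by simp [h6]⟩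
  refine ⟨t.card, fun b => χ (t.equivFin.symm b), fun b => ⟨h1 _, h2 _, h3 _, h4 _⟩, fun q => ?_⟩
  obtain ⟨p, hp, hp'⟩ := mem_iUnion₂.1 (ht (mem_univ q))
  refine ⟨t.equivFin ⟨p, hp⟩, ?_⟩
  simp only [Equiv.symm_apply_apply]
  exact ⟨hp'.1, fun i => (hp'.2 i).le⟩

/-- Every nonzero vector lies in one of the cones over which the central projections take values
in the unit cube. -/
theorem exists_axis {x : EuclideanSpace ℝ (Fin ℓ)} (hx : x ≠ 0) :
    ∃ j σ, 0 < sgn σ * x j ∧ ∀ i, |x i| ≤ sgn σ * x j := by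
  obtain ⟨j, -, hj⟩ := Finset.exists_max_image Finset.univ (fun i => |x i|) ⟨0, Finset.mem_univ 0⟩
  have hj0 : x j ≠ 0 := fun h0 => hx <| by
    ext i
    have := hj i (Finset.mem_univ i)
    rw [h0, abs_zero] at this
    simpa using abs_nonpos_iff.1 this
  rcases lt_or_gt_of_ne hj0 with h | h
  · refine ⟨j, false, by simpa [sgn] using h, fun i => ?_⟩
    have := hj i (Finset.mem_univ i)
    simpa [sgn, abs_of_neg h] using this
  · refine ⟨j, true, by simpa [sgn] using h, fun i => ?_⟩
    have := hj i (Finset.mem_univ i)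
    simpa [sgn, abs_of_pos h] using this

/-- The points of the tube for which the coordinate on the `axis` dominates have coordinates in the
core of the chart. -/
theorem polarChart_core {α β s₀ s : ℝ} {S T T' : ℝ → ℝ} {J : Fin ℓ ⊕ Fin k ≃ Fin m}
    {hJ : J (.inl 0) = 0} {hP : IsEndProfile α β S T T'} {hs₀ : 0 ≤ s₀} {c : PolarCell k ℓ Γ}
    {u : EuclideanSpace ℝ (Fin ℓ) × Γ} (h0 : 0 < sgn c.sign * u.1 c.axis)
    (h1 : ∀ i, |u.1 i| ≤ sgn c.sign * u.1 c.axis) (hs : s₀ < s) (hS : s ≤ S ‖u.1‖)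
    (hh : c.half → 0 ≤ u.1 0) (hq : u.2 ∈ c.chart.source) (hq' : ∀ i, |c.chart u.2 i| ≤ 1) :
    u ∈ (polarChart J hJ hP hs₀ c).source ∧
      s ≤ polarChart J hJ hP hs₀ c u (J (.inl c.axis)) ∧
      ∀ l ≠ J (.inl c.axis), |polarChart J hJ hP hs₀ c u l| ≤ 1 := by
  refine ⟨⟨h0, fun i _ => (h1 i).trans_lt (by linarith), hs.trans_le hS, hh, hq⟩, ?_,
    fun l hl => ?_⟩
  · rw [IsTubeEnd.polarChart_apply_axis]
    exact hS
  · obtain ⟨i | i, rfl⟩ := J.surjective l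
    · have hi : i ≠ c.axis := fun h => hl (by rw [h])
      have e : polarChart J hJ hP hs₀ c u (J (.inl i)) = (sgn c.sign * u.1 c.axis)⁻¹ * u.1 i := by
        simp [polarChart, setCoord_of_ne hi, centralProj]
      rw [e, abs_mul, abs_of_pos (inv_pos.2 h0), inv_mul_le_iff₀ h0, mul_one]
      exact h1 i
    · have e : polarChart J hJ hP hs₀ c u (J (.inr i)) = c.chart u.2 i := by
        simp [polarChart]
      rw [e]
      exact hq' i

/-- A neighbourhood of `Γ` contains a tube of positive radius around `Γ`. -/
theorem IsTubularDiffeo.exists_radius [IsManifold (𝓡∂ m) ∞ N] [CompactSpace Γ]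
    {g : SmoothMetric m N} {ι : Γ → N} {τ : PartialEquiv N (EuclideanSpace ℝ (Fin ℓ) × Γ)}
    (hτ : IsTubularDiffeo (k := k) g ι τ) {O : Set N} (hO : IsOpen O) (hιO : range ι ⊆ O) :
    ∃ ρ, 0 < ρ ∧ ρ ≤ 1 ∧ ∀ p ∈ τ.source, ‖(τ p).1‖ < ρ → p ∈ O := by
  obtain ⟨W, hW, hW'⟩ := continuousOn_iff'.1 hτ.smooth_symm.continuousOn O hO
  have h0 : ({0} : Set (EuclideanSpace ℝ (Fin ℓ))) ×ˢ (univ : Set Γ) ⊆ W := by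
    rintro ⟨x, q⟩ ⟨hx, -⟩
    obtain rfl : x = 0 := hx
    have h1 : ((0 : EuclideanSpace ℝ (Fin ℓ)), q) ∈ τ.symm ⁻¹' O ∩ τ.target := by
      rw [← hτ.map_submanifold q]
      refine ⟨?_, τ.map_source (hτ.mem_source q)⟩
      rw [mem_preimage, τ.left_inv (hτ.mem_source q)]
      exact hιO (mem_range_self q)
    rw [hW'] at h1
    exact h1.1
  obtain ⟨u, v, hu, -, h0u, huv, huW⟩ := generalized_tube_lemma isCompact_singleton
    isCompact_univ hW h0
  obtain ⟨ε, hε, hεu⟩ := Metric.isOpen_iff.1 hu 0 (h0u rfl)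
  refine ⟨min ε 1, by positivity, min_le_right _ _, fun p hp hpε => ?_⟩
  have h2 : τ p ∈ W ∩ τ.target :=
    ⟨huW ⟨hεu (by simpa using hpε.trans_le (min_le_left _ _)), huv (mem_univ _)⟩, τ.map_source hp⟩
  rw [← hW'] at h2
  simpa [τ.left_inv hp] using h2.1

end Covering

/-! ### The metric on an open submanifold -/

section Restriction

variable {m : ℕ} [NeZero m] {N : Type*} [TopologicalSpace N]
  [ChartedSpace (EuclideanHalfSpace m) N] {M : TopologicalSpace.Opens N} [Nonempty M]
  {κ : PartialEquiv N (EuclideanSpace ℝ (Fin m))}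

theorem restrictOpens_target (hsub : κ.source ⊆ M) :
    (restrictOpens M κ).target = κ.target :=
  Subset.antisymm (fun _ hx => hx.1) fun _ hx => ⟨hx, hsub (κ.map_target hx)⟩

variable [IsManifold (𝓡∂ m) ∞ N]

theorem IsNormalizedChart.restrictOpens (h : IsNormalizedChart κ) (hsub : κ.source ⊆ M) :
    IsNormalizedChart (restrictOpens M κ) := by
  rcases h.target_cases with ht | ht
  · exact h.isSmoothChart.restrictOpens.isNormalizedChart_of_openCube
      ((restrictOpens_target hsub).trans ht)
  · exact h.isSmoothChart.restrictOpens.isNormalizedChart_of_halfCube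
      ((restrictOpens_target hsub).trans ht)

theorem IsSmoothChart.chartMetric_restrictOpens (hκ : IsSmoothChart κ) (hsub : κ.source ⊆ M)
    {g : SmoothMetric m N} {h : SmoothMetric m M} {x : EuclideanSpace ℝ (Fin m)}
    (hx : x ∈ κ.target)
    (hgh : ∀ p : M, (p : N) ∈ κ.source → ∀ v w : TangentSpace (𝓡∂ m) p,
      h.inner p v w = restrictedForm g M p v w) (ξ η : EuclideanSpace ℝ (Fin m)) :
    chartMetric h (_root_.restrictOpens M κ) x ξ η = chartMetric g κ x ξ η := by
  have hκ' := hκ.restrictOpens (M := M)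
  have ht := restrictOpens_target hsub
  have hx' : x ∈ (_root_.restrictOpens M κ).target := by rwa [ht]
  have hv : ((_root_.restrictOpens M κ).symm x : N) = κ.symm x := restrictOpens_symm_apply hx'
  have h1 : HasMFDerivAt (𝓡∂ m) (𝓡∂ m) (Subtype.val : M → N) ((_root_.restrictOpens M κ).symm x)
      (mfderiv (𝓡∂ m) (𝓡∂ m) (Subtype.val : M → N) ((_root_.restrictOpens M κ).symm x)) :=
    ((contMDiff_subtype_val (n := ∞)).contMDiffAt.mdifferentiableAt (by simp)).hasMFDerivAt
  have h2 := h1.comp_hasMFDerivWithinAt x (hκ'.hasMFDerivWithinAt_symm hx')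
  have h3 := (hκ.hasMFDerivWithinAt_symm hx).congr_of_eventuallyEq
    (f₁ := Subtype.val ∘ (_root_.restrictOpens M κ).symm)
    (Filter.eventuallyEq_of_mem self_mem_nhdsWithin fun y hy =>
      restrictOpens_symm_apply (by rwa [ht])) hv
  rw [← ht] at h3
  have h4 := (hκ'.uniqueMDiffOn_target x hx').eq h2 h3
  rw [chartMetric, hgh _ (by rw [hv]; exact κ.map_target hx), restrictedForm, chartMetric]
  refine metric_inner_congr g hv ?_ ?_
  · rw [ht] at h4 ⊢; exact congrArg (fun L => L ξ) h4
  · rw [ht] at h4 ⊢; exact congrArg (fun L => L η) h4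

theorem IsUniformlyRegularMetric.restrictOpens {g : SmoothMetric m N} {h : SmoothMetric m M}
    {K : Set (PartialEquiv N (EuclideanSpace ℝ (Fin m)))} (hg : IsUniformlyRegularMetric g K)
    (hK : ∀ κ ∈ K, IsSmoothChart κ) (hsub : ∀ κ ∈ K, κ.source ⊆ M)
    (hgh : ∀ κ ∈ K, ∀ p : M, (p : N) ∈ κ.source → ∀ v w : TangentSpace (𝓡∂ m) p,
      h.inner p v w = restrictedForm g M p v w) :
    IsUniformlyRegularMetric h (_root_.restrictOpens M '' K) where
  equiv_euclidean := by
    obtain ⟨c, hc1, hc⟩ := hg.equiv_euclidean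
    refine ⟨c, hc1, ?_⟩
    rintro _ ⟨κ, hκ, rfl⟩ x hx ξ
    rw [restrictOpens_target (hsub κ hκ)] at hx
    rw [(hK κ hκ).chartMetric_restrictOpens (hsub κ hκ) hx (hgh κ hκ)]
    exact hc κ hκ x hx ξ
  coeff_bounds j := by
    obtain ⟨c, hc⟩ := hg.coeff_bounds j
    refine ⟨c, ?_⟩
    rintro _ ⟨κ, hκ, rfl⟩ a b x hx
    rw [restrictOpens_target (hsub κ hκ)] at hx ⊢
    rw [iteratedFDerivWithin_congr (fun y hy =>
      (hK κ hκ).chartMetric_restrictOpens (hsub κ hκ) hy (hgh κ hκ) _ _) hx]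
    exact hc κ hκ a b x hx

end Restriction

/-! ### The complement of the submanifold -/

/-- The case in which the submanifold is the whole manifold has to be treated apart, since
restricting a chart to an open submanifold uses a default point. -/
theorem isUniformlyRegular_of_isEmpty {m : ℕ} [NeZero m] {N : Type*} [TopologicalSpace N]
    [ChartedSpace (EuclideanHalfSpace m) N] [IsManifold (𝓡∂ m) ∞ N] [IsEmpty N]
    (g : SmoothMetric m N) : IsUniformlyRegular g :=
  ⟨∅, ⟨by simp, ⟨1 / 2, by norm_num, fun p => isEmptyElim p⟩, ⟨0, fun p => isEmptyElim p⟩,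
    by simp⟩, ⟨1, le_rfl, by simp⟩, by simp⟩

theorem IsUniformlyRegularMetric.mono {m : ℕ} [NeZero m] {N : Type*} [TopologicalSpace N]
    [ChartedSpace (EuclideanHalfSpace m) N] [IsManifold (𝓡∂ m) ∞ N] {g : SmoothMetric m N}
    {K K' : Set (PartialEquiv N (EuclideanSpace ℝ (Fin m)))} (h : IsUniformlyRegularMetric g K)
    (hK : K' ⊆ K) : IsUniformlyRegularMetric g K' :=
  ⟨h.equiv_euclidean.imp fun _ hc => ⟨hc.1, fun κ hκ => hc.2 κ (hK hκ)⟩,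
    fun j => (h.coeff_bounds j).imp fun _ hc κ hκ => hc κ (hK hκ)⟩

section Complement

variable {m k ℓ : ℕ} [NeZero m] [NeZero ℓ]
  {N : Type*} [TopologicalSpace N] [T2Space N] [ChartedSpace (EuclideanHalfSpace m) N]
  [IsManifold (𝓡∂ m) ∞ N]
  {Γ : Type*} [TopologicalSpace Γ] [CompactSpace Γ] [ChartedSpace (EuclideanSpace ℝ (Fin k)) Γ]

/-- The index set of the charts of the end: an axis, a sign and a chart of `Γ`, where the sign of
the first axis is positive if `Γ` lies in the boundary. -/
abbrev EndIndex (ℓ : ℕ) [NeZero ℓ] (bd : Prop) (n : ℕ) : Type :=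
  {a : (Fin ℓ × Bool) × Fin n // bd → a.1.1 = 0 → a.1.2 = true}

namespace IsTubularDiffeo

variable {g : SmoothMetric m N} {ι : Γ → N} {τ : PartialEquiv N (EuclideanSpace ℝ (Fin ℓ) × Γ)}

/-- The image of a smaller closed ball bundle is compact, hence closed in the ambient manifold. -/
theorem isCompact_closedTube (hτ : IsTubularDiffeo (k := k) g ι τ) {bd : Prop}
    (hmem : ∀ x q, (x, q) ∈ τ.target ↔ ‖x‖ < 1 ∧ (bd → 0 ≤ x 0)) {ε : ℝ} (hε : ε < 1) :
    IsCompact (τ.source ∩ τ ⁻¹' {u | ‖u.1‖ ≤ ε}) := by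
  have h1 : IsCompact ((Metric.closedBall (0 : EuclideanSpace ℝ (Fin ℓ)) ε ∩
      ⋂ (_ : bd), halfSpaceSet ℓ) ×ˢ (univ : Set Γ)) :=
    ((isCompact_closedBall _ _).inter_right
      (isClosed_iInter fun _ => isClosed_halfSpaceSet)).prod isCompact_univ
  have h2 : (Metric.closedBall (0 : EuclideanSpace ℝ (Fin ℓ)) ε ∩
      ⋂ (_ : bd), halfSpaceSet ℓ) ×ˢ (univ : Set Γ) = τ.target ∩ {u | ‖u.1‖ ≤ ε} := by
    ext ⟨x, q⟩
    simp only [mem_prod, mem_inter_iff, mem_closedBall_zero_iff, mem_iInter, mem_univ, and_true,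
      hmem, mem_ofPred_eq, halfSpaceSet]
    exact ⟨fun h => ⟨⟨h.1.trans_lt hε, h.2⟩, h.1⟩, fun h => ⟨h.2, h.1.2⟩⟩
  have h3 : τ.source ∩ τ ⁻¹' {u | ‖u.1‖ ≤ ε} = τ.symm '' (τ.target ∩ {u | ‖u.1‖ ≤ ε}) :=
    (τ.symm_image_target_inter_eq' _).symm
  rw [h3, ← h2]
  exact h1.image_of_continuousOn (hτ.smooth_symm.continuousOn.mono
    (by rw [h2]; exact inter_subset_left))

/-- The two cases for the position of the submanifold in a single formula. -/
theorem mem_target_iff_of_cases [Nonempty Γ] (hτ : IsTubularDiffeo (k := k) g ι τ)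
    (hbd : (range ι ∩ (𝓡∂ m).boundary N).Nonempty → range ι ⊆ (𝓡∂ m).boundary N)
    (x : EuclideanSpace ℝ (Fin ℓ)) (q : Γ) :
    (x, q) ∈ τ.target ↔ ‖x‖ < 1 ∧ (range ι ⊆ (𝓡∂ m).boundary N → 0 ≤ x 0) := by
  by_cases hb : range ι ⊆ (𝓡∂ m).boundary N
  · rw [hτ.target_of_boundary hb]
    simp [hb, halfSpaceSet]
  · have hi : range ι ⊆ (𝓡∂ m).interior N := fun p hp => by
      by_contra h
      exact hb (hbd ⟨p, hp, mem_boundary_iff_notMem_interior.2 h⟩)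
    rw [hτ.target_of_interior hi]
    simp [hb]

/-- Away from `Γ`, the heights of the points of the tube are locally bounded. -/
theorem exists_nhds_height_le (hτ : IsTubularDiffeo (k := k) g ι τ) {bd : Prop}
    (hmem : ∀ x q, (x, q) ∈ τ.target ↔ ‖x‖ < 1 ∧ (bd → 0 ≤ x 0)) {S : ℝ → ℝ}
    (hS : ∀ t t', 0 < t → t ≤ t' → S t' ≤ S t) {p : N} (hp : p ∉ range ι) :
    ∃ V ∈ 𝓝 p, ∃ R : ℝ, ∀ q ∈ V, q ∈ τ.source → S ‖(τ q).1‖ ≤ R := by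
  obtain ⟨ε, hε0, hε1, hpε⟩ : ∃ ε : ℝ, 0 < ε ∧ ε < 1 ∧ p ∉ τ.source ∩ τ ⁻¹' {u | ‖u.1‖ ≤ ε} := by
    by_cases hps : p ∈ τ.source
    · have hx : 0 < ‖(τ p).1‖ := norm_pos_iff.2 fun h0 => hp ⟨(τ p).2,
        τ.injOn (hτ.mem_source _) hps (by rw [hτ.map_submanifold]; exact Prod.ext h0.symm rfl)⟩
      have hx1 : ‖(τ p).1‖ < 1 := ((hmem _ _).1 (τ.map_source hps)).1
      refine ⟨‖(τ p).1‖ / 2, by positivity, by linarith, fun h => ?_⟩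
      have : ‖(τ p).1‖ ≤ ‖(τ p).1‖ / 2 := h.2
      linarith
    · exact ⟨1 / 2, by norm_num, by norm_num, fun h => hps h.1⟩
  refine ⟨_, (hτ.isCompact_closedTube hmem hε1).isClosed.isOpen_compl.mem_nhds hpε, S ε,
    fun q hq hqs => hS _ _ hε0 ?_⟩
  by_contra h
  exact hq ⟨hqs, (not_le.1 h).le⟩

end IsTubularDiffeo

/-- The end of `N \ Γ` described by finitely many charts of the tube. -/
theorem exists_isTubeEnd [IsManifold (𝓡 k) ∞ Γ] [Nonempty Γ]
    {g : SmoothMetric m N} {ι : Γ → N} {τ : PartialEquiv N (EuclideanSpace ℝ (Fin ℓ) × Γ)}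
    (hτ : IsTubularDiffeo (k := k) g ι τ)
    {bd : Prop} (hmem : ∀ x q, (x, q) ∈ τ.target ↔ ‖x‖ < 1 ∧ (bd → 0 ≤ x 0))
    {M : TopologicalSpace.Opens N} (hM : (M : Set N) = (range ι)ᶜ)
    {α β : ℝ} {S T T' : ℝ → ℝ} (hP : IsEndProfile α β S T T') {h : SmoothMetric m M}
    (h_near : ∃ O : Set N, IsOpen O ∧ range ι ⊆ O ∧ O ⊆ τ.source ∧
      ∀ p : M, (p : N) ∈ O → ∀ v w : TangentSpace (𝓡∂ m) p,
        h.inner p v w = pulledBackModelForm (k := k) g ι τ α M p v w) :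
    ∃ s₀ : ℝ, 0 ≤ s₀ ∧ ∃ (n : ℕ) (c : EndIndex ℓ bd n → PolarCell k ℓ Γ),
      IsTubeEnd g ι τ M h α S T s₀ bd c ∧
      ∀ (x : EuclideanSpace ℝ (Fin ℓ)) (q : Γ), x ≠ 0 → (x, q) ∈ τ.target →
        ∃ a, 0 < sgn (c a).sign * x (c a).axis ∧ (∀ i, |x i| ≤ sgn (c a).sign * x (c a).axis) ∧
          q ∈ (c a).chart.source ∧ ∀ i, |(c a).chart q i| ≤ 1 := by
  obtain ⟨O, hO, hιO, -, hmetric⟩ := h_near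
  obtain ⟨ρ, hρ0, hρ1, hρ⟩ := hτ.exists_radius hO hιO
  obtain ⟨n, χ, hχ, hχc⟩ := exists_finite_cube_charts (k := k) (Γ := Γ)
  -- At the heights above `S ρ` the radius is less than `ρ`, where the new metric is known.
  refine ⟨max 0 (S ρ), le_max_left _ _, n, fun a =>
    { axis := a.1.1.1
      sign := a.1.1.2
      half := bd ∧ a.1.1.1 ≠ 0
      chart := χ a.1.2
      half_ne := fun hh => hh.2
      open_source := (hχ _).1
      smooth := (hχ _).2.1
      smooth_symm := (hχ _).2.2.1
      chart_target := (hχ _).2.2.2 }, ⟨hτ, hM, hmem, fun a => Iff.rfl, fun a => a.2,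
        fun s hs => ?_, fun p hp hs => hmetric p (hρ p hp ?_)⟩, fun x q hx hxq => ?_⟩
  · by_contra hT
    have h1 := hP.height_le ρ (T s) hρ0 (hρ1.trans (not_lt.1 hT))
    rw [hP.height_radius s ((le_max_left _ _).trans_lt hs)] at h1
    exact absurd hs (not_lt.2 (h1.trans (le_max_right _ _)))
  · by_contra hx
    exact absurd hs (not_lt.2 ((hP.height_le _ _ hρ0 (not_lt.1 hx)).trans (le_max_right _ _)))
  · obtain ⟨j, σ, h1, h2⟩ := exists_axis hx
    obtain ⟨b, hb, hb'⟩ := hχc q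
    refine ⟨⟨((j, σ), b), fun hbd hj => ?_⟩, h1, h2, hb, hb'⟩
    have h3 := ((hmem x q).1 hxq).2 hbd
    have hj' : j = 0 := hj
    subst hj'
    cases σ
    · simp only [sgn] at h1
      linarith
    · rfl

end Complement

theorem theorem1p9 {m k ℓ : ℕ} [NeZero m] [NeZero ℓ] (hdim : k + ℓ = m)
    -- the uniformly regular ambient Riemannian manifold
    {N : Type*} [TopologicalSpace N] [T2Space N] [SecondCountableTopology N]
    [ChartedSpace (EuclideanHalfSpace m) N] [IsManifold (𝓡∂ m) ∞ N]
    (g : SmoothMetric m N) (hg : IsUniformlyRegular g)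
    -- the compact connected submanifold without boundary, of codimension `ℓ ≥ 1`
    {Γ : Type*} [TopologicalSpace Γ] [CompactSpace Γ] [ConnectedSpace Γ]
    [ChartedSpace (EuclideanSpace ℝ (Fin k)) Γ] [IsManifold (𝓡 k) ∞ Γ]
    (ι : Γ → N) (hι : EmbedsSmoothly (m := m) (k := k) ι)
    (hbd : (range ι ∩ (𝓡∂ m).boundary N).Nonempty → range ι ⊆ (𝓡∂ m).boundary N)
    (α : ℝ) (hα : 0 < α)
    -- the manifold with the submanifold removed, and a tubular neighbourhood
    (M : TopologicalSpace.Opens N) (hM : (M : Set N) = (range ι)ᶜ)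
    (τ : PartialEquiv N (EuclideanSpace ℝ (Fin ℓ) × Γ)) (hτ : IsTubularDiffeo (k := k) g ι τ)
    -- the new metric
    (h : SmoothMetric m M)
    (h_away : ∀ p : M, (p : N) ∉ τ.source → ∀ v w : TangentSpace (𝓡∂ m) p,
      h.inner p v w = restrictedForm g M p v w)
    (h_near : ∃ O : Set N, IsOpen O ∧ range ι ⊆ O ∧ O ⊆ τ.source ∧
      ∀ p : M, (p : N) ∈ O → ∀ v w : TangentSpace (𝓡∂ m) p,
        h.inner p v w = pulledBackModelForm (k := k) g ι τ α M p v w) :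
    IsUniformlyRegular h := by
  rcases isEmpty_or_nonempty M with hemp | hne
  · exact isUniformlyRegular_of_isEmpty h
  obtain ⟨K, hK, hgK⟩ := hg
  have hmem := hτ.mem_target_iff_of_cases hbd
  obtain ⟨β, S, T, T', hP⟩ := exists_isEndProfile hα
  obtain ⟨s₀, hs₀, n, c, H, hcore⟩ := exists_isTubeEnd hτ hmem hM hP h_near
  -- The first `ℓ` coordinates of `ℝᵐ` are used for the directions normal to `Γ`.
  set J : Fin ℓ ⊕ Fin k ≃ Fin m := finSumFinEquiv.trans (finCongr (by omega)) with hJdef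
  have hJ : J (.inl 0) = 0 := by
    ext
    simp [hJdef]
  obtain ⟨r, hr, hcov⟩ := hK.shrinkable
  -- The tube is relatively compact, and so is the union of the charts which meet the tube.
  obtain ⟨C₁, hC₁, hC₁τ⟩ := hτ.exists_compact_source_subset hι.smooth.continuous
    (fun x q hxq => by
      obtain ⟨h1, h2⟩ := (hmem x q).1 hxq
      refine ⟨h1.le, fun t ht => (hmem _ _).2 ⟨?_, fun hb => mul_nonneg ht.1 (h2 hb)⟩⟩
      rw [norm_smul, Real.norm_of_nonneg ht.1]
      exact (mul_le_of_le_one_left (norm_nonneg _) ht.2).trans_lt h1) hK hgK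
  obtain ⟨C₂, hC₂, hC₂K⟩ := hK.exists_compact_source_subset hC₁
  -- In `V` the height exceeds `s₀ + 2`, so that `V \ Γ` is covered by the cells of the end.
  set V : Set N := τ.source ∩ τ ⁻¹' {u | ‖u.1‖ < T (s₀ + 2)} with hV
  have hT2 : 0 < T (s₀ + 2) := hP.radius_pos _ (by linarith)
  have hVo : IsOpen V := hτ.smooth.continuousOn.isOpen_inter_preimage hτ.open_source
    (isOpen_lt (by fun_prop) continuous_const)
  have hVι : range ι ⊆ V := by
    rintro _ ⟨q, rfl⟩
    refine ⟨hτ.mem_source q, ?_⟩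
    rw [mem_preimage, hτ.map_submanifold]
    simpa using hT2
  have hB : IsCompact ((↑) ⁻¹' (C₂ \ V) : Set M) := by
    refine (Topology.IsInducing.subtypeVal.isCompact_preimage_iff ?_).2 (hC₂.diff hVo)
    rintro p ⟨-, hp⟩
    have : p ∈ M := by
      rw [← SetLike.mem_coe, hM]
      exact fun hpι => hp (hVι hpι)
    exact ⟨⟨p, this⟩, rfl⟩
  -- The charts which do not meet the tube: there the new metric is the old one.
  set K₁ : Set (PartialEquiv N (EuclideanSpace ℝ (Fin m))) :=
    {κ ∈ K | Disjoint κ.source τ.source} with hK₁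
  have hsub : ∀ κ ∈ K₁, κ.source ⊆ M := by
    rintro κ ⟨-, hκ⟩ p hp
    rw [hM]
    rintro ⟨q, rfl⟩
    exact disjoint_left.1 hκ hp (hτ.mem_source q)
  have hsm : ∀ κ ∈ K, IsSmoothChart κ := fun κ hκ => (hK.normalized κ hκ).isSmoothChart
  refine isUniformlyRegular_of_cylindricalEnd (H.isCylindricalEnd hJ hP hs₀)
    (restrictOpens M '' K) (restrictOpens M '' K₁) ?_ ?_ ?_ (image_mono fun κ hκ => hκ.1) ?_ ?_
    ((hgK.mono fun κ hκ => hκ.1).restrictOpens (fun κ hκ => hsm κ hκ.1) hsub ?_) ?_ hB ?_ hr ?_ ?_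
  · rintro _ ⟨κ, hκ, rfl⟩
    exact (hsm κ hκ).restrictOpens
  · rintro _ ⟨κ, hκ, rfl⟩ x hx
    exact (hK.normalized κ hκ).target_subset_openCube hx.1
  · intro i
    obtain ⟨C, hC⟩ := hK.transition_bounds i
    refine ⟨C, ?_⟩
    rintro _ ⟨κ, hκ, rfl⟩ _ ⟨κ', hκ', rfl⟩ x hx
    rw [iteratedFDerivWithin_restrictOpens (hsm κ hκ) hx]
    rw [overlap_restrictOpens] at hx
    exact hC κ hκ κ' hκ' x hx.1
  · rintro _ ⟨κ, hκ, rfl⟩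
    exact (hK.normalized κ hκ.1).restrictOpens (hsub κ hκ)
  · obtain ⟨d, hd⟩ := hK.finite_multiplicity
    refine ⟨d, fun p => le_trans ?_ (hd p)⟩
    refine (encard_le_encard ?_).trans (encard_image_le (restrictOpens M) _)
    rintro _ ⟨⟨κ, hκ, rfl⟩, hp⟩
    exact ⟨κ, ⟨hκ.1, hp⟩, rfl⟩
  · exact fun κ hκ p hp => h_away p fun hpτ => disjoint_left.1 hκ.2 hp hpτ
  · rintro _ ⟨κ, hκ, rfl⟩ a
    rw [disjoint_left]
    exact fun p hp hp' => disjoint_left.1 hκ.2 hp hp'.1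
  · intro p _
    obtain ⟨κ, hκ, hp, -⟩ := hcov p
    exact ⟨_, ⟨κ, hκ, rfl⟩, hp⟩
  · intro p
    obtain ⟨κ, hκ, hp, hpr⟩ := hcov p
    by_cases hd : Disjoint κ.source τ.source
    · refine .inl ⟨_, ⟨κ, ⟨hκ, hd⟩, rfl⟩, hp, ?_⟩
      rw [restrictOpens_target (hsub κ ⟨hκ, hd⟩)]
      exact hpr
    · have hpC : (p : N) ∈ C₂ := by
        obtain ⟨q, hq, hq'⟩ := not_disjoint_iff.1 hd
        exact hC₂K κ hκ ⟨q, hq, hC₁τ hq'⟩ hp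
      by_cases hpV : (p : N) ∈ V
      · right; right
        have hx := (H.mem_opens_iff hpV.1).1 p.2
        obtain ⟨a, h1, h2, h3, h4⟩ := hcore (τ p).1 (τ p).2 hx (τ.map_source hpV.1)
        have hS : s₀ + 2 ≤ S ‖(τ p).1‖ := by
          have := hP.height_le _ _ (norm_pos_iff.2 hx) (le_of_lt hpV.2)
          rwa [hP.height_radius _ (by linarith)] at this
        have hh : (c a).half → 0 ≤ (τ p).1 0 := fun hh =>
          ((hmem _ _).1 (τ.map_source hpV.1)).2 ((H.half_iff a).1 hh).1
        obtain ⟨h5, h6, h7⟩ := polarChart_core (hJ := hJ) (hP := hP) (hs₀ := hs₀) h1 h2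
          (by linarith) hS hh h3 h4
        exact ⟨a, ⟨hpV.1, h5⟩, h6, h7⟩
      · exact .inr (.inl ⟨hpC, hpV⟩)
  · intro p
    have hp : (p : N) ∉ range ι := by
      have := p.2
      rwa [← SetLike.mem_coe, hM] at this
    obtain ⟨W, hW, R, hR⟩ := hτ.exists_nhds_height_le hmem hP.height_le hp
    refine ⟨_, continuous_subtype_val.continuousAt.preimage_mem_nhds hW, R,
      fun a q hq hqs => ?_⟩
    have := hR q hq hqs.1
    rw [IsTubeEnd.tubeChart_apply, IsTubeEnd.polarChart_apply_axis]
    exact this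

end
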